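/- **Setting.** Let $d\ge 2$, let $\Omega\subset\mathbb R^d$ be a bounded open set (no smoothness of the boundary is needed), and let $$g_F(s)=a_0s^{\alpha_0}+a_1s^{\alpha_1}+\dots+a_Ns^{\alpha_N}\quad(s\ge 0),$$ where $N\ge1$, $0=\alpha_0<\alpha_1<\dots<\alpha_N$ are real, $a_i\ge 0$, $a_0>0$, $a_N>0$. For $\xi\ge0$ put $K(\xi)=1/g_F(s(\xi))$, where $s(\xi)$ is the unique $s\ge 0$ with $s\,g_F(s)=\xi$. Put $$a=\frac{\alpha_N}{\alpha_N+1},\qquad \beta=2-a,\qquad \lambda=\frac{2-a}{1-a},$$ and assume the degree condition $a\le \frac{4}{d+2}$. Write $(\cdot,\cdot)$ and $\|\cdot\|$ for the inner product and norm of $L^2(\Omega)$ (scalar or vector), $\|u\|_1=(\|u\|^2+\|\nabla u\|^2)^{1/2}$ for the norm of $H^1(\Omega)$, and $\|\cdot\|_{0,\beta}$ for the norm of $L^\beta(\Omega)$; $H^1_0(\Omega)$ is the closure of $C_c^\infty(\Omega)$ in $H^1(\Omega)$. Let $\phi\in C([0,\infty);H^1(\Omega))\cap C^1((0,\infty);H^1(\Omega))$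 (an extension of the boundary data to $\Omega$), let $f:(0,\infty)\to L^2(\Omega)$ be such that $\tilde f=f-\phi_t\in C^1((0,\infty);L^2(\Omega))$, and let $\rho^0\in H^1(\Omega)$. Let $\tilde\rho$ be a solution of the variational problem, in the following sense: $\tilde\rho:[0,\infty)\to H^1_0(\Omega)$, $$\tilde\rho\in C([0,\infty);H^1(\Omega))\cap C^1((0,\infty);H^1(\Omega))\cap C^2((0,\infty);L^2(\Omega)),$$ and, with $\rho=\tilde\rho+\phi$, $$(\tilde\rho_t,w)+(K(|\nabla\rho|)\nabla\rho,\nabla w)=(\tilde f,w)\quad\text{for all } w\in H^1_0(\Omega),\ t>0,\qquad \tilde\rho(0)=\tilde\rho^0:=\rho^0-\phi^0,\quad \phi^0=\phi(0).$$ (The time regularity holds in particular if $\tilde\rho$ is $C^2$ on $\bar\Omega\times(0,\infty)$ and $\tilde\rho,\nabla\tilde\rho$ are continuous on $\bar\Omega\times[0,\infty)$.) Put $$g(t)=\|\tilde f(t)\|^{\lambda}+\|\phi(t)\|_1^2\qquad(t>0).$$ Below, $Env\,g$ denotes an arbitrary continuous nondecreasing function on $(0,\infty)$ with $Env\,g\ge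 g$; each estimate containing $Env\,g$ is asserted for every such function. Limits superior and integrals take values in $[0,\infty]$. Put $$\mathcal A(t)=1+\|\rho^0\|_1^2+\|\phi^0\|^2+\int_0^te^{-\frac12(t-s)}\Big(\|\phi_t(s)\|_1^2+(Env\,g(s))^{\frac2\beta}\Big)ds,$$ and, for $0<t_0<1$, $$\begin{aligned}\mathcal B(t)={}&t_0^{-1}e^{-\frac14(t-t_0)}\Big\{1+\|\rho^0\|_1^2+\|\phi^0\|^2+\int_0^{t_0}\Big(\|\phi_t(s)\|_1^2+(Env\,g(s))^{\frac2\beta}\Big)ds\Big\}\\&+\int_0^te^{-\frac14(t-s)}\Big(1+\|\tilde\rho^0\|^2+\|\phi_t(s)\|_1^2+\|\tilde f_t(s)\|^2+(Env\,g(s))^{\frac2\beta}\Big)ds.\end{aligned}$$ **Theorem 4.6.** There is a constant $C>0$ depending only on $g_F$, $d$ and $\Omega$ (and not on $\phi,f,\rho^0,\tilde\rho$, $Env\,g$, $t_0$, $t$) such that the following hold. (i) For all $t>0$, $$\|\tilde\rho(t)\|\le C\Big(1+\|\rho^0\|+(Env\,g(t))^{\frac1\beta}\Big);$$ $$\limsup_{t\to\infty}\|\tilde\rho(t)\|^2\le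 C\Big(1+\limsup_{t\to\infty}g(t)\Big)^{\frac2\beta};$$ and if $\limsup_{t\to\infty}\|\tilde f(t)\|=\limsup_{t\to\infty}\|\phi(t)\|_1=0$, then $\limsup_{t\to\infty}\|\tilde\rho(t)\|^2=0$. (ii) For all $t>0$, $$\|\nabla\rho(t)\|_{0,\beta}^\beta\le C\mathcal A(t);$$ $$\limsup_{t\to\infty}\|\nabla\rho(t)\|_{0,\beta}^\beta\le C\Big(1+\limsup_{t\to\infty}\|\phi_t(t)\|_1^2+\big(\limsup_{t\to\infty}g(t)\big)^{\frac2\beta}\Big);$$ and if $\limsup_{t\to\infty}\|\tilde f(t)\|=\limsup_{t\to\infty}\|\phi(t)\|_1=\limsup_{t\to\infty}\|\phi_t(t)\|_1=0$, then $\limsup_{t\to\infty}\|\nabla\rho(t)\|_{0,\beta}=0$. (iii) For all $0<t_0<1$ and all $t\ge t_0$, $$\|\tilde\rho_t(t)\|^2\le C\mathcal B(t);$$ moreover $$\limsup_{t\to\infty}\|\tilde\rho_t(t)\|^2\le C\Big(1+\big(\limsup_{t\to\infty}g(t)\big)^{\frac2\beta}+\limsup_{t\to\infty}\|\phi_t(t)\|_1^2+\limsup_{t\to\infty}\|\tilde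 f_t(t)\|^2\Big).$$ (iv) For all $t\ge1$, $$\|\nabla\rho(t)\|_{0,\beta}^\beta\le C\Big(1+\|\tilde\rho^0\|^2+(Env\,g(t))^{\frac2\beta}+\int_{t-1}^t\|\phi_t(s)\|_1^2\,ds\Big),$$ $$\|\tilde\rho_t(t)\|^2\le C\Big(1+\|\tilde\rho^0\|^2+(Env\,g(t))^{\frac2\beta}+\int_{t-1}^t\big(\|\phi_t(s)\|_1^2+\|\tilde f_t(s)\|^2\big)ds\Big).$$ -/

import Mathlib

open MeasureTheory Filter Set
open scoped ENNReal NNReal Topology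

noncomputable section

namespace Forchheimer

/-! ### The generalized polynomial `g`, the exponents and the function `K` -/

/-- A generalized polynomial `g(s) = a₀ s ^ α₀ + ⋯ + a_N s ^ α_N` with `N ≥ 1`,
`0 = α₀ < α₁ < ⋯ < α_N`, coefficients `aᵢ ≥ 0`, `a₀ > 0` and `a_N > 0`. -/
structure GenPoly where
  N : ℕ
  one_le_N : 1 ≤ N
  α : Fin (N + 1) → ℝ
  coeff : Fin (N + 1) → ℝ
  α_zero : α 0 = 0
  α_strictMono : StrictMono α
  coeff_nonneg : ∀ i, 0 ≤ coeff i
  coeff_zero_pos : 0 < coeff 0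
  coeff_last_pos : 0 < coeff (Fin.last N)

namespace GenPoly

variable (P : GenPoly)

/-- The value `g(s)`, meant for `s ≥ 0`. -/
def eval (s : ℝ) : ℝ := ∑ i, P.coeff i * s ^ P.α i

/-- `deg g = α_N`. -/
def deg : ℝ := P.α (Fin.last P.N)

/-- `a = deg g / (deg g + 1)`. -/
def a : ℝ := P.deg / (P.deg + 1)

/-- `β = 2 - a`. -/
def β : ℝ := 2 - P.a

/-- `λ = (2 - a) / (1 - a)`. -/
def lam : ℝ := (2 - P.a) / (1 - P.a)

/-- `s(ξ)`: for `ξ ≥ 0`, the unique `s ≥ 0` with `s g(s) = ξ`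
(see `existsUnique_root` and `root_spec`). -/
def root (ξ : ℝ) : ℝ := sInf {s : ℝ | 0 ≤ s ∧ s * P.eval s = ξ}

/-- `K(ξ) = 1 / g(s(ξ))`, meant for `ξ ≥ 0`. -/
def K (ξ : ℝ) : ℝ := 1 / P.eval (P.root ξ)

theorem α_nonneg (i : Fin (P.N + 1)) : 0 ≤ P.α i := by
  rw [← P.α_zero]
  exact P.α_strictMono.monotone (Fin.zero_le i)

theorem coeff_zero_le_eval {s : ℝ} (hs : 0 ≤ s) : P.coeff 0 ≤ P.eval s := by
  have h : P.coeff 0 * s ^ P.α 0 ≤ P.eval s :=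
    Finset.single_le_sum (f := fun i => P.coeff i * s ^ P.α i)
      (fun i _ => mul_nonneg (P.coeff_nonneg i) (Real.rpow_nonneg hs _)) (Finset.mem_univ 0)
  simpa [P.α_zero] using h

theorem eval_mono {s t : ℝ} (hs : 0 ≤ s) (hst : s ≤ t) : P.eval s ≤ P.eval t :=
  Finset.sum_le_sum fun i _ =>
    mul_le_mul_of_nonneg_left (Real.rpow_le_rpow hs hst (P.α_nonneg i)) (P.coeff_nonneg i)

theorem continuous_eval : Continuous P.eval := by
  unfold eval
  exact continuous_finsetSum _ fun i _ =>
    continuous_const.mul (Real.continuous_rpow_const (P.α_nonneg i))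

theorem existsUnique_root {ξ : ℝ} (hξ : 0 ≤ ξ) : ∃! s : ℝ, 0 ≤ s ∧ s * P.eval s = ξ := by
  have h0 := P.coeff_zero_pos
  have hR : 0 ≤ ξ / P.coeff 0 := div_nonneg hξ h0.le
  have hc : ContinuousOn (fun s => s * P.eval s) (Icc 0 (ξ / P.coeff 0)) :=
    (continuous_id.mul P.continuous_eval).continuousOn
  have hmem : ξ ∈ Icc ((0 : ℝ) * P.eval 0) (ξ / P.coeff 0 * P.eval (ξ / P.coeff 0)) := by
    refine ⟨by simpa using hξ, ?_⟩
    calc ξ = ξ / P.coeff 0 * P.coeff 0 := by field_simp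
      _ ≤ _ := mul_le_mul_of_nonneg_left (P.coeff_zero_le_eval hR) hR
  obtain ⟨s, hs, hsξ⟩ := intermediate_value_Icc hR hc hmem
  have key : ∀ u v : ℝ, 0 ≤ u → u < v → u * P.eval u < v * P.eval v := fun u v hu huv =>
    mul_lt_mul huv (P.eval_mono hu huv.le) (h0.trans_le (P.coeff_zero_le_eval hu))
      (hu.trans huv.le)
  refine ⟨s, ⟨hs.1, hsξ⟩, ?_⟩
  rintro t ⟨ht, htξ⟩
  simp only at hsξ
  rcases lt_trichotomy t s with h | h | h
  · have := key t s ht h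
    linarith
  · exact h
  · have := key s t hs.1 h
    linarith

theorem root_spec {ξ : ℝ} (hξ : 0 ≤ ξ) :
    0 ≤ P.root ξ ∧ P.root ξ * P.eval (P.root ξ) = ξ := by
  obtain ⟨s, hs, hu⟩ := P.existsUnique_root hξ
  have hset : {s : ℝ | 0 ≤ s ∧ s * P.eval s = ξ} = {s} := by
    ext t
    exact ⟨fun ht => hu t ht, fun ht => by rw [mem_singleton_iff.1 ht]; exact hs⟩
  have : P.root ξ = s := by rw [root, hset, csInf_singleton]
  rw [this]
  exact hs

end GenPoly

/-! ### The Sobolev spaces `H¹(Ω)` and `H¹₀(Ω)` -/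

/-- `L²(Ω)`. -/
abbrev L2 {d : ℕ} (Ω : Set (EuclideanSpace ℝ (Fin d))) : Type :=
  Lp ℝ 2 (volume.restrict Ω)

/-- `(L²(Ω))ᵈ`, with the norm `(∫_Ω |v|²)^(1/2)`. -/
abbrev L2Vec {d : ℕ} (Ω : Set (EuclideanSpace ℝ (Fin d))) : Type :=
  Lp (EuclideanSpace ℝ (Fin d)) 2 (volume.restrict Ω)

/-- `η ∈ C_c^∞(Ω)`. -/
structure IsTestFunction {d : ℕ} (Ω : Set (EuclideanSpace ℝ (Fin d)))
    (η : EuclideanSpace ℝ (Fin d) → ℝ) : Prop where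
  contDiff : ContDiff ℝ (⊤ : ℕ∞) η
  hasCompactSupport : HasCompactSupport η
  tsupport_subset : tsupport η ⊆ Ω

/-- `G` is the weak gradient of `u` in `Ω`: `∫_Ω u ∂ᵢη = - ∫_Ω Gᵢ η` for all `η ∈ C_c^∞(Ω)`
and all `i`. -/
def IsWeakGradient {d : ℕ} (Ω : Set (EuclideanSpace ℝ (Fin d))) (u : L2 Ω) (G : L2Vec Ω) : Prop :=
  ∀ η : EuclideanSpace ℝ (Fin d) → ℝ, IsTestFunction Ω η → ∀ i : Fin d,
    ∫ x in Ω, u x * fderiv ℝ η x (EuclideanSpace.single i 1) = - ∫ x in Ω, G x i * η x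

section

variable {d : ℕ} {Ω : Set (EuclideanSpace ℝ (Fin d))}

theorem IsTestFunction.integrable_left {η : EuclideanSpace ℝ (Fin d) → ℝ}
    (hη : IsTestFunction Ω η) (u : L2 Ω) (i : Fin d) :
    IntegrableOn (fun x => u x * fderiv ℝ η x (EuclideanSpace.single i 1)) Ω := by
  have hcont : Continuous (fun x => fderiv ℝ η x (EuclideanSpace.single i 1)) :=
    (hη.contDiff.continuous_fderiv (by simp)).clm_apply continuous_const
  have hsupp : HasCompactSupport (fun x => fderiv ℝ η x (EuclideanSpace.single i 1)) :=
    hη.hasCompactSupport.fderiv_apply (𝕜 := ℝ) _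
  exact (Lp.memLp u).integrable_mul
    ((hcont.memLp_of_hasCompactSupport (p := 2) (μ := volume) hsupp).restrict Ω)

theorem IsTestFunction.integrable_right {η : EuclideanSpace ℝ (Fin d) → ℝ}
    (hη : IsTestFunction Ω η) (G : L2Vec Ω) (i : Fin d) :
    IntegrableOn (fun x => G x i * η x) Ω := by
  have hG : MemLp (fun x => G x i) 2 (volume.restrict Ω) :=
    (EuclideanSpace.proj i : EuclideanSpace ℝ (Fin d) →L[ℝ] ℝ).comp_memLp' (Lp.memLp G)
  exact hG.integrable_mul
    ((hη.contDiff.continuous.memLp_of_hasCompactSupport (p := 2) (μ := volume)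
      hη.hasCompactSupport).restrict Ω)

theorem IsWeakGradient.add {u v : L2 Ω} {G H : L2Vec Ω} (hu : IsWeakGradient Ω u G)
    (hv : IsWeakGradient Ω v H) : IsWeakGradient Ω (u + v) (G + H) := by
  intro η hη i
  have h1 : ∫ x in Ω, (u + v : L2 Ω) x * fderiv ℝ η x (EuclideanSpace.single i 1) =
      ∫ x in Ω, (u x * fderiv ℝ η x (EuclideanSpace.single i 1) +
        v x * fderiv ℝ η x (EuclideanSpace.single i 1)) := by
    refine integral_congr_ae ?_
    filter_upwards [Lp.coeFn_add u v] with x hx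
    rw [hx, Pi.add_apply, add_mul]
  have h2 : ∫ x in Ω, (G + H : L2Vec Ω) x i * η x =
      ∫ x in Ω, (G x i * η x + H x i * η x) := by
    refine integral_congr_ae ?_
    filter_upwards [Lp.coeFn_add G H] with x hx
    rw [hx, Pi.add_apply, PiLp.add_apply, add_mul]
  rw [h1, h2, integral_add (hη.integrable_left u i) (hη.integrable_left v i),
    integral_add (hη.integrable_right G i) (hη.integrable_right H i), hu η hη i, hv η hη i]
  ring

theorem IsWeakGradient.smul (c : ℝ) {u : L2 Ω} {G : L2Vec Ω} (hu : IsWeakGradient Ω u G) :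
    IsWeakGradient Ω (c • u) (c • G) := by
  intro η hη i
  have h1 : ∫ x in Ω, (c • u : L2 Ω) x * fderiv ℝ η x (EuclideanSpace.single i 1) =
      ∫ x in Ω, c * (u x * fderiv ℝ η x (EuclideanSpace.single i 1)) := by
    refine integral_congr_ae ?_
    filter_upwards [Lp.coeFn_smul c u] with x hx
    rw [hx, Pi.smul_apply, smul_eq_mul, mul_assoc]
  have h2 : ∫ x in Ω, (c • G : L2Vec Ω) x i * η x = ∫ x in Ω, c * (G x i * η x) := by
    refine integral_congr_ae ?_
    filter_upwards [Lp.coeFn_smul c G] with x hx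
    rw [hx, Pi.smul_apply, PiLp.smul_apply, smul_eq_mul, mul_assoc]
  rw [h1, h2, integral_const_mul, integral_const_mul, hu η hη i]
  ring

theorem IsWeakGradient.zero : IsWeakGradient Ω (0 : L2 Ω) (0 : L2Vec Ω) := by
  intro η _ i
  have h1 : ∫ x in Ω, (0 : L2 Ω) x * fderiv ℝ η x (EuclideanSpace.single i 1) =
      ∫ _x in Ω, (0 : ℝ) := by
    refine integral_congr_ae ?_
    filter_upwards [Lp.coeFn_zero ℝ 2 (volume.restrict Ω)] with x hx
    rw [hx, Pi.zero_apply, zero_mul]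
  have h2 : ∫ x in Ω, (0 : L2Vec Ω) x i * η x = ∫ _x in Ω, (0 : ℝ) := by
    refine integral_congr_ae ?_
    filter_upwards [Lp.coeFn_zero (EuclideanSpace ℝ (Fin d)) 2 (volume.restrict Ω)] with x hx
    rw [hx, Pi.zero_apply, PiLp.zero_apply, zero_mul]
  rw [h1, h2]
  simp

end

/-- `H¹(Ω)`, realized as the space of the pairs `(u, ∇u)` in `L²(Ω) × (L²(Ω))ᵈ`; its norm is
`‖u‖₁ = (‖u‖² + ‖∇u‖²)^(1/2)`. -/
def H1 {d : ℕ} (Ω : Set (EuclideanSpace ℝ (Fin d))) :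
    Submodule ℝ (WithLp 2 (L2 Ω × L2Vec Ω)) where
  carrier := {p | IsWeakGradient Ω p.fst p.snd}
  add_mem' hp hq := hp.add hq
  zero_mem' := IsWeakGradient.zero
  smul_mem' c _ hp := hp.smul c

/-- The element of `L²(Ω)` underlying an element of `H¹(Ω)`. -/
def toL2 {d : ℕ} {Ω : Set (EuclideanSpace ℝ (Fin d))} (u : H1 Ω) : L2 Ω := u.1.fst

/-- The weak gradient of an element of `H¹(Ω)`. -/
def grad {d : ℕ} {Ω : Set (EuclideanSpace ℝ (Fin d))} (u : H1 Ω) : L2Vec Ω := u.1.snd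

theorem norm_sq_H1 {d : ℕ} {Ω : Set (EuclideanSpace ℝ (Fin d))} (u : H1 Ω) :
    ‖u‖ ^ 2 = ‖toL2 u‖ ^ 2 + ‖grad u‖ ^ 2 :=
  WithLp.prod_norm_sq_eq_of_L2 u.1

/-- The elements of `H¹(Ω)` that are (represented by) functions in `C_c^∞(Ω)`. -/
def testH1 {d : ℕ} (Ω : Set (EuclideanSpace ℝ (Fin d))) : Set (H1 Ω) :=
  {u | ∃ η : EuclideanSpace ℝ (Fin d) → ℝ, IsTestFunction Ω η ∧ toL2 u =ᵐ[volume.restrict Ω] η}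

/-- `H¹₀(Ω)`: the closure of `C_c^∞(Ω)` in `H¹(Ω)`. -/
def H01 {d : ℕ} (Ω : Set (EuclideanSpace ℝ (Fin d))) : Set (H1 Ω) := closure (testH1 Ω)

/-- `‖∇u‖_{0,q}`, the `L^q(Ω)` norm of the gradient. -/
def gradNorm {d : ℕ} {Ω : Set (EuclideanSpace ℝ (Fin d))} (q : ℝ) (u : H1 Ω) : ℝ≥0∞ :=
  eLpNorm (grad u) (ENNReal.ofReal q) (volume.restrict Ω)

/-! ### The variational problem -/

/-- `F` is a continuous, increasing envelope of `f` on `I`. -/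
structure IsEnvelope (I : Set ℝ) (f F : ℝ → ℝ) : Prop where
  continuousOn : ContinuousOn F I
  monotoneOn : MonotoneOn F I
  le : ∀ t ∈ I, f t ≤ F t

section

variable {d : ℕ} {Ω : Set (EuclideanSpace ℝ (Fin d))}

/-- `f̃ = f - φ_t`. -/
def fTilde (φ : ℝ → H1 Ω) (f : ℝ → L2 Ω) (t : ℝ) : L2 Ω := f t - toL2 (deriv φ t)

/-- Regularity in time of the extension `φ` of the boundary data and of the source:
`φ ∈ C([0,∞); H¹(Ω)) ∩ C¹((0,∞); H¹(Ω))` and `f̃ ∈ C¹((0,∞); L²(Ω))`. -/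
structure IsRegularData (φ : ℝ → H1 Ω) (f : ℝ → L2 Ω) : Prop where
  continuousOn_φ : ContinuousOn φ (Ici 0)
  contDiffOn_φ : ContDiffOn ℝ 1 φ (Ioi 0)
  contDiffOn_fTilde : ContDiffOn ℝ 1 (fTilde φ f) (Ioi 0)

/-- `ρ̃ : [0,∞) → H¹₀(Ω)` solves, with `ρ = ρ̃ + φ`,
`(ρ̃_t, w) + (K(|∇ρ|)∇ρ, ∇w) = (f̃, w)` for all `w ∈ H¹₀(Ω)` and `t > 0`, and `ρ(0) = ρ⁰`.
The regularity required is `ρ̃ ∈ C([0,∞); H¹(Ω)) ∩ C¹((0,∞); H¹(Ω)) ∩ C²((0,∞); L²(Ω))`; it holds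
as soon as `ρ̃` is `C²` on `closure Ω × (0,∞)` and `ρ̃`, `∇ρ̃` are continuous on
`closure Ω × [0,∞)`. -/
structure IsWeakSolution (P : GenPoly) (φ : ℝ → H1 Ω) (f : ℝ → L2 Ω) (ρ₀ : H1 Ω)
    (ρt : ℝ → H1 Ω) : Prop where
  mem_H01 : ∀ t, 0 ≤ t → ρt t ∈ H01 Ω
  continuousOn : ContinuousOn ρt (Ici 0)
  contDiffOn_H1 : ContDiffOn ℝ 1 ρt (Ioi 0)
  contDiffOn_L2 : ContDiffOn ℝ 2 (fun t => toL2 (ρt t)) (Ioi 0)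
  initial : ρt 0 = ρ₀ - φ 0
  variational : ∀ t, 0 < t → ∀ w ∈ H01 Ω,
    inner ℝ (toL2 (deriv ρt t)) (toL2 w)
      + ∫ x in Ω, P.K ‖grad (ρt t + φ t) x‖ * inner ℝ (grad (ρt t + φ t) x) (grad w x)
    = inner ℝ (fTilde φ f t) (toL2 w)

/-- `g(t) = ‖f̃(t)‖^λ + ‖φ(t)‖₁²`. -/
def gFun (P : GenPoly) (φ : ℝ → H1 Ω) (f : ℝ → L2 Ω) (t : ℝ) : ℝ :=
  ‖fTilde φ f t‖ ^ P.lam + ‖φ t‖ ^ 2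

/-- `𝒜(t) = 1 + ‖ρ⁰‖₁² + ‖φ⁰‖² + ∫₀ᵗ e^{-(t-s)/2} (‖φ_t(s)‖₁² + G(s)^{2/β}) ds`,
where `G` stands for `Env g`; the integral may be infinite. -/
def boundA (P : GenPoly) (φ : ℝ → H1 Ω) (ρ₀ : H1 Ω) (G : ℝ → ℝ) (t : ℝ) : ℝ≥0∞ :=
  ENNReal.ofReal (1 + ‖ρ₀‖ ^ 2 + ‖toL2 (φ 0)‖ ^ 2)
    + ∫⁻ s in Ioo 0 t,
        ENNReal.ofReal (Real.exp (-(1 / 2) * (t - s)) * (‖deriv φ s‖ ^ 2 + G s ^ (2 / P.β)))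

/-- `ℬ(t) = t₀⁻¹ e^{-(t-t₀)/4} {1 + ‖ρ⁰‖₁² + ‖φ⁰‖² + ∫₀^{t₀} (‖φ_t(s)‖₁² + G(s)^{2/β}) ds}`
`+ ∫₀ᵗ e^{-(t-s)/4} (1 + ‖ρ̃⁰‖² + ‖φ_t(s)‖₁² + ‖f̃_t(s)‖² + G(s)^{2/β}) ds`,
where `G` stands for `Env g` and `ρ̃⁰ = ρ⁰ - φ⁰`; the integrals may be infinite. -/
def boundB (P : GenPoly) (φ : ℝ → H1 Ω) (f : ℝ → L2 Ω) (ρ₀ : H1 Ω) (G : ℝ → ℝ) (t₀ t : ℝ) :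
    ℝ≥0∞ :=
  ENNReal.ofReal (t₀⁻¹ * Real.exp (-(1 / 4) * (t - t₀)))
      * (ENNReal.ofReal (1 + ‖ρ₀‖ ^ 2 + ‖toL2 (φ 0)‖ ^ 2)
        + ∫⁻ s in Ioo 0 t₀, ENNReal.ofReal (‖deriv φ s‖ ^ 2 + G s ^ (2 / P.β)))
    + ∫⁻ s in Ioo 0 t,
        ENNReal.ofReal (Real.exp (-(1 / 4) * (t - s))
          * (1 + ‖toL2 (ρ₀ - φ 0)‖ ^ 2 + ‖deriv φ s‖ ^ 2 + ‖deriv (fTilde φ f) s‖ ^ 2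
            + G s ^ (2 / P.β)))

end

end Forchheimer

end

/-!
The flux `y ↦ K(|y|) y` is monotone and cocoercive, and `K(ξ) ξ²` grows like `ξ ^ β`. Testing the
equation with `ρ̃` and `ρ̃_t`, and its time derivative with `ρ̃_t`, gives differential inequalities
for `‖ρ̃‖²`, for the energy `∫ Φ(|∇ρ|)` with `Φ' = K(ξ) ξ`, and for `‖ρ̃_t‖²`.

The degree condition says `2d / (d + 2) ≤ β`, so the Poincaré–Sobolev inequality bounds `‖ρ̃‖ ^ β`
by a multiple of `∫ |∇ρ̃| ^ β`. Hence `m = ‖ρ̃‖²` satisfies `m' ≤ -c m ^ (β / 2) + C (1 + g)`, which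
keeps `m` below a multiple of `1 + g ^ (2 / β)`. The other two inequalities are then integrated with
exponential weights, and with the weights `t - s` and `(t - s)²` to forget the initial values.
-/

noncomputable section

namespace Forchheimer

namespace GenPoly

variable (P : GenPoly)

theorem deg_pos : 0 < P.deg :=
  P.α_zero.symm.trans_lt (P.α_strictMono (Fin.lt_def.2 P.one_le_N))

theorem a_pos : 0 < P.a := div_pos P.deg_pos (by linarith [P.deg_pos])

theorem one_sub_a : 1 - P.a = 1 / (P.deg + 1) := by
  have := P.deg_pos
  unfold a
  field_simp
  ring

theorem a_lt_one : P.a < 1 := by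
  have : 0 < 1 / (P.deg + 1) := one_div_pos.2 (by linarith [P.deg_pos])
  linarith [P.one_sub_a]

theorem one_lt_β : 1 < P.β := by
  unfold β
  linarith [P.a_lt_one]

theorem β_pos : 0 < P.β := one_pos.trans P.one_lt_β

theorem β_lt_two : P.β < 2 := by
  unfold β
  linarith [P.a_pos]

theorem holderConjugate : P.β.HolderConjugate P.lam := by
  refine Real.holderConjugate_iff.2 ⟨P.one_lt_β, ?_⟩
  have : 0 < 2 - P.a := P.β_pos
  have : 0 < 1 - P.a := sub_pos.2 P.a_lt_one
  unfold β lam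
  field_simp
  ring

theorem two_le_lam : 2 ≤ P.lam := by
  rw [lam, le_div_iff₀ (sub_pos.2 P.a_lt_one)]
  linarith [P.a_pos]

theorem eval_pos {s : ℝ} (hs : 0 ≤ s) : 0 < P.eval s :=
  P.coeff_zero_pos.trans_le (P.coeff_zero_le_eval hs)

theorem root_nonneg {r : ℝ} (hr : 0 ≤ r) : 0 ≤ P.root r := (P.root_spec hr).1

theorem root_mul_eval {r : ℝ} (hr : 0 ≤ r) : P.root r * P.eval (P.root r) = r :=
  (P.root_spec hr).2

theorem K_mul_self {r : ℝ} (hr : 0 ≤ r) : P.K r * r = P.root r := by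
  rw [K, one_div, inv_mul_eq_div, div_eq_iff (P.eval_pos (P.root_nonneg hr)).ne',
    P.root_mul_eval hr]

theorem K_pos {r : ℝ} (hr : 0 ≤ r) : 0 < P.K r :=
  one_div_pos.2 (P.eval_pos (P.root_nonneg hr))

theorem eval_root_mul_K {r : ℝ} (hr : 0 ≤ r) : P.eval (P.root r) * P.K r = 1 :=
  mul_one_div_cancel (P.eval_pos (P.root_nonneg hr)).ne'

theorem root_mono {r s : ℝ} (hr : 0 ≤ r) (hrs : r ≤ s) : P.root r ≤ P.root s := by
  have hs := hr.trans hrs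
  by_contra! h
  have : P.root s * P.eval (P.root s) < P.root r * P.eval (P.root r) :=
    mul_lt_mul h (P.eval_mono (P.root_nonneg hs) h.le) (P.eval_pos (P.root_nonneg hs))
      (P.root_nonneg hr)
  rw [P.root_mul_eval hr, P.root_mul_eval hs] at this
  exact hrs.not_gt this

theorem root_zero : P.root 0 = 0 := by
  simpa using (P.K_mul_self le_rfl).symm

theorem root_pos {r : ℝ} (hr : 0 < r) : 0 < P.root r := by
  rw [← P.K_mul_self hr.le]
  exact mul_pos (P.K_pos hr.le) hr

theorem K_anti {r s : ℝ} (hr : 0 ≤ r) (hrs : r ≤ s) : P.K s ≤ P.K r :=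
  one_div_le_one_div_of_le (P.eval_pos (P.root_nonneg hr))
    (P.eval_mono (P.root_nonneg hr) (P.root_mono hr hrs))

section Flux

variable {V : Type*} [NormedAddCommGroup V] [InnerProductSpace ℝ V]

/-- The vector field `y ↦ K(|y|) y`, through which the gradient enters the equation. -/
def flux (y : V) : V := P.K ‖y‖ • y

theorem norm_flux (y : V) : ‖P.flux y‖ = P.root ‖y‖ := by
  rw [flux, norm_smul, Real.norm_of_nonneg (P.K_pos (norm_nonneg y)).le,
    P.K_mul_self (norm_nonneg y)]

theorem flux_zero : P.flux (0 : V) = 0 := smul_zero _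

theorem inner_flux_self (y : V) : inner ℝ (P.flux y) y = P.root ‖y‖ * ‖y‖ := by
  rw [flux, real_inner_smul_left, real_inner_self_eq_norm_sq, ← P.K_mul_self (norm_nonneg y)]
  ring

theorem eval_smul_flux (y : V) : P.eval ‖P.flux y‖ • P.flux y = y := by
  rw [norm_flux, flux, smul_smul, P.eval_root_mul_K (norm_nonneg y), one_smul]

theorem eval_smul_strongly_monotone (v w : V) :
    P.coeff 0 * ‖v - w‖ ^ 2 ≤ inner ℝ (v - w) (P.eval ‖v‖ • v - P.eval ‖w‖ • w) := by
  have polarization : inner ℝ (v - w) (P.eval ‖v‖ • v - P.eval ‖w‖ • w) =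
      (P.eval ‖v‖ + P.eval ‖w‖) / 2 * ‖v - w‖ ^ 2
        + (P.eval ‖v‖ - P.eval ‖w‖) * (‖v‖ - ‖w‖) * ((‖v‖ + ‖w‖) / 2) := by
    rw [norm_sub_sq_real]
    simp only [inner_sub_left, inner_sub_right, real_inner_smul_right,
      real_inner_self_eq_norm_sq, real_inner_comm v w]
    ring
  have eval_mono_mul : 0 ≤ (P.eval ‖v‖ - P.eval ‖w‖) * (‖v‖ - ‖w‖) := by
    rcases le_total ‖v‖ ‖w‖ with h | h
    · exact mul_nonneg_of_nonpos_of_nonpos (sub_nonpos.2 (P.eval_mono (norm_nonneg v) h))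
        (sub_nonpos.2 h)
    · exact mul_nonneg (sub_nonneg.2 (P.eval_mono (norm_nonneg w) h)) (sub_nonneg.2 h)
  have coeff_le : P.coeff 0 ≤ (P.eval ‖v‖ + P.eval ‖w‖) / 2 := by
    linarith [P.coeff_zero_le_eval (norm_nonneg v), P.coeff_zero_le_eval (norm_nonneg w)]
  rw [polarization]
  exact le_add_of_le_of_nonneg (by gcongr) (mul_nonneg eval_mono_mul (by positivity))

theorem flux_cocoercive (y z : V) :
    P.coeff 0 * ‖P.flux y - P.flux z‖ ^ 2 ≤ inner ℝ (P.flux y - P.flux z) (y - z) := by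
  simpa only [eval_smul_flux] using P.eval_smul_strongly_monotone (P.flux y) (P.flux z)

theorem lipschitzWith_flux : LipschitzWith (P.coeff 0)⁻¹.toNNReal (P.flux : V → V) := by
  refine LipschitzWith.of_dist_le_mul fun y z => ?_
  rw [dist_eq_norm, dist_eq_norm, Real.coe_toNNReal _ (inv_nonneg.2 P.coeff_zero_pos.le),
    inv_mul_eq_div, le_div_iff₀' P.coeff_zero_pos]
  rcases (norm_nonneg (P.flux y - P.flux z)).eq_or_lt with h | h
  · rw [← h, mul_zero]
    exact norm_nonneg _
  · refine le_of_mul_le_mul_left ?_ h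
    linarith [(P.flux_cocoercive y z).trans (real_inner_le_norm _ _)]

end Flux

theorem continuous_root_abs : Continuous fun x : ℝ => P.root |x| :=
  P.lipschitzWith_flux.continuous.norm.congr P.norm_flux

/-- The potential `r ↦ ∫₀ʳ K(ξ) ξ dξ`, of which `y ↦ K(|y|) y` is the gradient at `r = |y|`.
The integrand `K(ξ) ξ = s(ξ)` is extended evenly to negative `ξ`, which makes it continuous. -/
def potential (r : ℝ) : ℝ := ∫ x in (0 : ℝ)..r, P.root |x|

theorem continuous_potential : Continuous P.potential :=
  intervalIntegral.continuous_primitive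
    (fun _ _ => P.continuous_root_abs.intervalIntegrable _ _) 0

theorem root_mul_sub_le {r s : ℝ} (hr : 0 ≤ r) (hs : 0 ≤ s) :
    P.root r * (s - r) ≤ P.potential s - P.potential r := by
  have hint : ∀ x y, IntervalIntegrable (fun x => P.root |x|) volume x y :=
    P.continuous_root_abs.intervalIntegrable
  rw [potential, potential, intervalIntegral.integral_interval_sub_left (hint 0 s) (hint 0 r)]
  rcases le_total r s with h | h
  · have := intervalIntegral.integral_mono_on h intervalIntegrable_const (hint r s)
      fun x hx => P.root_mono hr (hx.1.trans (le_abs_self x))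
    rwa [intervalIntegral.integral_const, smul_eq_mul, mul_comm] at this
  · have := intervalIntegral.integral_mono_on h (hint s r) intervalIntegrable_const
      fun x hx => P.root_mono (abs_nonneg x) ((abs_of_nonneg (hs.trans hx.1)).trans_le hx.2)
    rw [intervalIntegral.integral_const, smul_eq_mul] at this
    rw [intervalIntegral.integral_symm]
    linarith

theorem potential_zero : P.potential 0 = 0 := intervalIntegral.integral_same

theorem potential_nonneg {r : ℝ} (hr : 0 ≤ r) : 0 ≤ P.potential r := by
  simpa [P.root_zero, P.potential_zero] using P.root_mul_sub_le le_rfl hr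

theorem potential_le {r : ℝ} (hr : 0 ≤ r) : P.potential r ≤ P.root r * r := by
  have := P.root_mul_sub_le hr le_rfl
  rw [P.potential_zero] at this
  linarith

theorem root_mul_le_potential {r : ℝ} (hr : 0 ≤ r) : P.root r * r ≤ 2 * P.potential r := by
  have : ∫ x in (0 : ℝ)..r, P.K r * x ≤ P.potential r := by
    refine intervalIntegral.integral_mono_on hr
      (continuous_const_mul _ |>.intervalIntegrable _ _)
      (P.continuous_root_abs.intervalIntegrable _ _) fun x hx => ?_
    rw [abs_of_nonneg hx.1, ← P.K_mul_self hx.1]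
    exact mul_le_mul_of_nonneg_right (P.K_anti hx.1 hx.2) hx.1
  rw [intervalIntegral.integral_const_mul, integral_id] at this
  rw [← P.K_mul_self hr]
  linarith

theorem inner_flux_sub_le {V : Type*} [NormedAddCommGroup V] [InnerProductSpace ℝ V] (y z : V) :
    inner ℝ (P.flux y) (z - y) ≤ P.potential ‖z‖ - P.potential ‖y‖ :=
  calc inner ℝ (P.flux y) (z - y) ≤ P.root ‖y‖ * ‖z‖ - P.root ‖y‖ * ‖y‖ := by
        rw [inner_sub_right, inner_flux_self, ← norm_flux]
        gcongr
        exact real_inner_le_norm _ _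
    _ ≤ _ := by
        rw [← mul_sub]
        exact P.root_mul_sub_le (norm_nonneg y) (norm_nonneg z)

theorem exists_eval_le_rpow {s₀ : ℝ} (hs₀ : 0 < s₀) :
    ∃ B, 0 < B ∧ ∀ s, s₀ ≤ s → P.eval s ≤ B * s ^ P.deg := by
  refine ⟨∑ i, P.coeff i * s₀ ^ (P.α i - P.deg), ?_, fun s hs => ?_⟩
  · refine Finset.sum_pos' (fun i _ => mul_nonneg (P.coeff_nonneg i) (by positivity))
      ⟨0, Finset.mem_univ _, mul_pos P.coeff_zero_pos (by positivity)⟩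
  rw [eval, Finset.sum_mul]
  refine Finset.sum_le_sum fun i _ => ?_
  have hs_pos := hs₀.trans_le hs
  have hα : P.α i - P.deg ≤ 0 := sub_nonpos.2 (P.α_strictMono.monotone (Fin.le_last i))
  rw [mul_assoc]
  refine mul_le_mul_of_nonneg_left ?_ (P.coeff_nonneg i)
  calc s ^ P.α i = s ^ (P.α i - P.deg) * s ^ P.deg := by
        rw [← Real.rpow_add hs_pos, sub_add_cancel]
    _ ≤ s₀ ^ (P.α i - P.deg) * s ^ P.deg := by
        gcongr ?_ * _
        exact Real.rpow_le_rpow_of_nonpos hs₀ hs hα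

theorem exists_rpow_one_sub_a_le {r₀ : ℝ} (hr₀ : 0 < r₀) :
    ∃ C, 0 < C ∧ ∀ r, r₀ ≤ r → r ^ (1 - P.a) ≤ C * P.root r := by
  obtain ⟨B, hB, hroot⟩ := P.exists_eval_le_rpow (P.root_pos hr₀)
  refine ⟨B ^ (1 - P.a), Real.rpow_pos_of_pos hB _, fun r hr => ?_⟩
  have hr_pos := hr₀.trans_le hr
  have hs := P.root_pos hr_pos
  calc r ^ (1 - P.a)
      = (P.root r * P.eval (P.root r)) ^ (1 - P.a) := by rw [P.root_mul_eval hr_pos.le]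
    _ ≤ (P.root r * (B * P.root r ^ P.deg)) ^ (1 - P.a) := by
        have := P.eval_pos hs.le
        have := P.a_lt_one
        gcongr
        exact hroot _ (P.root_mono hr₀.le hr)
    _ = (B * P.root r ^ (P.deg + 1)) ^ (1 - P.a) := by
        rw [Real.rpow_add_one hs.ne']
        ring_nf
    _ = B ^ (1 - P.a) * P.root r := by
        rw [Real.mul_rpow hB.le (by positivity), ← Real.rpow_mul hs.le, one_sub_a,
          mul_one_div_cancel (by linarith [P.deg_pos]), Real.rpow_one]

theorem exists_rpow_β_le {δ : ℝ} (hδ : 0 < δ) :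
    ∃ C, 0 < C ∧ ∀ r, 0 ≤ r → r ^ P.β ≤ δ + C * (P.root r * r) := by
  have hr₀ : 0 < δ ^ (P.β)⁻¹ := Real.rpow_pos_of_pos hδ _
  obtain ⟨C, hC, hlarge⟩ := P.exists_rpow_one_sub_a_le hr₀
  refine ⟨C, hC, fun r hr => ?_⟩
  have hdissip := mul_nonneg hC.le (mul_nonneg (P.root_nonneg hr) hr)
  rcases le_total r (δ ^ (P.β)⁻¹) with h | h
  · have : r ^ P.β ≤ δ := (Real.le_rpow_inv_iff_of_pos hr hδ.le P.β_pos).1 h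
    linarith
  · calc r ^ P.β = r ^ (1 - P.a) * r := by
          rw [← Real.rpow_add_one (hr₀.trans_le h).ne', β]
          ring_nf
      _ ≤ C * P.root r * r := mul_le_mul_of_nonneg_right (hlarge r h) hr
      _ ≤ _ := by linarith

end GenPoly

section Spaces

variable {d : ℕ} {Ω : Set (EuclideanSpace ℝ (Fin d))}

/-- The map `(u, ∇u) ↦ u` as a continuous linear map. -/
def toL2L : H1 Ω →L[ℝ] L2 Ω := (WithLp.fstL 2 ℝ (L2 Ω) (L2Vec Ω)).comp (H1 Ω).subtypeL

/-- The weak gradient as a continuous linear map. -/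
def gradL : H1 Ω →L[ℝ] L2Vec Ω := (WithLp.sndL 2 ℝ (L2 Ω) (L2Vec Ω)).comp (H1 Ω).subtypeL

theorem toL2_add (u v : H1 Ω) : toL2 (u + v) = toL2 u + toL2 v := toL2L.map_add u v

theorem toL2_sub (u v : H1 Ω) : toL2 (u - v) = toL2 u - toL2 v := toL2L.map_sub u v

theorem toL2_smul (c : ℝ) (u : H1 Ω) : toL2 (c • u) = c • toL2 u := toL2L.map_smul c u

theorem continuous_toL2 : Continuous (toL2 : H1 Ω → L2 Ω) := toL2L.continuous

theorem grad_add (u v : H1 Ω) : grad (u + v) = grad u + grad v := gradL.map_add u v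

theorem grad_sub (u v : H1 Ω) : grad (u - v) = grad u - grad v := gradL.map_sub u v

theorem norm_toL2_le (u : H1 Ω) : ‖toL2 u‖ ≤ ‖u‖ :=
  abs_le_of_sq_le_sq' (by linarith [norm_sq_H1 u, sq_nonneg ‖grad u‖]) (norm_nonneg _) |>.2

theorem norm_grad_le (u : H1 Ω) : ‖grad u‖ ≤ ‖u‖ :=
  abs_le_of_sq_le_sq' (by linarith [norm_sq_H1 u, sq_nonneg ‖toL2 u‖]) (norm_nonneg _) |>.2

theorem IsTestFunction.add {η ζ : EuclideanSpace ℝ (Fin d) → ℝ} (hη : IsTestFunction Ω η)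
    (hζ : IsTestFunction Ω ζ) : IsTestFunction Ω (η + ζ) where
  contDiff := hη.contDiff.add hζ.contDiff
  hasCompactSupport := hη.hasCompactSupport.add hζ.hasCompactSupport
  tsupport_subset := (tsupport_add η ζ).trans
    (union_subset hη.tsupport_subset hζ.tsupport_subset)

theorem IsTestFunction.const_smul {η : EuclideanSpace ℝ (Fin d) → ℝ} (c : ℝ)
    (hη : IsTestFunction Ω η) : IsTestFunction Ω (c • η) where
  contDiff := contDiff_const.smul hη.contDiff
  hasCompactSupport := hη.hasCompactSupport.smul_left (f := fun _ => c)
  tsupport_subset := (tsupport_smul_subset_right (fun _ => c) η).trans hη.tsupport_subset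

theorem IsTestFunction.zero : IsTestFunction Ω 0 where
  contDiff := contDiff_const
  hasCompactSupport := HasCompactSupport.zero
  tsupport_subset := by simp [tsupport]

/-- `H¹₀(Ω)` as a closed subspace of `H¹(Ω)`. -/
def H01Submodule (Ω : Set (EuclideanSpace ℝ (Fin d))) : Submodule ℝ (H1 Ω) :=
  Submodule.topologicalClosure
    { carrier := testH1 Ω
      add_mem' := by
        rintro u v ⟨η, hη, hu⟩ ⟨ζ, hζ, hv⟩
        refine ⟨η + ζ, hη.add hζ, ?_⟩
        rw [toL2_add]
        exact (Lp.coeFn_add _ _).trans (hu.add hv)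
      zero_mem' := ⟨0, .zero, Lp.coeFn_zero _ _ _⟩
      smul_mem' := by
        rintro c u ⟨η, hη, hu⟩
        refine ⟨c • η, hη.const_smul c, ?_⟩
        rw [toL2_smul]
        exact (Lp.coeFn_smul _ _).trans (hu.const_smul c) }

theorem sub_mem_H01 {u v : H1 Ω} (hu : u ∈ H01 Ω) (hv : v ∈ H01 Ω) : u - v ∈ H01 Ω :=
  (H01Submodule Ω).sub_mem hu hv

theorem deriv_mem_H01 {u : ℝ → H1 Ω} {t : ℝ} (hu : ∀ᶠ s in 𝓝 t, u s ∈ H01 Ω) :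
    deriv u t ∈ H01 Ω := by
  by_cases hdiff : DifferentiableAt ℝ u t
  · refine isClosed_closure.mem_of_tendsto (hasDerivAt_iff_tendsto_slope.1 hdiff.hasDerivAt) ?_
    filter_upwards [hu.filter_mono nhdsWithin_le_nhds] with s hs
    exact (H01Submodule Ω).smul_mem _ (sub_mem_H01 hs hu.self_of_nhds)
  · rw [deriv_zero_of_not_differentiableAt hdiff]
    exact (H01Submodule Ω).zero_mem

theorem IsWeakGradient.eq_zero (hΩ : IsOpen Ω) {G : L2Vec Ω} (hG : IsWeakGradient Ω 0 G) :
    G = 0 := by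
  have hcoord : ∀ i, ∀ᵐ x ∂volume.restrict Ω, G x i = 0 := by
    intro i
    have hGi : MemLp (fun x => G x i) 2 (volume.restrict Ω) :=
      (EuclideanSpace.proj i : EuclideanSpace ℝ (Fin d) →L[ℝ] ℝ).comp_memLp' (Lp.memLp G)
    refine (ae_restrict_iff' hΩ.measurableSet).2
      (hΩ.ae_eq_zero_of_integral_contDiff_smul_eq_zero
        (locallyIntegrableOn_of_locallyIntegrable_restrict
          (hGi.locallyIntegrable one_le_two)) fun ψ hψ hψc hψΩ => ?_)
    have hleft : ∫ x in Ω, (0 : L2 Ω) x * fderiv ℝ ψ x (EuclideanSpace.single i 1) = 0 := by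
      refine integral_eq_zero_of_ae ?_
      filter_upwards [Lp.coeFn_zero ℝ 2 (volume.restrict Ω)] with x hx
      simp only [hx, Pi.zero_apply, zero_mul]
    rw [hG ψ ⟨hψ, hψc, hψΩ⟩ i, neg_eq_zero] at hleft
    rw [← setIntegral_eq_integral_of_forall_compl_eq_zero (s := Ω) fun x hx => by
      rw [image_eq_zero_of_notMem_tsupport fun h => hx (hψΩ h), zero_smul]]
    simpa only [smul_eq_mul, mul_comm] using hleft
  refine Lp.ext ?_
  filter_upwards [ae_all_iff.2 hcoord, Lp.coeFn_zero (EuclideanSpace ℝ (Fin d)) 2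
    (volume.restrict Ω)] with x hx hzero
  rw [hzero]
  ext i
  exact hx i

theorem IsWeakGradient.unique (hΩ : IsOpen Ω) {u : L2 Ω} {G H : L2Vec Ω}
    (hG : IsWeakGradient Ω u G) (hH : IsWeakGradient Ω u H) : G = H := by
  have : IsWeakGradient Ω (u + (-1 : ℝ) • u) (G + (-1 : ℝ) • H) := hG.add (hH.smul (-1))
  rw [neg_one_smul, neg_one_smul, add_neg_cancel] at this
  exact add_neg_eq_zero.1 (this.eq_zero hΩ)

namespace IsTestFunction

variable {η : EuclideanSpace ℝ (Fin d) → ℝ} (hη : IsTestFunction Ω η)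

include hη

theorem memLp : MemLp η 2 (volume.restrict Ω) :=
  (hη.contDiff.continuous.memLp_of_hasCompactSupport hη.hasCompactSupport).restrict Ω

theorem eq_zero_of_notMem {x : EuclideanSpace ℝ (Fin d)} (hx : x ∉ Ω) : η x = 0 :=
  image_eq_zero_of_notMem_tsupport fun h => hx (hη.tsupport_subset h)

theorem memLp_gradient : MemLp (gradient η) 2 (volume.restrict Ω) := by
  refine (Continuous.memLp_of_hasCompactSupport ?_ ?_).restrict Ω
  · exact (InnerProductSpace.toDual ℝ _).symm.continuous.comp
      (hη.contDiff.continuous_fderiv (by simp))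
  · exact (hη.hasCompactSupport.fderiv ℝ).comp_left (map_zero _)

omit hη in
theorem gradient_apply (x : EuclideanSpace ℝ (Fin d)) (i : Fin d) :
    gradient η x i = fderiv ℝ η x (EuclideanSpace.single i 1) := by
  rw [← inner_gradient_left, EuclideanSpace.inner_single_right]
  simp

theorem isWeakGradient : IsWeakGradient Ω (hη.memLp.toLp η) (hη.memLp_gradient.toLp _) := by
  intro ψ hψ i
  have continuous_fderiv {ζ} (hζ : IsTestFunction Ω ζ) :
      Continuous fun x => fderiv ℝ ζ x (EuclideanSpace.single i 1) :=
    (hζ.contDiff.continuous_fderiv (by simp)).clm_apply continuous_const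
  calc ∫ x in Ω, hη.memLp.toLp η x * fderiv ℝ ψ x (EuclideanSpace.single i 1)
      = ∫ x in Ω, η x * fderiv ℝ ψ x (EuclideanSpace.single i 1) := by
        refine integral_congr_ae ?_
        filter_upwards [hη.memLp.coeFn_toLp] with x hx
        rw [hx]
    _ = ∫ x, η x * fderiv ℝ ψ x (EuclideanSpace.single i 1) :=
        setIntegral_eq_integral_of_forall_compl_eq_zero fun x hx => by
          rw [hη.eq_zero_of_notMem hx, zero_mul]
    _ = -∫ x, fderiv ℝ η x (EuclideanSpace.single i 1) * ψ x := by
        refine integral_mul_fderiv_eq_neg_fderiv_mul_of_integrable ?_ ?_ ?_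
          (fun x _ => hη.contDiff.differentiable (by simp) x)
          (fun x _ => hψ.contDiff.differentiable (by simp) x)
        · exact ((continuous_fderiv hη).mul hψ.contDiff.continuous).integrable_of_hasCompactSupport
            hψ.hasCompactSupport.mul_left
        · exact (hη.contDiff.continuous.mul (continuous_fderiv hψ)).integrable_of_hasCompactSupport
            hη.hasCompactSupport.mul_right
        · exact (hη.contDiff.continuous.mul hψ.contDiff.continuous).integrable_of_hasCompactSupport
            hψ.hasCompactSupport.mul_left
    _ = -∫ x in Ω, fderiv ℝ η x (EuclideanSpace.single i 1) * ψ x := by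
        rw [setIntegral_eq_integral_of_forall_compl_eq_zero fun x hx => by
          rw [hψ.eq_zero_of_notMem hx, mul_zero]]
    _ = -∫ x in Ω, hη.memLp_gradient.toLp _ x i * ψ x := by
        congr 1
        refine integral_congr_ae ?_
        filter_upwards [hη.memLp_gradient.coeFn_toLp] with x hx
        rw [hx, gradient_apply]

theorem grad_ae_eq (hΩ : IsOpen Ω) {u : H1 Ω} (hu : toL2 u =ᵐ[volume.restrict Ω] η) :
    grad u =ᵐ[volume.restrict Ω] gradient η := by
  have toL2_eq : toL2 u = hη.memLp.toLp η := Lp.ext (hu.trans hη.memLp.coeFn_toLp.symm)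
  have grad_eq : grad u = hη.memLp_gradient.toLp _ :=
    IsWeakGradient.unique hΩ (toL2_eq ▸ u.2) hη.isWeakGradient
  exact grad_eq ▸ hη.memLp_gradient.coeFn_toLp

end IsTestFunction

end Spaces

section Sobolev

variable {d : ℕ} {Ω : Set (EuclideanSpace ℝ (Fin d))}

theorem IsTestFunction.eLpNorm_fderiv_eq_gradNorm (hΩ : IsOpen Ω)
    {η : EuclideanSpace ℝ (Fin d) → ℝ} (hη : IsTestFunction Ω η) {u : H1 Ω}
    (hu : toL2 u =ᵐ[volume.restrict Ω] η) (p : ℝ≥0) :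
    eLpNorm (fderiv ℝ η) p = gradNorm p u := by
  have hsupp : (Function.support fun x => ‖fderiv ℝ η x‖) ⊆ Ω :=
    fun x hx => hη.tsupport_subset
      (support_fderiv_subset ℝ (f := η) fun h => hx (by simp only [h, norm_zero]))
  rw [← eLpNorm_norm, ← eLpNorm_restrict_eq_of_support_subset hsupp, gradNorm,
    ENNReal.ofReal_coe_nnreal]
  refine eLpNorm_congr_norm_ae ?_
  filter_upwards [hη.grad_ae_eq hΩ hu] with x hx
  rw [hx, gradient, LinearIsometryEquiv.norm_map, norm_norm]

theorem exists_enorm_toL2_le_of_mem_testH1 (hd : 2 ≤ d) (hΩ : IsOpen Ω) :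
    ∃ C : ℝ≥0, ∀ u ∈ testH1 Ω, ‖toL2 u‖ₑ ≤ C * gradNorm (2 * d / (d + 2)) u := by
  have hd' : (2 : ℝ) ≤ d := by exact_mod_cast hd
  lift (2 * d / (d + 2) : ℝ) to ℝ≥0 using by positivity with p hp
  have hp1 : 1 ≤ p := by
    rw [← NNReal.coe_le_coe, hp, NNReal.coe_one, one_le_div (by positivity)]
    linarith
  have hp' : ((2 : ℝ≥0) : ℝ)⁻¹ =
      (p : ℝ)⁻¹ - (Module.finrank ℝ (EuclideanSpace ℝ (Fin d)) : ℝ)⁻¹ := by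
    rw [finrank_euclideanSpace_fin, hp, NNReal.coe_ofNat]
    field_simp
    ring
  refine ⟨SNormLESNormFDerivOfEqConst ℝ (volume : Measure (EuclideanSpace ℝ (Fin d))) p, ?_⟩
  rintro u ⟨η, hη, hu⟩
  have sobolev := eLpNorm_le_eLpNorm_fderiv_of_eq volume (hη.contDiff.of_le (by simp))
    hη.hasCompactSupport hp1 (by rw [finrank_euclideanSpace_fin]; lia) hp'
  rw [hη.eLpNorm_fderiv_eq_gradNorm hΩ hu, ENNReal.coe_ofNat] at sobolev
  refine le_trans ?_ sobolev
  rw [Lp.enorm_def, eLpNorm_congr_ae hu]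
  exact eLpNorm_mono_measure _ Measure.restrict_le_self

theorem gradNorm_two (u : H1 Ω) : gradNorm 2 u = ‖grad u‖ₑ := by
  rw [gradNorm, Lp.enorm_def, ENNReal.ofReal_ofNat]

/-- `∫_Ω |v|^q`. -/
def powInt (q : ℝ) (v : L2Vec Ω) : ℝ := ∫ x in Ω, ‖v x‖ ^ q

theorem powInt_nonneg (q : ℝ) (v : L2Vec Ω) : 0 ≤ powInt q v :=
  integral_nonneg fun _ => Real.rpow_nonneg (norm_nonneg _) _

/-- The Poincaré–Sobolev inequality `‖u‖ ≤ C ‖∇u‖_{0,q}` on `H¹₀(Ω)`, raised to the power `q`. -/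
def PoincareSobolev (q : ℝ) (Ω : Set (EuclideanSpace ℝ (Fin d))) : Prop :=
  ∃ C > 0, ∀ u ∈ H01 Ω, ‖toL2 u‖ ^ q ≤ C * powInt q (grad u)

variable [IsFiniteMeasure (volume.restrict Ω)]

theorem exists_gradNorm_le_gradNorm {p q : ℝ} (hp : 0 < p) (hpq : p ≤ q) :
    ∃ C : ℝ≥0, ∀ u : H1 Ω, gradNorm p u ≤ C * gradNorm q u := by
  have hc : (volume.restrict Ω) univ ^ (1 / p - 1 / q) ≠ ∞ := ENNReal.rpow_ne_top_of_nonneg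
    (sub_nonneg.2 (one_div_le_one_div_of_le hp hpq)) (measure_ne_top _ _)
  refine ⟨((volume.restrict Ω) univ ^ (1 / p - 1 / q)).toNNReal, fun u => ?_⟩
  rw [ENNReal.coe_toNNReal hc, mul_comm]
  have := eLpNorm_le_eLpNorm_mul_rpow_measure_univ (ENNReal.ofReal_le_ofReal hpq)
    (Lp.aestronglyMeasurable (grad u))
  rwa [ENNReal.toReal_ofReal hp.le, ENNReal.toReal_ofReal (hp.le.trans hpq)] at this

theorem continuous_gradNorm {q : ℝ} (hq1 : 1 ≤ q) (hq2 : q ≤ 2) :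
    Continuous (gradNorm q : H1 Ω → ℝ≥0∞) := by
  obtain ⟨C, hC⟩ := exists_gradNorm_le_gradNorm (Ω := Ω) (one_pos.trans_le hq1) hq2
  refine continuous_of_le_add_edist C ENNReal.coe_ne_top fun u v => ?_
  have hsub : ⇑(grad u) =ᵐ[volume.restrict Ω] ⇑(grad v) + ⇑(grad (u - v)) := by
    have := Lp.coeFn_add (grad v) (grad (u - v))
    rwa [← grad_add, add_sub_cancel] at this
  calc gradNorm q u
      = eLpNorm (⇑(grad v) + ⇑(grad (u - v))) (ENNReal.ofReal q) (volume.restrict Ω) :=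
        eLpNorm_congr_ae hsub
    _ ≤ gradNorm q v + gradNorm q (u - v) :=
        eLpNorm_add_le (Lp.aestronglyMeasurable _) (Lp.aestronglyMeasurable _)
          (ENNReal.one_le_ofReal.2 hq1)
    _ ≤ gradNorm q v + C * edist u v := by
        gcongr
        grw [hC, gradNorm_two, edist_eq_enorm_sub, enorm_le_iff_norm_le.2 (norm_grad_le _)]

theorem exists_enorm_toL2_le_of_mem_H01 (hd : 2 ≤ d) (hΩ : IsOpen Ω) {q : ℝ}
    (hqd : 2 * d / (d + 2) ≤ q) : ∃ C : ℝ≥0, ∀ u ∈ H01 Ω, ‖toL2 u‖ₑ ≤ C * gradNorm q u := by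
  have hd' : (2 : ℝ) ≤ d := by exact_mod_cast hd
  have hp1 : (1 : ℝ) ≤ 2 * d / (d + 2) := by
    rw [one_le_div (by positivity)]
    linarith
  have hp2 : (2 * d / (d + 2) : ℝ) ≤ 2 := by
    rw [div_le_iff₀ (by positivity)]
    linarith
  obtain ⟨C, hC⟩ := exists_enorm_toL2_le_of_mem_testH1 hd hΩ
  obtain ⟨D, hD⟩ := exists_gradNorm_le_gradNorm (Ω := Ω) (one_pos.trans_le hp1) hqd
  have hclosed : IsClosed {u : H1 Ω | ‖toL2 u‖ₑ ≤ C * gradNorm (2 * d / (d + 2)) u} :=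
    isClosed_le (continuous_enorm.comp continuous_toL2)
      (ENNReal.continuous_const_mul ENNReal.coe_ne_top |>.comp (continuous_gradNorm hp1 hp2))
  refine ⟨C * D, fun u hu => ?_⟩
  calc ‖toL2 u‖ₑ ≤ C * gradNorm (2 * d / (d + 2)) u := closure_minimal hC hclosed hu
    _ ≤ C * (D * gradNorm q u) := by
        gcongr
        exact hD u
    _ = _ := by rw [ENNReal.coe_mul, mul_assoc]

theorem memLp_of_le_two {q : ℝ} (hq : q ≤ 2) (v : L2Vec Ω) :
    MemLp v (ENNReal.ofReal q) (volume.restrict Ω) :=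
  (Lp.memLp v).mono_exponent (by simpa using ENNReal.ofReal_le_ofReal hq)

theorem integrable_rpow {q : ℝ} (hq0 : 0 < q) (hq : q ≤ 2) (v : L2Vec Ω) :
    Integrable (fun x => ‖v x‖ ^ q) (volume.restrict Ω) := by
  have := (memLp_of_le_two hq v).integrable_norm_rpow (by simpa using hq0) (by simp)
  rwa [ENNReal.toReal_ofReal hq0.le] at this

theorem gradNorm_rpow {q : ℝ} (hq0 : 0 < q) (hq : q ≤ 2) (u : H1 Ω) :
    gradNorm q u ^ q = ENNReal.ofReal (powInt q (grad u)) := by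
  rw [gradNorm, (memLp_of_le_two hq _).eLpNorm_eq_integral_rpow_norm (by simpa using hq0) (by simp),
    ENNReal.toReal_ofReal hq0.le, ← powInt, ENNReal.ofReal_rpow_of_nonneg
      (Real.rpow_nonneg (powInt_nonneg _ _) _) hq0.le,
    Real.rpow_inv_rpow (powInt_nonneg _ _) hq0.ne']

theorem poincareSobolev (hd : 2 ≤ d) (hΩ : IsOpen Ω) {q : ℝ} (hqd : 2 * d / (d + 2) ≤ q)
    (hq : q ≤ 2) : PoincareSobolev q Ω := by
  have hq0 : 0 < q := lt_of_lt_of_le (by positivity) hqd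
  obtain ⟨C, hC⟩ := exists_enorm_toL2_le_of_mem_H01 (Ω := Ω) hd hΩ hqd
  refine ⟨(C : ℝ) ^ q + 1, by positivity, fun u hu => ?_⟩
  have h := ENNReal.rpow_le_rpow (hC u hu) hq0.le
  have hpow := powInt_nonneg q (grad u)
  rw [ENNReal.mul_rpow_of_nonneg _ _ hq0.le, gradNorm_rpow hq0 hq, ← ofReal_norm,
    ENNReal.ofReal_rpow_of_nonneg (norm_nonneg _) hq0.le, ← ENNReal.ofReal_coe_nnreal,
    ENNReal.ofReal_rpow_of_nonneg C.coe_nonneg hq0.le, ← ENNReal.ofReal_mul (by positivity),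
    ENNReal.ofReal_le_ofReal_iff (by positivity)] at h
  linarith

end Sobolev

section Operator

theorem hasGradientAt_of_forall_inner_sub_le {V : Type*} [NormedAddCommGroup V]
    [InnerProductSpace ℝ V] [CompleteSpace V] {F : V → ℝ} {A : V → V}
    (hF : ∀ v w, inner ℝ (A v) (w - v) ≤ F w - F v) {v : V} (hA : ContinuousAt A v) :
    HasGradientAt F (A v) v := by
  rw [hasGradientAt_iff_isLittleO]
  have hbound (w : V) : ‖F w - F v - inner ℝ (A v) (w - v)‖ ≤ ‖‖A w - A v‖ * ‖w - v‖‖ := by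
    have hflip : F w - F v ≤ inner ℝ (A w) (w - v) := by
      have := hF w v
      rw [← neg_sub w v, inner_neg_right] at this
      linarith
    have hcs := real_inner_le_norm (A w - A v) (w - v)
    rw [inner_sub_left] at hcs
    rw [Real.norm_of_nonneg (sub_nonneg.2 (hF v w)), norm_mul, norm_norm, norm_norm]
    linarith
  refine (Asymptotics.isBigO_of_le _ hbound).trans_isLittleO ?_
  have hzero : (fun w => ‖A w - A v‖) =o[𝓝 v] fun _ => (1 : ℝ) :=
    (Asymptotics.isLittleO_one_iff ℝ).2 (tendsto_iff_norm_sub_tendsto_zero.1 hA)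
  refine Asymptotics.IsLittleO.of_norm_right ?_
  simpa only [one_mul] using hzero.mul_isBigO (Asymptotics.isBigO_refl (fun w => ‖w - v‖) (𝓝 v))

variable {d : ℕ} {Ω : Set (EuclideanSpace ℝ (Fin d))}

namespace GenPoly

variable (P : GenPoly)

/-- The operator `v ↦ K(|v|) v` on `(L²(Ω))ᵈ`. -/
def fluxOp (v : L2Vec Ω) : L2Vec Ω := P.lipschitzWith_flux.compLp P.flux_zero v

theorem fluxOp_ae_eq (v : L2Vec Ω) : ∀ᵐ x ∂volume.restrict Ω, P.fluxOp v x = P.flux (v x) :=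
  P.lipschitzWith_flux.coeFn_compLp P.flux_zero v

theorem continuous_fluxOp : Continuous (P.fluxOp : L2Vec Ω → L2Vec Ω) :=
  (P.lipschitzWith_flux.lipschitzWith_compLp P.flux_zero).continuous

theorem inner_fluxOp (v w : L2Vec Ω) :
    inner ℝ (P.fluxOp v) w = ∫ x in Ω, P.K ‖v x‖ * inner ℝ (v x) (w x) := by
  rw [L2.inner_def]
  refine integral_congr_ae ?_
  filter_upwards [P.fluxOp_ae_eq v] with x hx
  rw [hx, flux, real_inner_smul_left]

theorem fluxOp_zero : P.fluxOp (0 : L2Vec Ω) = 0 := P.lipschitzWith_flux.compLp_zero P.flux_zero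

theorem norm_fluxOp_le (v : L2Vec Ω) : ‖P.fluxOp v‖ ≤ (P.coeff 0)⁻¹ * ‖v‖ := by
  have := P.lipschitzWith_flux.norm_compLp_le P.flux_zero v
  rwa [Real.coe_toNNReal _ (inv_nonneg.2 P.coeff_zero_pos.le)] at this

theorem fluxOp_cocoercive (v w : L2Vec Ω) :
    P.coeff 0 * ‖P.fluxOp v - P.fluxOp w‖ ^ 2 ≤ inner ℝ (P.fluxOp v - P.fluxOp w) (v - w) := by
  rw [← real_inner_self_eq_norm_sq, ← real_inner_smul_left, L2.inner_def, L2.inner_def]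
  refine integral_mono_ae (L2.integrable_inner _ _) (L2.integrable_inner _ _) ?_
  filter_upwards [P.fluxOp_ae_eq v, P.fluxOp_ae_eq w, Lp.coeFn_sub v w,
    Lp.coeFn_sub (P.fluxOp v) (P.fluxOp w),
    Lp.coeFn_smul (P.coeff 0) (P.fluxOp v - P.fluxOp w)] with x hv hw hvw hflux hsmul
  simp only [hsmul, Pi.smul_apply, hflux, hvw, Pi.sub_apply, hv, hw, real_inner_smul_left,
    real_inner_self_eq_norm_sq]
  exact P.flux_cocoercive (v x) (w x)

/-- The dissipation `∫_Ω K(|v|) |v|²`. -/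
def dissip (v : L2Vec Ω) : ℝ := inner ℝ (P.fluxOp v) v

theorem norm_fluxOp_sq_le (v : L2Vec Ω) : P.coeff 0 * ‖P.fluxOp v‖ ^ 2 ≤ P.dissip v := by
  have := P.fluxOp_cocoercive v 0
  rwa [fluxOp_zero, sub_zero, sub_zero] at this

theorem dissip_le (v : L2Vec Ω) : P.dissip v ≤ (P.coeff 0)⁻¹ * ‖v‖ ^ 2 := by
  calc P.dissip v ≤ ‖P.fluxOp v‖ * ‖v‖ := real_inner_le_norm _ _
    _ ≤ (P.coeff 0)⁻¹ * ‖v‖ * ‖v‖ := by grw [P.norm_fluxOp_le v]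
    _ = _ := by ring

theorem dissip_eq (v : L2Vec Ω) : P.dissip v = ∫ x in Ω, P.root ‖v x‖ * ‖v x‖ := by
  rw [dissip, L2.inner_def]
  refine integral_congr_ae ?_
  filter_upwards [P.fluxOp_ae_eq v] with x hx
  rw [hx, inner_flux_self]

theorem integrable_root_mul (v : L2Vec Ω) :
    Integrable (fun x => P.root ‖v x‖ * ‖v x‖) (volume.restrict Ω) := by
  refine (L2.integrable_inner (P.fluxOp v) v (𝕜 := ℝ)).congr ?_
  filter_upwards [P.fluxOp_ae_eq v] with x hx
  rw [hx, inner_flux_self]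

/-- The energy `∫_Ω Φ(|v|)`, where `Φ` is the potential. -/
def energy (v : L2Vec Ω) : ℝ := ∫ x in Ω, P.potential ‖v x‖

theorem integrable_potential (v : L2Vec Ω) :
    Integrable (fun x => P.potential ‖v x‖) (volume.restrict Ω) := by
  refine (P.integrable_root_mul v).mono'
    ((P.continuous_potential.comp continuous_norm).comp_aestronglyMeasurable
      (Lp.aestronglyMeasurable v)) (ae_of_all _ fun x => ?_)
  rw [Real.norm_of_nonneg (P.potential_nonneg (norm_nonneg _))]
  exact P.potential_le (norm_nonneg _)

theorem energy_nonneg (v : L2Vec Ω) : 0 ≤ P.energy v :=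
  integral_nonneg fun _ => P.potential_nonneg (norm_nonneg _)

theorem energy_le_dissip (v : L2Vec Ω) : P.energy v ≤ P.dissip v := by
  rw [dissip_eq]
  exact integral_mono (P.integrable_potential v) (P.integrable_root_mul v)
    fun x => P.potential_le (norm_nonneg _)

theorem dissip_le_energy (v : L2Vec Ω) : P.dissip v ≤ 2 * P.energy v := by
  rw [dissip_eq, energy, ← integral_const_mul]
  exact integral_mono (P.integrable_root_mul v) ((P.integrable_potential v).const_mul 2)
    fun x => P.root_mul_le_potential (norm_nonneg _)

theorem inner_fluxOp_le_energy_sub (v w : L2Vec Ω) :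
    inner ℝ (P.fluxOp v) (w - v) ≤ P.energy w - P.energy v := by
  rw [energy, energy, ← integral_sub (P.integrable_potential w) (P.integrable_potential v),
    L2.inner_def]
  refine integral_mono_ae (L2.integrable_inner _ _)
    ((P.integrable_potential w).sub (P.integrable_potential v)) ?_
  filter_upwards [P.fluxOp_ae_eq v, Lp.coeFn_sub w v] with x hflux hsub
  rw [hflux, hsub]
  exact P.inner_flux_sub_le (v x) (w x)

theorem hasGradientAt_energy (v : L2Vec Ω) : HasGradientAt P.energy (P.fluxOp v) v :=
  hasGradientAt_of_forall_inner_sub_le P.inner_fluxOp_le_energy_sub P.continuous_fluxOp.continuousAt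

theorem continuous_energy : Continuous (P.energy : L2Vec Ω → ℝ) :=
  continuous_iff_continuousAt.2 fun v => (P.hasGradientAt_energy v).continuousAt

theorem exists_powInt_le [IsFiniteMeasure (volume.restrict Ω)] {δ : ℝ} (hδ : 0 < δ) :
    ∃ C, 0 < C ∧ ∀ v : L2Vec Ω, powInt P.β v ≤ δ + C * P.dissip v := by
  set m := (volume.restrict Ω).real univ
  have : 0 ≤ m := measureReal_nonneg
  obtain ⟨C, hC, hpointwise⟩ := P.exists_rpow_β_le (δ := δ / (m + 1)) (by positivity)
  refine ⟨C, hC, fun v => ?_⟩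
  calc powInt P.β v ≤ ∫ x in Ω, (δ / (m + 1) + C * (P.root ‖v x‖ * ‖v x‖)) :=
        integral_mono (integrable_rpow P.β_pos P.β_lt_two.le v)
          ((integrable_const _).add ((P.integrable_root_mul v).const_mul C))
          fun x => hpointwise _ (norm_nonneg _)
    _ = m * (δ / (m + 1)) + C * P.dissip v := by
        rw [integral_add (integrable_const _) ((P.integrable_root_mul v).const_mul C),
          integral_const, integral_const_mul, ← dissip_eq, smul_eq_mul]
    _ ≤ δ + C * P.dissip v := by
        gcongr
        rw [mul_div_assoc', div_le_iff₀ (by positivity)]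
        linarith

end GenPoly

theorem add_rpow_le_mul {x y p : ℝ} (hx : 0 ≤ x) (hy : 0 ≤ y) (hp : 1 ≤ p) :
    (x + y) ^ p ≤ 2 ^ (p - 1) * (x ^ p + y ^ p) := by
  exact_mod_cast NNReal.rpow_add_le_mul_rpow_add_rpow ⟨x, hx⟩ ⟨y, hy⟩ hp

theorem powInt_sub_le [IsFiniteMeasure (volume.restrict Ω)] {q : ℝ} (hq1 : 1 ≤ q) (hq2 : q ≤ 2)
    (v w : L2Vec Ω) : powInt q (v - w) ≤ 2 * (powInt q v + powInt q w) := by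
  have hq0 : 0 < q := one_pos.trans_le hq1
  have hintv := integrable_rpow hq0 hq2 v
  have hintw := integrable_rpow hq0 hq2 w
  rw [powInt, powInt, powInt, ← integral_add hintv hintw, ← integral_const_mul]
  refine integral_mono_ae (integrable_rpow hq0 hq2 (v - w)) ((hintv.add hintw).const_mul 2) ?_
  filter_upwards [Lp.coeFn_sub v w] with x hx
  rw [hx, Pi.sub_apply]
  calc ‖v x - w x‖ ^ q ≤ (‖v x‖ + ‖w x‖) ^ q := by grw [norm_sub_le]
    _ ≤ 2 ^ (q - 1) * (‖v x‖ ^ q + ‖w x‖ ^ q) :=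
        add_rpow_le_mul (norm_nonneg _) (norm_nonneg _) hq1
    _ ≤ 2 ^ (1 : ℝ) * (‖v x‖ ^ q + ‖w x‖ ^ q) := by
        gcongr
        · norm_num
        · linarith
    _ = _ := by rw [Real.rpow_one]

end Operator

section DifferentialInequalities

variable {y y' h : ℝ → ℝ} {s t : ℝ}

theorem le_of_deriv_nonpos_above {B : ℝ} (hst : s ≤ t) (hy : ContinuousOn y (Icc s t))
    (hderiv : ∀ τ ∈ Ioo s t, HasDerivAt y (y' τ) τ) (hle : ∀ τ ∈ Ioo s t, B < y τ → y' τ ≤ 0)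
    (hs : y s ≤ B) : y t ≤ B := by
  by_contra! ht
  set S := Icc s t ∩ y ⁻¹' Iic B
  have hS : IsCompact S :=
    isCompact_Icc.of_isClosed_subset (hy.preimage_isClosed_of_isClosed isClosed_Icc isClosed_Iic)
      inter_subset_left
  have hσ : sSup S ∈ S := hS.sSup_mem ⟨s, left_mem_Icc.2 hst, hs⟩
  set σ := sSup S
  have hσB : y σ ≤ B := hσ.2
  have habove : ∀ τ ∈ Ioo σ t, B < y τ := fun τ hτ => by
    by_contra! hτB
    have hτS : τ ∈ S := ⟨⟨hσ.1.1.trans hτ.1.le, hτ.2.le⟩, hτB⟩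
    exact absurd (le_csSup hS.bddAbove hτS) (not_le.2 hτ.1)
  have hanti : AntitoneOn y (Icc σ t) := by
    refine antitoneOn_of_hasDerivWithinAt_nonpos (f' := y') (convex_Icc σ t)
      (hy.mono (Icc_subset_Icc_left hσ.1.1)) (fun τ hτ => ?_) fun τ hτ => ?_ <;>
      rw [interior_Icc] at hτ
    · exact (hderiv τ ⟨hσ.1.1.trans_lt hτ.1, hτ.2⟩).hasDerivWithinAt
    · exact hle τ ⟨hσ.1.1.trans_lt hτ.1, hτ.2⟩ (habove τ hτ)
  have := hanti (left_mem_Icc.2 hσ.1.2) (right_mem_Icc.2 hσ.1.2) hσ.1.2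
  linarith

theorem exists_le_of_deriv_neg_above {T B κ : ℝ} (hκ : 0 < κ)
    (hderiv : ∀ τ, T ≤ τ → HasDerivAt y (y' τ) τ) (hle : ∀ τ, T ≤ τ → B < y τ → y' τ ≤ -κ) :
    ∃ τ, T ≤ τ ∧ y τ ≤ B := by
  by_contra! habove
  set t := T + |y T - B| / κ with ht
  have hTt : T ≤ t := le_add_of_nonneg_right (by positivity)
  have hline := image_le_of_deriv_right_le_deriv_boundary (f := y) (f' := y') (a := T) (b := t)
    (B := fun τ => y T - κ * (τ - T)) (B' := fun _ => -κ)
    (fun τ hτ => (hderiv τ hτ.1).continuousAt.continuousWithinAt)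
    (fun τ hτ => (hderiv τ hτ.1).hasDerivWithinAt) (by simp) (by fun_prop)
    (fun τ _ => by
      have := (((hasDerivAt_id τ).sub_const T).const_mul κ).const_sub (y T)
      simpa using this.hasDerivWithinAt)
    (fun τ hτ => hle τ hτ.1 (habove τ hτ.1)) (right_mem_Icc.2 hTt)
  have hdecrease : κ * (t - T) = |y T - B| := by
    rw [ht]
    field_simp
    ring
  linarith [habove t hTt, le_abs_self (y T - B)]

theorem eventually_le_of_deriv_neg_above {T B κ : ℝ} (hκ : 0 < κ)
    (hderiv : ∀ τ, T ≤ τ → HasDerivAt y (y' τ) τ) (hle : ∀ τ, T ≤ τ → B < y τ → y' τ ≤ -κ) :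
    ∀ᶠ t in atTop, y t ≤ B := by
  obtain ⟨τ, hτ, hτB⟩ := exists_le_of_deriv_neg_above hκ hderiv hle
  filter_upwards [eventually_ge_atTop τ] with t ht
  refine le_of_deriv_nonpos_above ht
    (fun σ hσ => (hderiv σ (hτ.trans hσ.1)).continuousAt.continuousWithinAt)
    (fun σ hσ => hderiv σ (hτ.trans hσ.1.le)) (fun σ hσ hB => ?_) hτB
  linarith [hle σ (hτ.trans hσ.1.le) hB]

theorem eventually_le_of_deriv_le {c p B m : ℝ} (hc : 0 < c) (hp : 0 < p) (hB : 0 ≤ B)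
    (hmB : m < B ^ p) (hderiv : ∀ᶠ t in atTop, HasDerivAt y (y' t) t)
    (hle : ∀ᶠ t in atTop, y' t ≤ c * (-(y t) ^ p + h t)) (hh : ∀ᶠ t in atTop, h t ≤ m) :
    ∀ᶠ t in atTop, y t ≤ B := by
  obtain ⟨T, hT⟩ := eventually_atTop.1 (hderiv.and (hle.and hh))
  refine eventually_le_of_deriv_neg_above (y' := y') (mul_pos hc (sub_pos.2 hmB))
    (fun τ hτ => (hT τ hτ).1) fun τ hτ hBy => ?_
  calc y' τ ≤ c * (-(y τ) ^ p + h τ) := (hT τ hτ).2.1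
    _ ≤ c * (-B ^ p + m) := by
        gcongr
        exact (hT τ hτ).2.2
    _ = -(c * (B ^ p - m)) := by ring

theorem limsup_le_of_deriv_le {c p : ℝ} (hc : 0 < c) (hp : 0 < p)
    (hderiv : ∀ᶠ t in atTop, HasDerivAt y (y' t) t)
    (hle : ∀ᶠ t in atTop, y' t ≤ c * (-(y t) ^ p + h t)) :
    limsup (fun t => ENNReal.ofReal (y t)) atTop
      ≤ (limsup (fun t => ENNReal.ofReal (h t)) atTop) ^ (1 / p) := by
  set L := limsup (fun t => ENNReal.ofReal (h t)) atTop
  refine le_of_forall_gt fun b hb => ?_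
  obtain ⟨B, hLB, hBb⟩ := exists_between hb
  have hB : B ≠ ∞ := hBb.ne_top
  have hL_lt : L < B ^ p := by
    rw [one_div] at hLB
    simpa only [ENNReal.rpow_inv_rpow hp.ne'] using ENNReal.rpow_lt_rpow hLB hp
  obtain ⟨m, hLm, hmB⟩ := exists_between hL_lt
  have hmB_real : m.toReal < B.toReal ^ p := by
    rw [ENNReal.toReal_rpow]
    exact ENNReal.toReal_strict_mono (ENNReal.rpow_ne_top_of_nonneg hp.le hB) hmB
  have hh : ∀ᶠ t in atTop, h t ≤ m.toReal := by
    filter_upwards [eventually_lt_of_limsup_lt hLm] with t ht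
    exact (ENNReal.ofReal_le_iff_le_toReal hmB.ne_top).1 ht.le
  refine (limsup_le_of_le (by isBoundedDefault) ?_).trans_lt hBb
  filter_upwards [eventually_le_of_deriv_le hc hp ENNReal.toReal_nonneg hmB_real hderiv hle hh]
    with t ht using ENNReal.ofReal_le_of_le_toReal ht

theorem limsup_le_of_deriv_add_le {c : ℝ} (hc : 0 < c)
    (hderiv : ∀ᶠ t in atTop, HasDerivAt y (y' t) t)
    (hle : ∀ᶠ t in atTop, y' t + c * y t ≤ c * h t) :
    limsup (fun t => ENNReal.ofReal (y t)) atTop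
      ≤ limsup (fun t => ENNReal.ofReal (h t)) atTop := by
  have := limsup_le_of_deriv_le (h := h) hc one_pos hderiv <| hle.mono fun t ht => by
    rw [Real.rpow_one]
    linarith
  simpa using this

theorem ofReal_le_add_lintegral (hst : s ≤ t) (hy : ContinuousOn y (Icc s t))
    (hderiv : ∀ τ ∈ Ioo s t, HasDerivAt y (y' τ) τ) (hh : ContinuousOn h (Ioo s t))
    (hle : ∀ τ ∈ Ioo s t, y' τ ≤ h τ) :
    ENNReal.ofReal (y t) ≤ ENNReal.ofReal (y s) + ∫⁻ τ in Ioo s t, ENNReal.ofReal (h τ) := by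
  by_cases hfin : ∫⁻ τ in Ioo s t, ENNReal.ofReal (h τ) = ∞
  · simp [hfin]
  have hpos : (fun τ => ENNReal.ofReal (max (h τ) 0)) = fun τ => ENNReal.ofReal (h τ) := by
    ext τ
    rw [ENNReal.ofReal_max, ENNReal.ofReal_zero, max_eq_left zero_le]
  have hmax : 0 ≤ fun τ => max (h τ) 0 := fun τ => le_max_right _ _
  have hint : IntegrableOn (fun τ => max (h τ) 0) (Ioo s t) := by
    refine ⟨(hh.aestronglyMeasurable measurableSet_Ioo).sup aestronglyMeasurable_const, ?_⟩
    rw [hasFiniteIntegral_iff_ofReal (ae_of_all _ hmax), hpos]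
    exact lt_top_iff_ne_top.2 hfin
  have hincrement : y t - y s ≤ ∫ τ in Ioo s t, max (h τ) 0 := by
    rw [← integral_Ioc_eq_integral_Ioo, ← intervalIntegral.integral_of_le hst]
    exact intervalIntegral.sub_le_integral_of_hasDeriv_right_of_le hst hy
      (fun τ hτ => (hderiv τ hτ).hasDerivWithinAt)
      ((integrableOn_Icc_iff_integrableOn_Ioo).2 hint)
      fun τ hτ => (hle τ hτ).trans (le_max_left _ _)
  rw [← hpos, ← ofReal_integral_eq_lintegral_ofReal hint (ae_of_all _ hmax)]
  exact (ENNReal.ofReal_le_ofReal (sub_le_iff_le_add'.1 hincrement)).trans ENNReal.ofReal_add_le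

theorem gronwall_lintegral {k : ℝ} (hst : s ≤ t) (hy : ContinuousOn y (Icc s t))
    (hderiv : ∀ τ ∈ Ioo s t, HasDerivAt y (y' τ) τ) (hh : ContinuousOn h (Ioo s t))
    (hle : ∀ τ ∈ Ioo s t, y' τ + k * y τ ≤ h τ) :
    ENNReal.ofReal (y t) ≤ ENNReal.ofReal (Real.exp (-k * (t - s)) * y s)
      + ∫⁻ τ in Ioo s t, ENNReal.ofReal (Real.exp (-k * (t - τ)) * h τ) := by
  have hexp : Continuous fun τ => Real.exp (-k * (t - τ)) := by fun_prop
  have := ofReal_le_add_lintegral (y := fun τ => Real.exp (-k * (t - τ)) * y τ)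
    (y' := fun τ => Real.exp (-k * (t - τ)) * k * y τ + Real.exp (-k * (t - τ)) * y' τ)
    (h := fun τ => Real.exp (-k * (t - τ)) * h τ) hst (hexp.continuousOn.mul hy)
    (fun τ hτ => by
      refine HasDerivAt.mul ?_ (hderiv τ hτ)
      simpa using (((hasDerivAt_id τ).const_sub t).const_mul (-k)).exp)
    (hexp.continuousOn.mul hh)
    (fun τ hτ => by
      have := mul_le_mul_of_nonneg_left (hle τ hτ) (Real.exp_pos (-k * (t - τ))).le
      linarith)
  simpa using this

theorem gronwall_lintegral_const_add {k K c : ℝ} (hst : s ≤ t) (hk : 0 < k) (hK : 0 ≤ K)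
    (hc : 0 ≤ c) (hys : 0 ≤ y s) (hy : ContinuousOn y (Icc s t))
    (hderiv : ∀ τ ∈ Ioo s t, HasDerivAt y (y' τ) τ) (hh : ContinuousOn h (Ioo s t))
    (hle : ∀ τ ∈ Ioo s t, y' τ + k * y τ ≤ K * (c + h τ)) :
    ENNReal.ofReal (y t) ≤ ENNReal.ofReal (y s + K * c / k)
      + ENNReal.ofReal K * ∫⁻ τ in Ioo s t, ENNReal.ofReal (Real.exp (-k * (t - τ)) * h τ) := by
  have hKc : 0 ≤ K * c / k := by positivity
  have hshift := gronwall_lintegral (y := fun τ => y τ - K * c / k) (h := fun τ => K * h τ)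
    (k := k) hst (hy.sub continuousOn_const) (fun τ hτ => (hderiv τ hτ).sub_const _)
    (continuousOn_const.mul hh) fun τ hτ => by
      have : k * (K * c / k) = K * c := by field_simp
      linarith [hle τ hτ]
  simp only [mul_left_comm _ K, ENNReal.ofReal_mul hK] at hshift
  rw [lintegral_const_mul' _ _ ENNReal.ofReal_ne_top] at hshift
  have hinit : Real.exp (-k * (t - s)) * (y s - K * c / k) ≤ y s := by
    have hexp_le : Real.exp (-k * (t - s)) ≤ 1 := Real.exp_le_one_iff.2 (by nlinarith)
    nlinarith [Real.exp_pos (-k * (t - s))]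
  calc ENNReal.ofReal (y t) ≤ ENNReal.ofReal (y t - K * c / k) + ENNReal.ofReal (K * c / k) := by
        simpa only [sub_add_cancel] using
          ENNReal.ofReal_add_le (p := y t - K * c / k) (q := K * c / k)
    _ ≤ ENNReal.ofReal (y s)
        + ENNReal.ofReal K * (∫⁻ τ in Ioo s t, ENNReal.ofReal (Real.exp (-k * (t - τ)) * h τ))
        + ENNReal.ofReal (K * c / k) := by
        gcongr
        exact hshift.trans (by gcongr)
    _ = _ := by
        rw [ENNReal.ofReal_add hys hKc]
        ring

theorem ofReal_le_add_lintegral_const_add {K c : ℝ} (hst : s ≤ t) (hst1 : t - s ≤ 1) (hK : 0 ≤ K)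
    (hc : 0 ≤ c) (hys : 0 ≤ y s) (hy : ContinuousOn y (Icc s t))
    (hderiv : ∀ τ ∈ Ioo s t, HasDerivAt y (y' τ) τ) (hh : ContinuousOn h (Ioo s t))
    (hle : ∀ τ ∈ Ioo s t, y' τ ≤ K * (c + h τ)) :
    ENNReal.ofReal (y t) ≤ ENNReal.ofReal (y s + K * c)
      + ENNReal.ofReal K * ∫⁻ τ in Ioo s t, ENNReal.ofReal (h τ) := by
  have hKc : 0 ≤ K * c := by positivity
  have hshift := ofReal_le_add_lintegral (y := fun τ => y τ - K * c * (τ - s))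
    (h := fun τ => K * h τ) (y' := fun τ => y' τ - K * c) hst (hy.sub (by fun_prop))
    (fun τ hτ => by
      refine (hderiv τ hτ).sub ?_
      simpa using ((hasDerivAt_id τ).sub_const s).const_mul (K * c))
    (continuousOn_const.mul hh) fun τ hτ => by linarith [hle τ hτ]
  simp only [ENNReal.ofReal_mul hK, sub_self, mul_zero, sub_zero] at hshift
  rw [lintegral_const_mul' _ _ ENNReal.ofReal_ne_top] at hshift
  calc ENNReal.ofReal (y t) ≤ ENNReal.ofReal (y t - K * c * (t - s) + K * c) :=
        ENNReal.ofReal_le_ofReal (by nlinarith)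
    _ ≤ ENNReal.ofReal (y t - K * c * (t - s)) + ENNReal.ofReal (K * c) := ENNReal.ofReal_add_le
    _ ≤ ENNReal.ofReal (y s) + ENNReal.ofReal K * (∫⁻ τ in Ioo s t, ENNReal.ofReal (h τ))
        + ENNReal.ofReal (K * c) := by gcongr
    _ = _ := by
        rw [ENNReal.ofReal_add hys hKc]
        ring

end DifferentialInequalities

section Limsup

variable {ι : Type*} {l : Filter ι}

theorem limsup_add_le_ennreal (u v : ι → ℝ≥0∞) :
    limsup (fun t => u t + v t) l ≤ limsup u l + limsup v l := by
  refine ENNReal.le_of_forall_pos_le_add fun ε hε hfin => ?_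
  obtain ⟨hu, hv⟩ := ENNReal.add_lt_top.1 hfin
  have hε_half : (ε : ℝ≥0∞) / 2 ≠ 0 := by simpa using hε.ne'
  refine limsup_le_of_le (by isBoundedDefault) ?_
  filter_upwards [eventually_lt_of_limsup_lt (ENNReal.lt_add_right hu.ne hε_half),
    eventually_lt_of_limsup_lt (ENNReal.lt_add_right hv.ne hε_half)] with t hut hvt
  calc u t + v t ≤ (limsup u l + ε / 2) + (limsup v l + ε / 2) := add_le_add hut.le hvt.le
    _ = limsup u l + limsup v l + ε := by rw [add_add_add_comm, ENNReal.add_halves]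

theorem limsup_rpow_ennreal [l.NeBot] {p : ℝ} (hp : 0 ≤ p) (u : ι → ℝ≥0∞) :
    limsup (fun t => u t ^ p) l = (limsup u l) ^ p :=
  (Monotone.map_limsup_of_continuousAt (f := fun x : ℝ≥0∞ => x ^ p)
    (fun _ _ h => ENNReal.rpow_le_rpow h hp) u ENNReal.continuous_rpow_const.continuousAt).symm

theorem limsup_sq_ennreal [l.NeBot] (u : ι → ℝ≥0∞) :
    limsup (fun t => u t ^ 2) l = (limsup u l) ^ 2 := by
  simpa only [ENNReal.rpow_two] using limsup_rpow_ennreal (l := l) zero_le_two u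

end Limsup

section Solution

variable {d : ℕ} {Ω : Set (EuclideanSpace ℝ (Fin d))} {P : GenPoly}

theorem inner_grad_le {ε : ℝ} (hε : 0 < ε) (F : L2Vec Ω) (w : H1 Ω) :
    inner ℝ F (grad w) ≤ ε * ‖F‖ ^ 2 + ε⁻¹ / 4 * ‖w‖ ^ 2 := by
  have hyoung := two_mul_le_add_mul_sq (a := ‖F‖) (b := ‖w‖) (mul_pos two_pos hε)
  rw [mul_inv] at hyoung
  calc inner ℝ F (grad w) ≤ ‖F‖ * ‖w‖ := by grw [real_inner_le_norm, norm_grad_le]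
    _ ≤ _ := by linarith

theorem GenPoly.inner_fluxOp_grad_le (P : GenPoly) {ε : ℝ} (hε : 0 < ε) (v : L2Vec Ω) (w : H1 Ω) :
    inner ℝ (P.fluxOp v) (grad w)
      ≤ ε * P.dissip v + ε⁻¹ / 4 * ((P.coeff 0)⁻¹ * ‖w‖ ^ 2) := by
  have hinner := inner_grad_le (mul_pos hε P.coeff_zero_pos) (P.fluxOp v) w
  have hdissip := mul_le_mul_of_nonneg_left (P.norm_fluxOp_sq_le v) hε.le
  rw [mul_inv] at hinner
  linarith

/-- A solution of the variational problem, bundled with its data. -/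
structure Solution (P : GenPoly) (Ω : Set (EuclideanSpace ℝ (Fin d))) where
  φ : ℝ → H1 Ω
  f : ℝ → L2 Ω
  ρ₀ : H1 Ω
  ρt : ℝ → H1 Ω
  regular : IsRegularData φ f
  weak : IsWeakSolution P φ f ρ₀ ρt

/-- The constant of the energy inequalities. -/
def GenPoly.energyConst (P : GenPoly) : ℝ := 3 + 2 * (P.coeff 0)⁻¹

theorem GenPoly.energyConst_pos (P : GenPoly) : 0 < P.energyConst := by
  have := inv_pos.2 P.coeff_zero_pos
  unfold energyConst
  positivity

namespace Solution

variable (u : Solution P Ω) {t : ℝ}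

/-- The source `f̃ = f - φ_t`. -/
abbrev source : ℝ → L2 Ω := fTilde u.φ u.f

/-- The gradient `∇ρ`, where `ρ = ρ̃ + φ`. -/
def gradρ (t : ℝ) : L2Vec Ω := grad (u.ρt t + u.φ t)

/-- `‖ρ̃‖²`. -/
def massSq (t : ℝ) : ℝ := ‖toL2 (u.ρt t)‖ ^ 2

/-- `‖ρ̃_t‖²`. -/
def rateSq (t : ℝ) : ℝ := ‖toL2 (deriv u.ρt t)‖ ^ 2

/-- The energy `∫_Ω Φ(|∇ρ|)` of the solution. -/
def energy (t : ℝ) : ℝ := P.energy (u.gradρ t)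

/-- The right-hand side `‖ρ̃‖² + ‖φ‖₁² + ‖f̃‖² + ‖φ_t‖₁²` of the energy inequalities. -/
def forcing (t : ℝ) : ℝ := u.massSq t + ‖u.φ t‖ ^ 2 + ‖u.source t‖ ^ 2 + ‖deriv u.φ t‖ ^ 2

theorem massSq_nonneg (t : ℝ) : 0 ≤ u.massSq t := sq_nonneg _

theorem rateSq_nonneg (t : ℝ) : 0 ≤ u.rateSq t := sq_nonneg _

theorem energy_nonneg (t : ℝ) : 0 ≤ u.energy t := P.energy_nonneg _

theorem forcing_nonneg (t : ℝ) : 0 ≤ u.forcing t := by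
  unfold forcing massSq
  positivity

theorem massSq_zero : u.massSq 0 = ‖toL2 (u.ρ₀ - u.φ 0)‖ ^ 2 := by rw [massSq, u.weak.initial]

theorem gradρ_zero : u.gradρ 0 = grad u.ρ₀ := by rw [gradρ, u.weak.initial, sub_add_cancel]

theorem hasDerivAt_of_contDiffOn {F : Type*} [NormedAddCommGroup F] [NormedSpace ℝ F] {v : ℝ → F}
    (hv : ContDiffOn ℝ 1 v (Ioi 0)) (ht : 0 < t) : HasDerivAt v (deriv v t) t :=
  ((hv.differentiableOn one_ne_zero t ht).differentiableAt (Ioi_mem_nhds ht)).hasDerivAt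

theorem hasDerivAt_φ (ht : 0 < t) : HasDerivAt u.φ (deriv u.φ t) t :=
  hasDerivAt_of_contDiffOn u.regular.contDiffOn_φ ht

theorem hasDerivAt_source (ht : 0 < t) : HasDerivAt u.source (deriv u.source t) t :=
  hasDerivAt_of_contDiffOn u.regular.contDiffOn_fTilde ht

theorem hasDerivAt_ρt (ht : 0 < t) : HasDerivAt u.ρt (deriv u.ρt t) t :=
  hasDerivAt_of_contDiffOn u.weak.contDiffOn_H1 ht

theorem hasDerivAt_toL2_ρt (ht : 0 < t) :
    HasDerivAt (fun s => toL2 (u.ρt s)) (toL2 (deriv u.ρt t)) t :=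
  toL2L.hasFDerivAt.comp_hasDerivAt t (u.hasDerivAt_ρt ht)

theorem hasDerivAt_toL2_deriv_ρt (ht : 0 < t) :
    HasDerivAt (fun s => toL2 (deriv u.ρt s)) (deriv (fun s => toL2 (deriv u.ρt s)) t) t := by
  have hrate : ContDiffOn ℝ 1 (deriv fun s => toL2 (u.ρt s)) (Ioi 0) :=
    u.weak.contDiffOn_L2.deriv_of_isOpen isOpen_Ioi (by norm_num)
  exact hasDerivAt_of_contDiffOn
    (hrate.congr fun s hs => (u.hasDerivAt_toL2_ρt hs).deriv.symm) ht

theorem deriv_ρt_mem_H01 (ht : 0 < t) : deriv u.ρt t ∈ H01 Ω :=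
  deriv_mem_H01 <| (eventually_gt_nhds ht).mono fun s hs => u.weak.mem_H01 s hs.le

theorem hasDerivAt_massSq (ht : 0 < t) :
    HasDerivAt u.massSq (2 * inner ℝ (toL2 (u.ρt t)) (toL2 (deriv u.ρt t))) t :=
  (u.hasDerivAt_toL2_ρt ht).norm_sq

theorem hasDerivAt_rateSq (ht : 0 < t) :
    HasDerivAt u.rateSq
      (2 * inner ℝ (toL2 (deriv u.ρt t)) (deriv (fun s => toL2 (deriv u.ρt s)) t)) t :=
  (u.hasDerivAt_toL2_deriv_ρt ht).norm_sq

theorem hasDerivAt_energy (ht : 0 < t) :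
    HasDerivAt u.energy
      (inner ℝ (P.fluxOp (u.gradρ t)) (grad (deriv u.ρt t + deriv u.φ t))) t :=
  (P.hasGradientAt_energy _).hasFDerivAt.comp_hasDerivAt t
    (gradL.hasFDerivAt.comp_hasDerivAt t ((u.hasDerivAt_ρt ht).add (u.hasDerivAt_φ ht)))

theorem differentiableAt_massSq (ht : 0 < t) : DifferentiableAt ℝ u.massSq t :=
  (u.hasDerivAt_massSq ht).differentiableAt

theorem differentiableAt_rateSq (ht : 0 < t) : DifferentiableAt ℝ u.rateSq t :=
  (u.hasDerivAt_rateSq ht).differentiableAt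

theorem differentiableAt_energy (ht : 0 < t) : DifferentiableAt ℝ u.energy t :=
  (u.hasDerivAt_energy ht).differentiableAt

theorem continuousOn_massSq : ContinuousOn u.massSq (Ici 0) :=
  (continuous_toL2.comp_continuousOn u.weak.continuousOn).norm.pow 2

theorem continuousOn_energy : ContinuousOn u.energy (Ici 0) :=
  P.continuous_energy.comp_continuousOn (gradL.continuous.comp_continuousOn
    (u.weak.continuousOn.add u.regular.continuousOn_φ))

theorem continuousOn_rateSq : ContinuousOn u.rateSq (Ioi 0) := fun _ ht =>
  (u.differentiableAt_rateSq ht).continuousAt.continuousWithinAt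

theorem continuousOn_norm_deriv_φ_sq : ContinuousOn (fun t => ‖deriv u.φ t‖ ^ 2) (Ioi 0) :=
  (u.regular.contDiffOn_φ.continuousOn_deriv_of_isOpen isOpen_Ioi le_rfl).norm.pow 2

theorem continuousOn_norm_deriv_source_sq :
    ContinuousOn (fun t => ‖deriv u.source t‖ ^ 2) (Ioi 0) :=
  (u.regular.contDiffOn_fTilde.continuousOn_deriv_of_isOpen isOpen_Ioi le_rfl).norm.pow 2

theorem inner_deriv_add_inner_fluxOp (ht : 0 < t) {w : H1 Ω} (hw : w ∈ H01 Ω) :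
    inner ℝ (toL2 (deriv u.ρt t)) (toL2 w) + inner ℝ (P.fluxOp (u.gradρ t)) (grad w)
      = inner ℝ (u.source t) (toL2 w) := by
  rw [P.inner_fluxOp]
  exact u.weak.variational t ht w hw

theorem dissip_gradρ (ht : 0 < t) :
    P.dissip (u.gradρ t) = inner ℝ (u.source t) (toL2 (u.ρt t))
      - inner ℝ (toL2 (u.ρt t)) (toL2 (deriv u.ρt t))
      + inner ℝ (P.fluxOp (u.gradρ t)) (grad (u.φ t)) := by
  have htest := u.inner_deriv_add_inner_fluxOp ht (u.weak.mem_H01 t ht.le)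
  have hsplit : P.dissip (u.gradρ t) = inner ℝ (P.fluxOp (u.gradρ t)) (grad (u.ρt t))
      + inner ℝ (P.fluxOp (u.gradρ t)) (grad (u.φ t)) := by
    rw [← inner_add_right, ← grad_add]
    rfl
  rw [hsplit, real_inner_comm (toL2 (deriv u.ρt t)) (toL2 (u.ρt t))]
  linarith

theorem deriv_massSq_add_dissip_le (ht : 0 < t) :
    deriv u.massSq t + P.dissip (u.gradρ t)
      ≤ (P.coeff 0)⁻¹ * ‖u.φ t‖ ^ 2 + 2 * (‖u.source t‖ * ‖toL2 (u.ρt t)‖) := by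
  have hcross := P.inner_fluxOp_grad_le one_half_pos (u.gradρ t) (u.φ t)
  rw [(u.hasDerivAt_massSq ht).deriv]
  linarith [u.dissip_gradρ ht, real_inner_le_norm (u.source t) (toL2 (u.ρt t))]

theorem deriv_massSq_add_energy_le (ht : 0 < t) :
    deriv u.massSq t + u.energy t
      ≤ P.energyConst * (u.massSq t + ‖u.φ t‖ ^ 2 + ‖u.source t‖ ^ 2) := by
  have hcoeff := inv_pos.2 P.coeff_zero_pos
  have hyoung := two_mul_le_add_sq ‖u.source t‖ ‖toL2 (u.ρt t)‖
  calc deriv u.massSq t + u.energy t ≤ deriv u.massSq t + P.dissip (u.gradρ t) := by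
        gcongr
        exact P.energy_le_dissip _
    _ ≤ (P.coeff 0)⁻¹ * ‖u.φ t‖ ^ 2 + (‖u.source t‖ ^ 2 + u.massSq t) := by
        rw [massSq]
        linarith [u.deriv_massSq_add_dissip_le ht]
    _ ≤ P.energyConst * ‖u.φ t‖ ^ 2 + P.energyConst * (‖u.source t‖ ^ 2 + u.massSq t) := by
        have hmass := u.massSq_nonneg t
        unfold GenPoly.energyConst
        gcongr
        · linarith
        · exact le_mul_of_one_le_left (by positivity) (by linarith)
    _ = _ := by ring

theorem dissip_gradρ_le (ht : 0 < t) :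
    3 / 4 * P.dissip (u.gradρ t)
      ≤ 1 / 2 * u.rateSq t + 2 * u.massSq t + ‖u.source t‖ ^ 2 + (P.coeff 0)⁻¹ * ‖u.φ t‖ ^ 2 := by
  have hcross := P.inner_fluxOp_grad_le one_half_pos (u.gradρ t) (u.φ t)
  have hsource := real_inner_le_norm (u.source t) (toL2 (u.ρt t))
  have hrate := (abs_le.1 (abs_real_inner_le_norm (toL2 (u.ρt t)) (toL2 (deriv u.ρt t)))).1
  have hφ := mul_nonneg (inv_pos.2 P.coeff_zero_pos).le (sq_nonneg ‖u.φ t‖)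
  unfold rateSq massSq
  linarith [u.dissip_gradρ ht, sq_nonneg (‖toL2 (deriv u.ρt t)‖ - 3 / 2 * ‖toL2 (u.ρt t)‖),
    sq_nonneg (‖u.source t‖ - ‖toL2 (u.ρt t)‖), sq_nonneg ‖u.source t‖,
    sq_nonneg ‖toL2 (u.ρt t)‖]

theorem inner_fluxOp_grad_deriv_le (ht : 0 < t) :
    inner ℝ (P.fluxOp (u.gradρ t)) (grad (deriv u.ρt t))
      ≤ ‖u.source t‖ ^ 2 - 3 / 4 * u.rateSq t := by
  have htest := u.inner_deriv_add_inner_fluxOp ht (u.deriv_ρt_mem_H01 ht)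
  rw [real_inner_self_eq_norm_sq] at htest
  unfold rateSq
  linarith [real_inner_le_norm (u.source t) (toL2 (deriv u.ρt t)),
    sq_nonneg (‖toL2 (deriv u.ρt t)‖ - 2 * ‖u.source t‖)]

theorem deriv_energy_le (ht : 0 < t) :
    deriv u.energy t + 1 / 4 * u.rateSq t + 1 / 2 * u.energy t ≤ P.energyConst * u.forcing t := by
  have hcoeff := (inv_pos.2 P.coeff_zero_pos).le
  have hφ_deriv : inner ℝ (P.fluxOp (u.gradρ t)) (grad (deriv u.φ t))
      ≤ 1 / 4 * P.dissip (u.gradρ t) + (P.coeff 0)⁻¹ * ‖deriv u.φ t‖ ^ 2 :=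
    (P.inner_fluxOp_grad_le (ε := 1 / 4) (by norm_num) _ _).trans_eq (by ring)
  have henergy : u.energy t ≤ P.dissip (u.gradρ t) := P.energy_le_dissip _
  have hforcing : 3 * (u.massSq t + ‖u.source t‖ ^ 2)
      + (P.coeff 0)⁻¹ * (‖u.φ t‖ ^ 2 + ‖deriv u.φ t‖ ^ 2) ≤ P.energyConst * u.forcing t := by
    have hmass := mul_nonneg hcoeff (u.massSq_nonneg t)
    have hsource := mul_nonneg hcoeff (sq_nonneg ‖u.source t‖)
    have hφ := mul_nonneg hcoeff (sq_nonneg ‖u.φ t‖)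
    have hφ' := mul_nonneg hcoeff (sq_nonneg ‖deriv u.φ t‖)
    unfold forcing GenPoly.energyConst
    linarith [sq_nonneg ‖u.φ t‖, sq_nonneg ‖deriv u.φ t‖]
  rw [(u.hasDerivAt_energy ht).deriv, grad_add, inner_add_right]
  linarith [u.dissip_gradρ_le ht, u.inner_fluxOp_grad_deriv_le ht, u.massSq_nonneg t,
    sq_nonneg ‖u.source t‖]

theorem inner_deriv_sub_le {s : ℝ} (hs : 0 < s) (ht : 0 < t) :
    inner ℝ (toL2 (deriv u.ρt s) - toL2 (deriv u.ρt t)) (toL2 (u.ρt s) - toL2 (u.ρt t))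
      ≤ inner ℝ (u.source s - u.source t) (toL2 (u.ρt s) - toL2 (u.ρt t))
        + (P.coeff 0)⁻¹ / 4 * ‖u.φ s - u.φ t‖ ^ 2 := by
  have hw := sub_mem_H01 (u.weak.mem_H01 s hs.le) (u.weak.mem_H01 t ht.le)
  have htest_s := u.inner_deriv_add_inner_fluxOp hs hw
  have htest_t := u.inner_deriv_add_inner_fluxOp ht hw
  have hcoercive := P.fluxOp_cocoercive (u.gradρ s) (u.gradρ t)
  have hcross := inner_grad_le P.coeff_zero_pos (P.fluxOp (u.gradρ s) - P.fluxOp (u.gradρ t))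
    (u.φ s - u.φ t)
  have hgrad : u.gradρ s - u.gradρ t = grad (u.ρt s - u.ρt t) + grad (u.φ s - u.φ t) := by
    simp only [gradρ, grad_add, grad_sub]
    abel
  rw [hgrad, inner_add_right, inner_sub_left (z := grad (u.ρt s - u.ρt t))] at hcoercive
  rw [← toL2_sub (u.ρt s), inner_sub_left, inner_sub_left]
  linarith

theorem inner_deriv_rate_le (ht : 0 < t) :
    inner ℝ (deriv (fun s => toL2 (deriv u.ρt s)) t) (toL2 (deriv u.ρt t))
      ≤ inner ℝ (deriv u.source t) (toL2 (deriv u.ρt t))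
        + (P.coeff 0)⁻¹ / 4 * ‖deriv u.φ t‖ ^ 2 := by
  have hrate := hasDerivAt_iff_tendsto_slope.1 (u.hasDerivAt_toL2_deriv_ρt ht)
  have hρt := hasDerivAt_iff_tendsto_slope.1 (u.hasDerivAt_toL2_ρt ht)
  have hsource := hasDerivAt_iff_tendsto_slope.1 (u.hasDerivAt_source ht)
  have hφ := hasDerivAt_iff_tendsto_slope.1 (u.hasDerivAt_φ ht)
  refine le_of_tendsto_of_tendsto (hrate.inner hρt)
    ((hsource.inner hρt).add ((hφ.norm.pow 2).const_mul _)) ?_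
  filter_upwards [nhdsWithin_le_nhds (Ioi_mem_nhds ht)] with s hs
  have := mul_le_mul_of_nonneg_left (u.inner_deriv_sub_le hs ht) (mul_self_nonneg (s - t)⁻¹)
  simp only [slope_def_module, real_inner_smul_left, real_inner_smul_right, norm_smul,
    Real.norm_eq_abs, mul_pow, sq_abs]
  linarith

theorem deriv_rateSq_le (ht : 0 < t) :
    deriv u.rateSq t
      ≤ u.rateSq t + ‖deriv u.source t‖ ^ 2 + P.energyConst * u.forcing t := by
  have hcoeff := inv_pos.2 P.coeff_zero_pos
  have hforcing : (P.coeff 0)⁻¹ / 2 * ‖deriv u.φ t‖ ^ 2 ≤ P.energyConst * u.forcing t := by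
    have hmass := u.massSq_nonneg t
    unfold GenPoly.energyConst forcing
    gcongr
    · linarith
    · exact le_add_of_nonneg_left (by positivity)
  have hinner := u.inner_deriv_rate_le ht
  rw [real_inner_comm] at hinner
  rw [(u.hasDerivAt_rateSq ht).deriv]
  unfold rateSq at *
  linarith [real_inner_le_norm (deriv u.source t) (toL2 (deriv u.ρt t)),
    two_mul_le_add_sq ‖deriv u.source t‖ ‖toL2 (deriv u.ρt t)‖]

end Solution

end Solution

section Mass

variable {d : ℕ} {Ω : Set (EuclideanSpace ℝ (Fin d))} {P : GenPoly}

theorem enorm_sq {F : Type*} [NormedAddCommGroup F] (x : F) :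
    ‖x‖ₑ ^ 2 = ENNReal.ofReal (‖x‖ ^ 2) := by
  rw [ENNReal.ofReal_pow (norm_nonneg _), ofReal_norm]

theorem exists_mul_le_mul_rpow_add_mul_rpow {p q : ℝ} (hpq : p.HolderConjugate q) {ε : ℝ}
    (hε : 0 < ε) :
    ∃ N, 0 < N ∧ ∀ x y : ℝ, 0 ≤ x → 0 ≤ y → x * y ≤ ε * x ^ p + N * y ^ q := by
  set κ := ε ^ p⁻¹
  have hκ : 0 < κ := by positivity
  refine ⟨κ⁻¹ ^ q, by positivity, fun x y hx hy => ?_⟩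
  calc x * y = (κ * x) * (κ⁻¹ * y) := by field_simp
    _ ≤ (κ * x) ^ p / p + (κ⁻¹ * y) ^ q / q :=
        Real.young_inequality_of_nonneg (by positivity) (by positivity) hpq
    _ ≤ (κ * x) ^ p + (κ⁻¹ * y) ^ q :=
        add_le_add (div_le_self (by positivity) hpq.lt.le)
          (div_le_self (by positivity) hpq.symm.lt.le)
    _ = ε * x ^ p + κ⁻¹ ^ q * y ^ q := by
        rw [Real.mul_rpow hκ.le hx, Real.mul_rpow (inv_nonneg.2 hκ.le) hy,
          Real.rpow_inv_rpow hε.le hpq.pos.ne']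

theorem GenPoly.dissip_grad_le (P : GenPoly) (v : H1 Ω) :
    P.dissip (grad v) ≤ (P.coeff 0)⁻¹ * ‖v‖ ^ 2 := by
  have := inv_pos.2 P.coeff_zero_pos
  grw [P.dissip_le, norm_grad_le]

theorem GenPoly.two_mul_div_le_β (P : GenPoly) {d : ℕ} (hdeg : P.a ≤ 4 / ((d : ℝ) + 2)) :
    2 * (d : ℝ) / (d + 2) ≤ P.β := by
  have : 2 * (d : ℝ) / (d + 2) = 2 - 4 / (d + 2) := by
    field_simp
    ring
  rw [this, GenPoly.β]
  linarith

theorem GenPoly.one_le_two_div_β (P : GenPoly) : 1 ≤ 2 / P.β := by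
  rw [one_le_div P.β_pos]
  exact P.β_lt_two.le

theorem le_one_add_rpow {x p : ℝ} (hx : 0 ≤ x) (hp : 1 ≤ p) : x ≤ 1 + x ^ p := by
  have hpow := Real.rpow_nonneg hx p
  rcases le_total x 1 with h | h
  · linarith
  · linarith [Real.self_le_rpow_of_one_le h hp]

namespace Solution

/-- The function `g = ‖f̃‖^λ + ‖φ‖₁²` measuring the data of the problem. -/
abbrev g (u : Solution P Ω) : ℝ → ℝ := gFun P u.φ u.f

theorem g_nonneg (u : Solution P Ω) (t : ℝ) : 0 ≤ u.g t := by
  unfold g gFun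
  positivity

end Solution

theorem IsEnvelope.nonneg {u : Solution P Ω} {G : ℝ → ℝ} (hG : IsEnvelope (Ioi 0) u.g G) {t : ℝ}
    (ht : 0 < t) : 0 ≤ G t := (u.g_nonneg t).trans (hG.le t ht)

theorem IsEnvelope.g_le {u : Solution P Ω} {G : ℝ → ℝ} (hG : IsEnvelope (Ioi 0) u.g G) {s t : ℝ}
    (hs : 0 < s) (hst : s ≤ t) : u.g s ≤ G t :=
  (hG.le s hs).trans (hG.monotoneOn hs (hs.trans_le hst) hst)

theorem IsEnvelope.norm_φ_zero_sq_le {u : Solution P Ω} {G : ℝ → ℝ}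
    (hG : IsEnvelope (Ioi 0) u.g G) {t : ℝ} (ht : 0 < t) : ‖u.φ 0‖ ^ 2 ≤ G t := by
  have hlim : Tendsto (fun s => ‖u.φ s‖ ^ 2) (𝓝[>] 0) (𝓝 (‖u.φ 0‖ ^ 2)) :=
    ((u.regular.continuousOn_φ 0 self_mem_Ici).mono_left
      (nhdsWithin_mono 0 Ioi_subset_Ici_self)).norm.pow 2
  refine le_of_tendsto hlim ?_
  filter_upwards [Ioo_mem_nhdsGT ht] with s hs
  exact (le_add_of_nonneg_left (by positivity)).trans (hG.g_le hs.1 hs.2.le)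

section Bounds

variable [IsFiniteMeasure (volume.restrict Ω)] (hPS : PoincareSobolev P.β Ω)
include hPS

theorem PoincareSobolev.exists_rpow_norm_le {δ : ℝ} (hδ : 0 < δ) :
    ∃ M, 0 < M ∧ ∀ w ∈ H01 Ω, ∀ v : H1 Ω,
      ‖toL2 w‖ ^ P.β ≤ δ + M * (P.dissip (grad (w + v)) + (P.coeff 0)⁻¹ * ‖v‖ ^ 2) := by
  obtain ⟨S, hS, hsobolev⟩ := hPS
  obtain ⟨R, hR, hdissip⟩ := P.exists_powInt_le (Ω := Ω) (δ := δ / (4 * S)) (by positivity)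
  refine ⟨2 * S * R, by positivity, fun w hw v => ?_⟩
  calc ‖toL2 w‖ ^ P.β ≤ S * powInt P.β (grad (w + v) - grad v) := by
        simpa only [grad_add, add_sub_cancel_right] using hsobolev w hw
    _ ≤ S * (2 * (powInt P.β (grad (w + v)) + powInt P.β (grad v))) := by
        grw [powInt_sub_le P.one_lt_β.le P.β_lt_two.le]
    _ ≤ S * (2 * ((δ / (4 * S) + R * P.dissip (grad (w + v)))
          + (δ / (4 * S) + R * ((P.coeff 0)⁻¹ * ‖v‖ ^ 2)))) := by
        grw [hdissip (grad (w + v)), hdissip (grad v), P.dissip_grad_le v]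
    _ = _ := by
        field_simp
        ring

theorem exists_deriv_massSq_le {δ : ℝ} (hδ : 0 < δ) :
    ∃ c D, 0 < c ∧ 0 < D ∧ ∀ (u : Solution P Ω) (t : ℝ), 0 < t →
      deriv u.massSq t ≤ c * (-u.massSq t ^ (P.β / 2) + (δ + D * u.g t)) := by
  obtain ⟨M, hM, hcoercive⟩ := hPS.exists_rpow_norm_le (P := P) (half_pos hδ)
  obtain ⟨N, hN, hyoung⟩ := exists_mul_le_mul_rpow_add_mul_rpow P.holderConjugate
    (ε := 1 / (4 * M)) (by positivity)
  have hcoeff := inv_pos.2 P.coeff_zero_pos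
  refine ⟨1 / (2 * M), 4 * M * ((P.coeff 0)⁻¹ + N), by positivity, by positivity, fun u t ht => ?_⟩
  have hmass : u.massSq t ^ (P.β / 2) = ‖toL2 (u.ρt t)‖ ^ P.β := by
    rw [Solution.massSq, ← Real.rpow_natCast_mul (norm_nonneg _)]
    congr 1
    push_cast
    ring
  have hdissip : u.massSq t ^ (P.β / 2)
      ≤ δ / 2 + M * (P.dissip (u.gradρ t) + (P.coeff 0)⁻¹ * ‖u.φ t‖ ^ 2) :=
    hmass.trans_le (hcoercive _ (u.weak.mem_H01 t ht.le) _)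
  have hsource : 2 * M * (2 * (‖u.source t‖ * ‖toL2 (u.ρt t)‖))
      ≤ u.massSq t ^ (P.β / 2) + 4 * M * N * ‖u.source t‖ ^ P.lam := by
    calc 2 * M * (2 * (‖u.source t‖ * ‖toL2 (u.ρt t)‖))
        = 4 * M * (‖toL2 (u.ρt t)‖ * ‖u.source t‖) := by ring
      _ ≤ 4 * M * (1 / (4 * M) * ‖toL2 (u.ρt t)‖ ^ P.β + N * ‖u.source t‖ ^ P.lam) := by
          grw [hyoung _ _ (norm_nonneg _) (norm_nonneg _)]
      _ = _ := by
          rw [hmass]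
          field_simp
  have hderiv := mul_le_mul_of_nonneg_left (u.deriv_massSq_add_dissip_le ht)
    (by positivity : 0 ≤ 2 * M)
  rw [one_div, ← div_eq_inv_mul, le_div_iff₀' (by positivity), Solution.g, gFun]
  have hφ : 0 ≤ M * N * ‖u.φ t‖ ^ 2 := by positivity
  have hf : 0 ≤ M * (P.coeff 0)⁻¹ * ‖u.source t‖ ^ P.lam := by positivity
  linarith

theorem exists_massSq_le :
    ∃ D, 0 < D ∧ ∀ (u : Solution P Ω) (G : ℝ → ℝ), IsEnvelope (Ioi 0) u.g G → ∀ t, 0 < t →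
      u.massSq t ≤ ‖toL2 (u.ρ₀ - u.φ 0)‖ ^ 2 + D * (1 + G t ^ (2 / P.β)) := by
  obtain ⟨c, D, hc, hD, hdecay⟩ := exists_deriv_massSq_le hPS one_pos
  have hexp := P.one_le_two_div_β
  have hβ := P.β_pos
  refine ⟨2 ^ (2 / P.β - 1) * (1 + D ^ (2 / P.β)), by positivity, fun u G hG t ht => ?_⟩
  have hGt := hG.nonneg ht
  set B := (1 + D * G t) ^ (2 / P.β) with hB
  have hB_rpow : B ^ (P.β / 2) = 1 + D * G t := by
    rw [hB, ← inv_div, Real.rpow_inv_rpow (by positivity) (by positivity)]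
  have hB_le : B ≤ 2 ^ (2 / P.β - 1) * (1 + D ^ (2 / P.β)) * (1 + G t ^ (2 / P.β)) := by
    calc B ≤ 2 ^ (2 / P.β - 1) * (1 + D ^ (2 / P.β) * G t ^ (2 / P.β)) := by
          rw [← Real.mul_rpow hD.le hGt]
          simpa only [Real.one_rpow] using add_rpow_le_mul zero_le_one (mul_nonneg hD.le hGt) hexp
      _ ≤ 2 ^ (2 / P.β - 1) * ((1 + D ^ (2 / P.β)) * (1 + G t ^ (2 / P.β))) := by
          gcongr
          have hDpow := Real.rpow_nonneg hD.le (2 / P.β)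
          have hGpow := Real.rpow_nonneg hGt (2 / P.β)
          linarith
      _ = _ := by ring
  have hbound : u.massSq t ≤ u.massSq 0 + B := by
    refine le_of_deriv_nonpos_above ht.le (u.continuousOn_massSq.mono Icc_subset_Ici_self)
      (fun τ hτ => (u.differentiableAt_massSq hτ.1).hasDerivAt) (fun τ hτ hlt => ?_)
      (le_add_of_nonneg_right (by positivity))
    refine (hdecay u τ hτ.1).trans (mul_nonpos_of_nonneg_of_nonpos hc.le ?_)
    have hpow : B ^ (P.β / 2) ≤ u.massSq τ ^ (P.β / 2) :=
      Real.rpow_le_rpow (by positivity) (by linarith [u.massSq_nonneg 0]) (by positivity)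
    linarith [mul_le_mul_of_nonneg_left (hG.g_le hτ.1 hτ.2.le) hD.le]
  rw [u.massSq_zero] at hbound
  linarith

theorem eventually_norm_le :
    ∀ᶠ C : ℝ≥0 in atTop, ∀ (u : Solution P Ω) (G : ℝ → ℝ), IsEnvelope (Ioi 0) u.g G →
      ∀ t, 0 < t → ‖toL2 (u.ρt t)‖ ≤ C * (1 + ‖toL2 u.ρ₀‖ + G t ^ (1 / P.β)) := by
  obtain ⟨D, hD, hmass⟩ := exists_massSq_le hPS
  filter_upwards [eventually_ge_atTop (1 + D).toNNReal] with C hC u G hG t ht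
  have hGt := hG.nonneg ht
  have hC_real : 1 + D ≤ C := Real.toNNReal_le_iff_le_coe.1 hC
  set x := G t ^ (1 / P.β) with hx
  have hx_sq : G t ^ (2 / P.β) = x ^ 2 := by
    rw [hx, ← Real.rpow_mul_natCast hGt]
    congr 1
    push_cast
    ring
  have hφ : ‖toL2 (u.φ 0)‖ ≤ 1 + x := by
    refine (norm_toL2_le _).trans (abs_le_of_sq_le_sq' (b := 1 + x) ?_ (by positivity)).2
    calc ‖u.φ 0‖ ^ 2 ≤ 1 + x ^ 2 :=
          hx_sq ▸ (hG.norm_φ_zero_sq_le ht).trans (le_one_add_rpow hGt P.one_le_two_div_β)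
      _ ≤ (1 + x) ^ 2 := by linarith [(by positivity : 0 ≤ x)]
  have hinit : ‖toL2 (u.ρ₀ - u.φ 0)‖ ≤ 1 + ‖toL2 u.ρ₀‖ + x := by
    rw [toL2_sub]
    linarith [norm_sub_le (toL2 u.ρ₀) (toL2 (u.φ 0))]
  have hsq : ‖toL2 (u.ρt t)‖ ^ 2 ≤ ((1 + D) * (1 + ‖toL2 u.ρ₀‖ + x)) ^ 2 := by
    calc ‖toL2 (u.ρt t)‖ ^ 2 ≤ ‖toL2 (u.ρ₀ - u.φ 0)‖ ^ 2 + D * (1 + x ^ 2) :=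
          hx_sq ▸ hmass u G hG t ht
      _ ≤ (1 + ‖toL2 u.ρ₀‖ + x) ^ 2 + D * (1 + ‖toL2 u.ρ₀‖ + x) ^ 2 := by
          gcongr
          nlinarith [norm_nonneg (toL2 u.ρ₀), (by positivity : 0 ≤ x)]
      _ ≤ _ := by nlinarith [sq_nonneg (1 + ‖toL2 u.ρ₀‖ + x), sq_nonneg D]
  calc ‖toL2 (u.ρt t)‖ ≤ (1 + D) * (1 + ‖toL2 u.ρ₀‖ + x) :=
        (abs_le_of_sq_le_sq' hsq (by positivity)).2
    _ ≤ _ := by gcongr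

theorem exists_limsup_norm_sq_le {δ : ℝ} (hδ : 0 < δ) :
    ∃ D : ℝ≥0, ∀ u : Solution P Ω,
      limsup (fun t => ‖toL2 (u.ρt t)‖ₑ ^ 2) atTop ≤ (ENNReal.ofReal δ
        + D * limsup (fun t => ENNReal.ofReal (u.g t)) atTop) ^ (2 / P.β) := by
  obtain ⟨c, D, hc, hD, hdecay⟩ := exists_deriv_massSq_le hPS hδ
  refine ⟨D.toNNReal, fun u => ?_⟩
  have hlimsup := limsup_le_of_deriv_le (h := fun t => δ + D * u.g t) hc (half_pos P.β_pos)
    ((eventually_gt_atTop 0).mono fun t ht => (u.differentiableAt_massSq ht).hasDerivAt)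
    ((eventually_gt_atTop 0).mono (hdecay u))
  rw [one_div_div] at hlimsup
  simp only [enorm_sq]
  refine hlimsup.trans (ENNReal.rpow_le_rpow ?_ (div_pos two_pos P.β_pos).le)
  simp only [ENNReal.ofReal_add hδ.le (mul_nonneg hD.le (u.g_nonneg _)), ENNReal.ofReal_mul hD.le]
  rw [limsup_const_add _ _ _ (by isBoundedDefault) (by isBoundedDefault),
    ENNReal.limsup_const_mul_of_ne_top ENNReal.ofReal_ne_top]
  rfl

theorem eventually_limsup_norm_sq_le :
    ∀ᶠ C : ℝ≥0 in atTop, ∀ u : Solution P Ω,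
      limsup (fun t => ‖toL2 (u.ρt t)‖ₑ ^ 2) atTop
        ≤ C * (1 + limsup (fun t => ENNReal.ofReal (u.g t)) atTop) ^ (2 / P.β) := by
  obtain ⟨D, hD⟩ := exists_limsup_norm_sq_le hPS one_pos
  have hexp : 0 ≤ 2 / P.β := (div_pos two_pos P.β_pos).le
  filter_upwards [eventually_ge_atTop ((1 + D) ^ (2 / P.β))] with C hC u
  have hC_coe : ((1 : ℝ≥0∞) + D) ^ (2 / P.β) ≤ C := by
    rw [← ENNReal.coe_one, ← ENNReal.coe_add, ← ENNReal.coe_rpow_of_nonneg _ hexp]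
    exact ENNReal.coe_le_coe.2 hC
  refine (hD u).trans ?_
  grw [← hC_coe, ← ENNReal.mul_rpow_of_nonneg _ _ hexp, ENNReal.ofReal_one, add_mul, one_mul]
  gcongr
  · exact le_self_add
  · exact le_add_self

theorem limsup_norm_sq_eq_zero (u : Solution P Ω)
    (hg : limsup (fun t => ENNReal.ofReal (u.g t)) atTop = 0) :
    limsup (fun t => ‖toL2 (u.ρt t)‖ₑ ^ 2) atTop = 0 := by
  have hexp : 0 < 2 / P.β := div_pos two_pos P.β_pos
  have hroot : limsup (fun t => ‖toL2 (u.ρt t)‖ₑ ^ 2) atTop ^ (2 / P.β)⁻¹ ≤ 0 := by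
    refine ENNReal.le_of_forall_pos_le_add fun δ hδ _ => ?_
    obtain ⟨D, hD⟩ := exists_limsup_norm_sq_le hPS (NNReal.coe_pos.2 hδ)
    rw [ENNReal.rpow_inv_le_iff hexp]
    simpa only [hg, mul_zero, add_zero, zero_add, ENNReal.ofReal_coe_nnreal] using hD u
  exact (ENNReal.rpow_eq_zero_iff_of_pos (inv_pos.2 hexp)).1 (nonpos_iff_eq_zero.1 hroot)

end Bounds

theorem Solution.limsup_g_eq_zero (u : Solution P Ω)
    (hf : limsup (fun t => ‖u.source t‖ₑ) atTop = 0) (hφ : limsup (fun t => ‖u.φ t‖ₑ) atTop = 0) :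
    limsup (fun t => ENNReal.ofReal (u.g t)) atTop = 0 := by
  have hlam : 0 < P.lam := P.holderConjugate.symm.pos
  have hg t : ENNReal.ofReal (u.g t) = ‖u.source t‖ₑ ^ P.lam + ‖u.φ t‖ₑ ^ 2 := by
    rw [Solution.g, gFun, ENNReal.ofReal_add (by positivity) (by positivity), enorm_sq,
      ← ENNReal.ofReal_rpow_of_nonneg (norm_nonneg _) hlam.le, ofReal_norm]
  simp only [hg]
  refine le_antisymm ((limsup_add_le_ennreal _ _).trans ?_) zero_le
  rw [limsup_rpow_ennreal hlam.le, limsup_sq_ennreal, hf, hφ, ENNReal.zero_rpow_of_pos hlam]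
  simp

end Mass

theorem ofReal_add_mul_le {x A K L : ℝ} (hL : 0 ≤ L) (hx : x ≤ L * A) (hKL : K ≤ L) (I : ℝ≥0∞) :
    ENNReal.ofReal x + ENNReal.ofReal K * I
      ≤ (L.toNNReal : ℝ≥0∞) * (ENNReal.ofReal A + I) := by
  grw [hx, hKL, ENNReal.ofReal_mul hL, mul_add]
  rfl

theorem eventually_one_add_mul_le (R D : ℝ≥0) :
    ∀ᶠ C : ℝ≥0 in atTop, ∀ x B : ℝ≥0∞, 1 ≤ B → x ≤ D * B → 1 + R * x ≤ C * B := by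
  filter_upwards [eventually_ge_atTop (1 + R * D)] with C hC x B hB hx
  calc 1 + R * x ≤ B + R * (D * B) := by gcongr
    _ = ((1 + R * D : ℝ≥0) : ℝ≥0∞) * B := by
        push_cast
        ring
    _ ≤ C * B := by gcongr

section Gradient

variable {d : ℕ} {Ω : Set (EuclideanSpace ℝ (Fin d))} {P : GenPoly}

theorem norm_toL2_sub_sq_le (v w : H1 Ω) :
    ‖toL2 (v - w)‖ ^ 2 ≤ 2 * (‖v‖ ^ 2 + ‖toL2 w‖ ^ 2) := by
  grw [toL2_sub, norm_sub_le, norm_toL2_le v]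
  exact add_sq_le

theorem IsEnvelope.continuousOn_rpow {u : Solution P Ω} {G : ℝ → ℝ}
    (hG : IsEnvelope (Ioi 0) u.g G) : ContinuousOn (fun t => G t ^ (2 / P.β)) (Ioi 0) :=
  hG.continuousOn.rpow_const fun _ _ => Or.inr (zero_le_one.trans P.one_le_two_div_β)

namespace Solution

variable (u : Solution P Ω)

theorem norm_φ_sq_le (t : ℝ) : ‖u.φ t‖ ^ 2 ≤ u.g t := le_add_of_nonneg_left (by positivity)

theorem norm_source_sq_le (t : ℝ) : ‖u.source t‖ ^ 2 ≤ 1 + u.g t := by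
  have hpow := le_one_add_rpow (x := ‖u.source t‖ ^ (2 : ℝ)) (p := P.lam / 2) (by positivity)
    (by linarith [P.two_le_lam])
  rw [← Real.rpow_mul (norm_nonneg _), mul_div_cancel₀ _ two_ne_zero, Real.rpow_two] at hpow
  unfold g gFun
  linarith [sq_nonneg ‖u.φ t‖]

theorem energy_zero_le : u.energy 0 ≤ (P.coeff 0)⁻¹ * ‖u.ρ₀‖ ^ 2 := by
  rw [energy, u.gradρ_zero]
  exact (P.energy_le_dissip _).trans (P.dissip_grad_le _)

theorem limsup_forcing_le :
    limsup (fun t => ENNReal.ofReal (u.forcing t)) atTop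
      ≤ limsup (fun t => ‖toL2 (u.ρt t)‖ₑ ^ 2) atTop + limsup (fun t => ‖u.φ t‖ₑ ^ 2) atTop
        + limsup (fun t => ‖u.source t‖ₑ ^ 2) atTop
        + limsup (fun t => ‖deriv u.φ t‖ₑ ^ 2) atTop := by
  have hforcing t : ENNReal.ofReal (u.forcing t)
      = ‖toL2 (u.ρt t)‖ₑ ^ 2 + ‖u.φ t‖ₑ ^ 2 + ‖u.source t‖ₑ ^ 2 + ‖deriv u.φ t‖ₑ ^ 2 := by
    rw [forcing, massSq, ENNReal.ofReal_add (by positivity) (by positivity),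
      ENNReal.ofReal_add (by positivity) (by positivity),
      ENNReal.ofReal_add (by positivity) (by positivity)]
    simp only [enorm_sq]
  simp only [hforcing]
  grw [limsup_add_le_ennreal, limsup_add_le_ennreal, limsup_add_le_ennreal]

theorem limsup_energy_le :
    limsup (fun t => ENNReal.ofReal (u.energy t)) atTop ≤
      ENNReal.ofReal (2 * P.energyConst)
        * limsup (fun t => ENNReal.ofReal (u.forcing t)) atTop := by
  have hκ := P.energyConst_pos
  rw [← ENNReal.limsup_const_mul_of_ne_top ENNReal.ofReal_ne_top]
  simp only [← ENNReal.ofReal_mul (by positivity : 0 ≤ 2 * P.energyConst)]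
  refine limsup_le_of_deriv_add_le one_half_pos
    ((eventually_gt_atTop 0).mono fun t ht => (u.differentiableAt_energy ht).hasDerivAt)
    ((eventually_gt_atTop 0).mono fun t ht => ?_)
  linarith [u.deriv_energy_le ht, u.rateSq_nonneg t]

end Solution

section Bounds

variable [IsFiniteMeasure (volume.restrict Ω)]

theorem exists_gradNorm_rpow_le (P : GenPoly) {δ : ℝ} (hδ : 0 < δ) :
    ∃ R : ℝ≥0, ∀ (u : Solution P Ω) (t : ℝ),
      gradNorm P.β (u.ρt t + u.φ t) ^ P.β
        ≤ ENNReal.ofReal δ + R * ENNReal.ofReal (u.energy t) := by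
  obtain ⟨C, hC, hdissip⟩ := P.exists_powInt_le (Ω := Ω) hδ
  refine ⟨(C * 2).toNNReal, fun u t => ?_⟩
  rw [gradNorm_rpow P.β_pos P.β_lt_two.le]
  calc ENNReal.ofReal (powInt P.β (u.gradρ t)) ≤ ENNReal.ofReal (δ + C * 2 * u.energy t) := by
        gcongr
        grw [hdissip, P.dissip_le_energy, mul_assoc]
        rfl
    _ ≤ ENNReal.ofReal δ + ENNReal.ofReal (C * 2 * u.energy t) := ENNReal.ofReal_add_le
    _ = _ := by
        rw [ENNReal.ofReal_mul (by positivity)]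
        rfl

theorem exists_limsup_gradNorm_rpow_le (P : GenPoly) {δ : ℝ} (hδ : 0 < δ) :
    ∃ R : ℝ≥0, ∀ u : Solution P Ω,
      limsup (fun t => gradNorm P.β (u.ρt t + u.φ t) ^ P.β) atTop
        ≤ ENNReal.ofReal δ + R * limsup (fun t => ENNReal.ofReal (u.energy t)) atTop := by
  obtain ⟨R, hgrad⟩ := exists_gradNorm_rpow_le (Ω := Ω) P hδ
  refine ⟨R, fun u => ?_⟩
  rw [← ENNReal.limsup_const_mul_of_ne_top ENNReal.coe_ne_top,
    ← limsup_const_add _ _ _ (by isBoundedDefault) (by isBoundedDefault)]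
  exact limsup_le_limsup (.of_forall (hgrad u))

variable (hPS : PoincareSobolev P.β Ω)
include hPS

theorem exists_forcing_le :
    ∃ D, 0 < D ∧ ∀ (u : Solution P Ω) (G : ℝ → ℝ), IsEnvelope (Ioi 0) u.g G → ∀ t, 0 < t →
      u.forcing t
        ≤ D * (1 + ‖toL2 (u.ρ₀ - u.φ 0)‖ ^ 2 + (‖deriv u.φ t‖ ^ 2 + G t ^ (2 / P.β))) := by
  obtain ⟨D, hD, hmass⟩ := exists_massSq_le hPS
  refine ⟨D + 3, by positivity, fun u G hG t ht => ?_⟩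
  have hg := (hG.le t ht).trans (le_one_add_rpow (hG.nonneg ht) P.one_le_two_div_β)
  have hGpow : 0 ≤ G t ^ (2 / P.β) := Real.rpow_nonneg (hG.nonneg ht) _
  calc u.forcing t
      ≤ ‖toL2 (u.ρ₀ - u.φ 0)‖ ^ 2 + D * (1 + G t ^ (2 / P.β)) + ‖deriv u.φ t‖ ^ 2
        + 3 * (1 + G t ^ (2 / P.β)) := by
        unfold Solution.forcing
        linarith [hmass u G hG t ht, u.norm_φ_sq_le t, u.norm_source_sq_le t]
    _ ≤ (D + 3) * ‖toL2 (u.ρ₀ - u.φ 0)‖ ^ 2 + D * (1 + G t ^ (2 / P.β))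
        + (D + 3) * ‖deriv u.φ t‖ ^ 2 + 3 * (1 + G t ^ (2 / P.β)) := by
        gcongr <;> exact le_mul_of_one_le_left (by positivity) (by linarith)
    _ = _ := by ring

theorem exists_energy_le_boundA :
    ∃ C : ℝ≥0, ∀ (u : Solution P Ω) (G : ℝ → ℝ), IsEnvelope (Ioi 0) u.g G → ∀ t, 0 < t →
      ENNReal.ofReal (u.energy t) ≤ C * boundA P u.φ u.ρ₀ G t := by
  obtain ⟨D, hD, hforcing⟩ := exists_forcing_le hPS
  have hcoeff := inv_pos.2 P.coeff_zero_pos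
  have hκ := P.energyConst_pos
  set K := P.energyConst * D with hK
  have hK_pos : 0 < K := by positivity
  refine ⟨((P.coeff 0)⁻¹ + 4 * K).toNNReal, fun u G hG t ht => ?_⟩
  have hgronwall := gronwall_lintegral_const_add (k := 1 / 2) (K := K)
    (c := 1 + ‖toL2 (u.ρ₀ - u.φ 0)‖ ^ 2) (h := fun τ => ‖deriv u.φ τ‖ ^ 2 + G τ ^ (2 / P.β))
    ht.le one_half_pos hK_pos.le (by positivity) (u.energy_nonneg 0)
    (u.continuousOn_energy.mono Icc_subset_Ici_self)
    (fun τ hτ => (u.differentiableAt_energy hτ.1).hasDerivAt)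
    ((u.continuousOn_norm_deriv_φ_sq.add hG.continuousOn_rpow).mono fun τ hτ => hτ.1)
    (fun τ hτ => by
      have := mul_le_mul_of_nonneg_left (hforcing u G hG τ hτ.1) hκ.le
      rw [hK, mul_assoc]
      linarith [u.deriv_energy_le hτ.1, u.rateSq_nonneg τ])
  refine hgronwall.trans (ofReal_add_mul_le (by positivity) ?_ (by linarith) _)
  have hinit := mul_le_mul_of_nonneg_left (norm_toL2_sub_sq_le u.ρ₀ (u.φ 0)) hK_pos.le
  have hφ := mul_nonneg hcoeff.le (sq_nonneg ‖toL2 (u.φ 0)‖)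
  linarith [u.energy_zero_le]

theorem eventually_gradNorm_le_boundA :
    ∀ᶠ C : ℝ≥0 in atTop, ∀ (u : Solution P Ω) (G : ℝ → ℝ), IsEnvelope (Ioi 0) u.g G →
      ∀ t, 0 < t → gradNorm P.β (u.ρt t + u.φ t) ^ P.β ≤ C * boundA P u.φ u.ρ₀ G t := by
  obtain ⟨R, hgrad⟩ := exists_gradNorm_rpow_le (Ω := Ω) P one_pos
  obtain ⟨D, henergy⟩ := exists_energy_le_boundA hPS
  filter_upwards [eventually_one_add_mul_le R D] with C hC u G hG t ht
  have hone : 1 ≤ boundA P u.φ u.ρ₀ G t := by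
    refine le_add_right (ENNReal.one_le_ofReal.2 ?_)
    rw [add_assoc]
    exact le_add_of_nonneg_right (by positivity)
  grw [hgrad, ENNReal.ofReal_one, hC _ _ hone (henergy u G hG t ht)]

theorem exists_limsup_forcing_le :
    ∃ C : ℝ≥0, ∀ u : Solution P Ω,
      limsup (fun t => ENNReal.ofReal (u.forcing t)) atTop
        ≤ C * (1 + limsup (fun t => ‖deriv u.φ t‖ₑ ^ 2) atTop
          + limsup (fun t => ENNReal.ofReal (u.g t)) atTop ^ (2 / P.β)) := by
  obtain ⟨C, hmass⟩ := (eventually_limsup_norm_sq_le hPS).exists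
  refine ⟨(C + 2) * 2 ^ (2 / P.β - 1) + 1, fun u => ?_⟩
  set L := limsup (fun t => ENNReal.ofReal (u.g t)) atTop
  set N := limsup (fun t => ‖deriv u.φ t‖ₑ ^ 2) atTop
  have hφ : limsup (fun t => ‖u.φ t‖ₑ ^ 2) atTop ≤ L :=
    limsup_le_limsup (.of_forall fun t => by
      simpa only [enorm_sq] using ENNReal.ofReal_le_ofReal (u.norm_φ_sq_le t))
  have hsource : limsup (fun t => ‖u.source t‖ₑ ^ 2) atTop ≤ 1 + L := by
    rw [← limsup_const_add _ _ _ (by isBoundedDefault) (by isBoundedDefault)]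
    refine limsup_le_limsup (.of_forall fun t => ?_)
    simp only [enorm_sq]
    grw [u.norm_source_sq_le t, ENNReal.ofReal_add_le, ENNReal.ofReal_one]
  have hself : 1 + L ≤ (1 + L) ^ (2 / P.β) :=
    ENNReal.le_rpow_self_of_one_le le_self_add P.one_le_two_div_β
  have hpow : (1 + L) ^ (2 / P.β) ≤ 2 ^ (2 / P.β - 1) * (1 + L ^ (2 / P.β)) := by
    simpa only [ENNReal.one_rpow] using
      ENNReal.rpow_add_le_mul_rpow_add_rpow 1 L P.one_le_two_div_β
  calc limsup (fun t => ENNReal.ofReal (u.forcing t)) atTop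
      ≤ C * (1 + L) ^ (2 / P.β) + (1 + L) ^ (2 / P.β) + (1 + L) ^ (2 / P.β) + N := by
        refine u.limsup_forcing_le.trans ?_
        gcongr
        exacts [hmass u, hφ.trans (le_add_self.trans hself), hsource.trans hself]
    _ = (C + 2) * (1 + L) ^ (2 / P.β) + N := by ring
    _ ≤ (C + 2) * (2 ^ (2 / P.β - 1) * (1 + N + L ^ (2 / P.β))) + (1 + N + L ^ (2 / P.β)) := by
        grw [hpow]
        gcongr
        · exact le_self_add
        · exact le_add_right le_add_self
    _ = _ := by
        push_cast [ENNReal.coe_rpow_of_ne_zero (two_ne_zero (α := ℝ≥0))]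
        ring

theorem eventually_limsup_gradNorm_le :
    ∀ᶠ C : ℝ≥0 in atTop, ∀ u : Solution P Ω,
      limsup (fun t => gradNorm P.β (u.ρt t + u.φ t) ^ P.β) atTop
        ≤ C * (1 + limsup (fun t => ‖deriv u.φ t‖ₑ ^ 2) atTop
          + limsup (fun t => ENNReal.ofReal (u.g t)) atTop ^ (2 / P.β)) := by
  obtain ⟨R, hgrad⟩ := exists_limsup_gradNorm_rpow_le (Ω := Ω) P one_pos
  obtain ⟨D, hforcing⟩ := exists_limsup_forcing_le hPS
  filter_upwards [eventually_one_add_mul_le R ((2 * P.energyConst).toNNReal * D)] with C hC u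
  refine (hgrad u).trans ?_
  rw [ENNReal.ofReal_one]
  refine hC _ _ (add_assoc (1 : ℝ≥0∞) _ _ ▸ le_self_add) ?_
  grw [u.limsup_energy_le, hforcing u, ← mul_assoc, ENNReal.coe_mul]
  rfl

theorem limsup_energy_eq_zero (u : Solution P Ω)
    (hf : limsup (fun t => ‖u.source t‖ₑ) atTop = 0) (hφ : limsup (fun t => ‖u.φ t‖ₑ) atTop = 0)
    (hφ' : limsup (fun t => ‖deriv u.φ t‖ₑ) atTop = 0) :
    limsup (fun t => ENNReal.ofReal (u.energy t)) atTop = 0 := by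
  have hforcing : limsup (fun t => ENNReal.ofReal (u.forcing t)) atTop = 0 := by
    refine nonpos_iff_eq_zero.1 (u.limsup_forcing_le.trans_eq ?_)
    rw [limsup_norm_sq_eq_zero hPS u (u.limsup_g_eq_zero hf hφ)]
    simp only [limsup_sq_ennreal, hf, hφ, hφ', zero_pow two_ne_zero, add_zero]
  refine nonpos_iff_eq_zero.1 (u.limsup_energy_le.trans_eq ?_)
  rw [hforcing, mul_zero]

theorem limsup_gradNorm_eq_zero (u : Solution P Ω)
    (hf : limsup (fun t => ‖u.source t‖ₑ) atTop = 0) (hφ : limsup (fun t => ‖u.φ t‖ₑ) atTop = 0)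
    (hφ' : limsup (fun t => ‖deriv u.φ t‖ₑ) atTop = 0) :
    limsup (fun t => gradNorm P.β (u.ρt t + u.φ t)) atTop = 0 := by
  have hpow : limsup (fun t => gradNorm P.β (u.ρt t + u.φ t) ^ P.β) atTop ≤ 0 := by
    refine ENNReal.le_of_forall_pos_le_add fun δ hδ _ => ?_
    obtain ⟨R, hgrad⟩ := exists_limsup_gradNorm_rpow_le (Ω := Ω) P (NNReal.coe_pos.2 hδ)
    simpa only [limsup_energy_eq_zero hPS u hf hφ hφ', mul_zero, add_zero, zero_add,
      ENNReal.ofReal_coe_nnreal] using hgrad u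
  rw [limsup_rpow_ennreal P.β_pos.le] at hpow
  exact (ENNReal.rpow_eq_zero_iff_of_pos P.β_pos).1 (nonpos_iff_eq_zero.1 hpow)

end Bounds

end Gradient

section Rate

theorem ofReal_exp_mul_lintegral_le {k r t : ℝ} {F h : ℝ → ℝ} (hk : 0 ≤ k) (hrt : r ≤ t)
    (hFh : ∀ s ∈ Ioo 0 r, F s ≤ h s) :
    ENNReal.ofReal (Real.exp (-k * (t - r))) * ∫⁻ s in Ioo 0 r, ENNReal.ofReal (F s)
      ≤ ENNReal.ofReal (Real.exp (k * r))
        * ∫⁻ s in Ioo 0 t, ENNReal.ofReal (Real.exp (-k * (t - s)) * h s) := by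
  rw [← lintegral_const_mul' _ _ ENNReal.ofReal_ne_top,
    ← lintegral_const_mul' _ _ ENNReal.ofReal_ne_top]
  refine (setLIntegral_mono' measurableSet_Ioo fun s hs => ?_).trans
    (lintegral_mono_set (Ioo_subset_Ioo_right hrt))
  have hexp : Real.exp (-k * (t - r)) ≤ Real.exp (k * r) * Real.exp (-k * (t - s)) := by
    rw [← Real.exp_add]
    exact Real.exp_le_exp.2 (by linarith [mul_nonneg hk hs.1.le])
  rw [ENNReal.ofReal_mul (Real.exp_nonneg (-k * (t - s))), ← mul_assoc,
    ← ENNReal.ofReal_mul (Real.exp_nonneg (k * r))]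
  exact mul_le_mul' (ENNReal.ofReal_le_ofReal hexp) (ENNReal.ofReal_le_ofReal (hFh s hs))

variable {d : ℕ} {Ω : Set (EuclideanSpace ℝ (Fin d))} {P : GenPoly}

theorem IsEnvelope.rpow_nonneg {u : Solution P Ω} {G : ℝ → ℝ} (hG : IsEnvelope (Ioi 0) u.g G)
    {t : ℝ} (ht : 0 < t) : 0 ≤ G t ^ (2 / P.β) :=
  Real.rpow_nonneg (hG.nonneg ht) _

theorem IsEnvelope.rpow_le_rpow {u : Solution P Ω} {G : ℝ → ℝ} (hG : IsEnvelope (Ioi 0) u.g G)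
    {s t : ℝ} (hs : 0 < s) (hst : s ≤ t) : G s ^ (2 / P.β) ≤ G t ^ (2 / P.β) :=
  Real.rpow_le_rpow (hG.nonneg hs) (hG.monotoneOn hs (hs.trans_le hst) hst)
    (zero_le_one.trans P.one_le_two_div_β)

namespace Solution

variable (u : Solution P Ω) {t σ : ℝ}

theorem deriv_rateSq_add_energy_le (ht : 0 < t) :
    deriv u.rateSq t + 8 * deriv u.energy t + 1 / 2 * (u.rateSq t + 8 * u.energy t)
      ≤ ‖deriv u.source t‖ ^ 2 + 9 * (P.energyConst * u.forcing t) := by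
  linarith [u.deriv_rateSq_le ht, u.deriv_energy_le ht, u.rateSq_nonneg t]

theorem mul_energyConst_mul_forcing_le (hσ : σ ≤ 1) :
    σ * (P.energyConst * u.forcing t) ≤ P.energyConst * u.forcing t :=
  mul_le_of_le_one_left (mul_nonneg P.energyConst_pos.le (u.forcing_nonneg t)) hσ

theorem deriv_mul_rateSq_add_energy_le (ht : 0 < t) (hσ₀ : 0 ≤ σ) (hσ₁ : σ ≤ 1) :
    u.rateSq t + σ * deriv u.rateSq t + 8 * deriv u.energy t
      ≤ σ * ‖deriv u.source t‖ ^ 2 + 9 * (P.energyConst * u.forcing t) := by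
  linarith [mul_le_mul_of_nonneg_left (u.deriv_rateSq_le ht) hσ₀, u.deriv_energy_le ht,
    mul_le_of_le_one_left (u.rateSq_nonneg t) hσ₁, u.mul_energyConst_mul_forcing_le (t := t) hσ₁,
    u.energy_nonneg t]

theorem deriv_mul_energy_add_massSq_le (ht : 0 < t) (hσ₀ : 0 ≤ σ) (hσ₁ : σ ≤ 1) :
    u.energy t + σ * deriv u.energy t + deriv u.massSq t + 1 / 4 * (σ * u.rateSq t)
      ≤ 2 * (P.energyConst * u.forcing t) := by
  have hmass : deriv u.massSq t + u.energy t ≤ P.energyConst * u.forcing t := by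
    refine (u.deriv_massSq_add_energy_le ht).trans
      (mul_le_mul_of_nonneg_left ?_ P.energyConst_pos.le)
    exact le_add_of_nonneg_right (sq_nonneg _)
  linarith [mul_le_mul_of_nonneg_left (u.deriv_energy_le ht) hσ₀,
    mul_nonneg hσ₀ (u.energy_nonneg t), u.mul_energyConst_mul_forcing_le (t := t) hσ₁]

theorem deriv_sq_mul_rateSq_add_le (ht : 0 < t) (hσ₀ : 0 ≤ σ) (hσ₁ : σ ≤ 1) :
    2 * σ * u.rateSq t + σ ^ 2 * deriv u.rateSq t
        + 12 * (u.energy t + σ * deriv u.energy t + deriv u.massSq t)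
      ≤ ‖deriv u.source t‖ ^ 2 + 25 * (P.energyConst * u.forcing t) := by
  have hsq : σ ^ 2 ≤ σ := pow_le_of_le_one hσ₀ hσ₁ two_ne_zero
  linarith [mul_le_mul_of_nonneg_left (u.deriv_rateSq_le ht) (sq_nonneg σ),
    mul_le_mul_of_nonneg_right hsq (u.rateSq_nonneg t),
    mul_le_of_le_one_left (sq_nonneg ‖deriv u.source t‖) (hsq.trans hσ₁),
    u.mul_energyConst_mul_forcing_le (t := t) (hsq.trans hσ₁),
    u.deriv_mul_energy_add_massSq_le ht hσ₀ hσ₁]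

theorem hasDerivAt_sub_mul_energy_add_massSq (s : ℝ) (ht : 0 < t) :
    HasDerivAt (fun τ => (τ - s) * u.energy τ + u.massSq τ)
      (u.energy t + (t - s) * deriv u.energy t + deriv u.massSq t) t := by
  simpa only [one_mul] using
    (((hasDerivAt_id' t).sub_const s).fun_mul (u.differentiableAt_energy ht).hasDerivAt).fun_add
      (u.differentiableAt_massSq ht).hasDerivAt

theorem continuousOn_sub_mul_energy_add_massSq (s : ℝ) :
    ContinuousOn (fun τ => (τ - s) * u.energy τ + u.massSq τ) (Ici 0) :=
  ((continuousOn_id.sub continuousOn_const).mul u.continuousOn_energy).add u.continuousOn_massSq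

theorem hasDerivAt_sub_mul_rateSq (s : ℝ) (ht : 0 < t) :
    HasDerivAt (fun τ => (τ - s) * u.rateSq τ) (u.rateSq t + (t - s) * deriv u.rateSq t) t := by
  simpa only [one_mul] using
    ((hasDerivAt_id' t).sub_const s).fun_mul (u.differentiableAt_rateSq ht).hasDerivAt

theorem hasDerivAt_sub_sq_mul_rateSq (s : ℝ) (ht : 0 < t) :
    HasDerivAt (fun τ => (τ - s) ^ 2 * u.rateSq τ)
      (2 * (t - s) * u.rateSq t + (t - s) ^ 2 * deriv u.rateSq t) t := by
  simpa only [Nat.cast_ofNat, Nat.add_one_sub_one, pow_one, mul_one] using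
    (((hasDerivAt_id' t).sub_const s).fun_pow 2).fun_mul (u.differentiableAt_rateSq ht).hasDerivAt

end Solution

section Bounds

variable [IsFiniteMeasure (volume.restrict Ω)] (hPS : PoincareSobolev P.β Ω)
include hPS

theorem exists_mul_norm_sq_add_mul_forcing_le {k : ℝ} (hk : 0 ≤ k) :
    ∃ K, 0 < K ∧ ∀ (u : Solution P Ω) (G : ℝ → ℝ), IsEnvelope (Ioi 0) u.g G →
      ∀ t r, 0 < t → 0 ≤ r →
        r * ‖deriv u.source t‖ ^ 2 + k * (P.energyConst * u.forcing t)
          ≤ K * (1 + ‖toL2 (u.ρ₀ - u.φ 0)‖ ^ 2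
            + (‖deriv u.φ t‖ ^ 2 + G t ^ (2 / P.β) + r * ‖deriv u.source t‖ ^ 2)) := by
  obtain ⟨D, hD, hforcing⟩ := exists_forcing_le hPS
  have hκ := P.energyConst_pos
  refine ⟨k * (P.energyConst * D) + 1, by positivity, fun u G hG t r ht hr => ?_⟩
  have hGpow := hG.rpow_nonneg ht
  set A := 1 + ‖toL2 (u.ρ₀ - u.φ 0)‖ ^ 2 + (‖deriv u.φ t‖ ^ 2 + G t ^ (2 / P.β)) with hA
  have hA₀ : 0 ≤ A := by positivity
  calc r * ‖deriv u.source t‖ ^ 2 + k * (P.energyConst * u.forcing t)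
      ≤ r * ‖deriv u.source t‖ ^ 2 + k * (P.energyConst * (D * A)) := by
        gcongr
        exact hforcing u G hG t ht
    _ ≤ (k * (P.energyConst * D) + 1) * (A + r * ‖deriv u.source t‖ ^ 2) := by
        have : 0 ≤ k * (P.energyConst * D) * (r * ‖deriv u.source t‖ ^ 2) := by positivity
        linarith
    _ = _ := by rw [hA, add_assoc]

theorem exists_sub_mul_rateSq_le :
    ∃ K, 0 < K ∧ ∀ (u : Solution P Ω) (G : ℝ → ℝ), IsEnvelope (Ioi 0) u.g G →
      ∀ s t, 0 < s → s ≤ t → t ≤ 1 →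
        ENNReal.ofReal ((t - s) * u.rateSq t + 8 * u.energy t)
          ≤ ENNReal.ofReal (8 * u.energy s + K * (1 + ‖toL2 (u.ρ₀ - u.φ 0)‖ ^ 2))
            + ENNReal.ofReal K * ∫⁻ τ in Ioo 0 t, ENNReal.ofReal
              (‖deriv u.φ τ‖ ^ 2 + G τ ^ (2 / P.β) + t * ‖deriv u.source τ‖ ^ 2) := by
  obtain ⟨K, hK, hforcing⟩ := exists_mul_norm_sq_add_mul_forcing_le hPS (k := 9) (by norm_num)
  refine ⟨K, hK, fun u G hG s t hs hst ht => ?_⟩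
  have hpos : Icc s t ⊆ Ioi 0 := fun τ hτ => hs.trans_le hτ.1
  have hgrowth := ofReal_le_add_lintegral_const_add
    (y := fun τ => (τ - s) * u.rateSq τ + 8 * u.energy τ)
    (h := fun τ => ‖deriv u.φ τ‖ ^ 2 + G τ ^ (2 / P.β) + t * ‖deriv u.source τ‖ ^ 2)
    (c := 1 + ‖toL2 (u.ρ₀ - u.φ 0)‖ ^ 2) hst (by linarith) hK.le (by positivity)
    (by simpa only [sub_self, zero_mul, zero_add] using
      mul_nonneg (by norm_num) (u.energy_nonneg s))
    (((continuousOn_id.sub continuousOn_const).mul (u.continuousOn_rateSq.mono hpos)).add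
      (continuousOn_const.mul (u.continuousOn_energy.mono (hpos.trans Ioi_subset_Ici_self))))
    (fun τ hτ => (u.hasDerivAt_sub_mul_rateSq s (hs.trans hτ.1)).add
      ((u.differentiableAt_energy (hs.trans hτ.1)).hasDerivAt.const_mul 8))
    (((u.continuousOn_norm_deriv_φ_sq.add hG.continuousOn_rpow).add
      (continuousOn_const.mul u.continuousOn_norm_deriv_source_sq)).mono
        (Ioo_subset_Icc_self.trans hpos))
    fun τ hτ => by
      have hτ₀ := hs.trans hτ.1
      have hsource : (τ - s) * ‖deriv u.source τ‖ ^ 2 ≤ t * ‖deriv u.source τ‖ ^ 2 := by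
        gcongr
        linarith [hτ.2]
      linarith [hforcing u G hG τ t hτ₀ (hτ₀.trans hτ.2).le,
        u.deriv_mul_rateSq_add_energy_le hτ₀ (sub_nonneg.2 hτ.1.le) (by linarith [hτ.2])]
  simp only [sub_self, zero_mul, zero_add] at hgrowth
  grw [hgrowth, Ioo_subset_Ioo_left hs.le]

theorem exists_mul_rateSq_add_energy_le :
    ∃ K : ℝ≥0, ∀ (u : Solution P Ω) (G : ℝ → ℝ), IsEnvelope (Ioi 0) u.g G →
      ∀ t, 0 < t → t ≤ 1 →
        ENNReal.ofReal (t * u.rateSq t + 8 * u.energy t)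
          ≤ K * (ENNReal.ofReal (1 + ‖u.ρ₀‖ ^ 2 + ‖toL2 (u.φ 0)‖ ^ 2)
            + ∫⁻ s in Ioo 0 t, ENNReal.ofReal
              (‖deriv u.φ s‖ ^ 2 + G s ^ (2 / P.β) + t * ‖deriv u.source s‖ ^ 2)) := by
  obtain ⟨K, hK, hsub⟩ := exists_sub_mul_rateSq_le hPS
  have hcoeff := inv_pos.2 P.coeff_zero_pos
  refine ⟨(8 * (P.coeff 0)⁻¹ + 2 * K).toNNReal, fun u G hG t ht ht₁ => ?_⟩
  have hleft : Tendsto (fun s => (t - s) * u.rateSq t + 8 * u.energy t) (𝓝[>] 0)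
      (𝓝 ((t - 0) * u.rateSq t + 8 * u.energy t)) :=
    tendsto_nhdsWithin_of_tendsto_nhds (Continuous.tendsto (by fun_prop) 0)
  have hright : Tendsto (fun s => 8 * u.energy s + K * (1 + ‖toL2 (u.ρ₀ - u.φ 0)‖ ^ 2)) (𝓝[>] 0)
      (𝓝 (8 * u.energy 0 + K * (1 + ‖toL2 (u.ρ₀ - u.φ 0)‖ ^ 2))) :=
    (((u.continuousOn_energy 0 self_mem_Ici).mono_left
      (nhdsWithin_mono 0 Ioi_subset_Ici_self)).const_mul 8).add_const _
  have hlimit := le_of_tendsto_of_tendsto (ENNReal.tendsto_ofReal hleft)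
    ((ENNReal.tendsto_ofReal hright).add_const _)
    (by filter_upwards [Ioo_mem_nhdsGT ht] with s hs using hsub u G hG s t hs.1 hs.2.le ht₁)
  rw [sub_zero] at hlimit
  refine hlimit.trans (ofReal_add_mul_le (by positivity) ?_ (by linarith) _)
  have hinit := mul_le_mul_of_nonneg_left (norm_toL2_sub_sq_le u.ρ₀ (u.φ 0)) hK.le
  have hφ := mul_nonneg hcoeff.le (sq_nonneg ‖toL2 (u.φ 0)‖)
  linarith [u.energy_zero_le]

theorem exists_rateSq_add_energy_le_initial :
    ∃ K : ℝ≥0, ∀ (u : Solution P Ω) (G : ℝ → ℝ), IsEnvelope (Ioi 0) u.g G →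
      ∀ t, 0 < t → t ≤ 1 →
        ENNReal.ofReal (u.rateSq t + 8 * u.energy t)
          ≤ K * (ENNReal.ofReal t⁻¹ * (ENNReal.ofReal (1 + ‖u.ρ₀‖ ^ 2 + ‖toL2 (u.φ 0)‖ ^ 2)
              + ∫⁻ s in Ioo 0 t, ENNReal.ofReal (‖deriv u.φ s‖ ^ 2 + G s ^ (2 / P.β)))
            + ∫⁻ s in Ioo 0 t, ENNReal.ofReal (‖deriv u.source s‖ ^ 2)) := by
  obtain ⟨K, hmul⟩ := exists_mul_rateSq_add_energy_le hPS
  refine ⟨K, fun u G hG t ht ht₁ => ?_⟩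
  have hmeas : AEMeasurable
      (fun s => ENNReal.ofReal (‖deriv u.φ s‖ ^ 2 + G s ^ (2 / P.β))) (volume.restrict (Ioo 0 t)) :=
    (((u.continuousOn_norm_deriv_φ_sq.add hG.continuousOn_rpow).mono
      fun s hs => hs.1).aemeasurable measurableSet_Ioo).ennreal_ofReal
  have hinv : ENNReal.ofReal t⁻¹ * ENNReal.ofReal t = 1 := by
    rw [← ENNReal.ofReal_mul (by positivity), inv_mul_cancel₀ ht.ne', ENNReal.ofReal_one]
  set A := ENNReal.ofReal (1 + ‖u.ρ₀‖ ^ 2 + ‖toL2 (u.φ 0)‖ ^ 2)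
  set I := ∫⁻ s in Ioo 0 t, ENNReal.ofReal (‖deriv u.φ s‖ ^ 2 + G s ^ (2 / P.β))
  set J := ∫⁻ s in Ioo 0 t, ENNReal.ofReal (‖deriv u.source s‖ ^ 2)
  have hsplit : ∫⁻ s in Ioo 0 t, ENNReal.ofReal
      (‖deriv u.φ s‖ ^ 2 + G s ^ (2 / P.β) + t * ‖deriv u.source s‖ ^ 2)
        ≤ I + ENNReal.ofReal t * J := by
    rw [← lintegral_const_mul' _ _ ENNReal.ofReal_ne_top, ← lintegral_add_left' hmeas]
    refine lintegral_mono fun s => ?_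
    grw [ENNReal.ofReal_add_le, ENNReal.ofReal_mul ht.le]
  calc ENNReal.ofReal (u.rateSq t + 8 * u.energy t)
      ≤ ENNReal.ofReal (t⁻¹ * (t * u.rateSq t + 8 * u.energy t)) := by
        rw [mul_add, inv_mul_cancel_left₀ ht.ne']
        refine ENNReal.ofReal_le_ofReal (add_le_add_right (le_mul_of_one_le_left ?_ ?_) _)
        exacts [mul_nonneg (by norm_num) (u.energy_nonneg t), (one_le_inv₀ ht).2 ht₁]
    _ ≤ ENNReal.ofReal t⁻¹ * (K * (A + (I + ENNReal.ofReal t * J))) := by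
        rw [ENNReal.ofReal_mul (inv_nonneg.2 ht.le)]
        grw [hmul u G hG t ht ht₁, hsplit]
    _ = K * (ENNReal.ofReal t⁻¹ * (A + I) + ENNReal.ofReal t⁻¹ * ENNReal.ofReal t * J) := by ring
    _ = _ := by rw [hinv, one_mul]

theorem exists_rateSq_add_energy_gronwall :
    ∃ M : ℝ≥0, ∀ (u : Solution P Ω) (G : ℝ → ℝ), IsEnvelope (Ioi 0) u.g G →
      ∀ t₀ t, 0 < t₀ → t₀ ≤ t →
        ENNReal.ofReal (u.rateSq t + 8 * u.energy t)
          ≤ ENNReal.ofReal (Real.exp (-(1 / 4) * (t - t₀)))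
              * ENNReal.ofReal (u.rateSq t₀ + 8 * u.energy t₀)
            + M * ∫⁻ s in Ioo 0 t, ENNReal.ofReal (Real.exp (-(1 / 4) * (t - s))
              * (1 + ‖toL2 (u.ρ₀ - u.φ 0)‖ ^ 2 + ‖deriv u.φ s‖ ^ 2 + ‖deriv u.source s‖ ^ 2
                + G s ^ (2 / P.β))) := by
  obtain ⟨M, hM, hforcing⟩ := exists_mul_norm_sq_add_mul_forcing_le hPS (k := 9) (by norm_num)
  refine ⟨M.toNNReal, fun u G hG t₀ t ht₀ ht => ?_⟩
  set h : ℝ → ℝ := fun s => 1 + ‖toL2 (u.ρ₀ - u.φ 0)‖ ^ 2 + ‖deriv u.φ s‖ ^ 2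
    + ‖deriv u.source s‖ ^ 2 + G s ^ (2 / P.β)
  have hpos : Icc t₀ t ⊆ Ioi 0 := fun τ hτ => ht₀.trans_le hτ.1
  have hgronwall := gronwall_lintegral (y := fun τ => u.rateSq τ + 8 * u.energy τ)
    (h := fun τ => M * h τ) (k := 1 / 4) ht
    ((u.continuousOn_rateSq.mono hpos).add
      (continuousOn_const.mul (u.continuousOn_energy.mono (hpos.trans Ioi_subset_Ici_self))))
    (fun τ hτ => (u.differentiableAt_rateSq (ht₀.trans hτ.1)).hasDerivAt.add
      ((u.differentiableAt_energy (ht₀.trans hτ.1)).hasDerivAt.const_mul 8))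
    (continuousOn_const.mul ((((continuousOn_const.add u.continuousOn_norm_deriv_φ_sq).add
      u.continuousOn_norm_deriv_source_sq).add hG.continuousOn_rpow).mono
        (Ioo_subset_Icc_self.trans hpos)))
    fun τ hτ => by
      have hτ₀ := ht₀.trans hτ.1
      simp only [h]
      linarith [u.deriv_rateSq_add_energy_le hτ₀, hforcing u G hG τ 1 hτ₀ zero_le_one,
        u.rateSq_nonneg τ, u.energy_nonneg τ]
  rw [ENNReal.ofReal_mul (Real.exp_pos _).le] at hgronwall
  simp only [mul_left_comm _ M, ENNReal.ofReal_mul hM.le] at hgronwall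
  grw [hgronwall, Ioo_subset_Ioo_left ht₀.le, lintegral_const_mul' _ _ ENNReal.ofReal_ne_top]
  rfl

theorem eventually_rateSq_le_boundB :
    ∀ᶠ C : ℝ≥0 in atTop, ∀ (u : Solution P Ω) (t₀ : ℝ), 0 < t₀ → t₀ < 1 →
      ∀ G : ℝ → ℝ, IsEnvelope (Ioi 0) u.g G → ∀ t, t₀ ≤ t →
        ‖toL2 (deriv u.ρt t)‖ₑ ^ 2 ≤ C * boundB P u.φ u.f u.ρ₀ G t₀ t := by
  obtain ⟨K, hinitial⟩ := exists_rateSq_add_energy_le_initial hPS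
  obtain ⟨M, hgronwall⟩ := exists_rateSq_add_energy_gronwall hPS
  filter_upwards [eventually_ge_atTop (K + (K * (Real.exp (1 / 4)).toNNReal + M))]
    with C hC u t₀ ht₀ ht₁ G hG t ht
  have hweight := ofReal_exp_mul_lintegral_le (k := 1 / 4) (F := fun s => ‖deriv u.source s‖ ^ 2)
    (h := fun s => 1 + ‖toL2 (u.ρ₀ - u.φ 0)‖ ^ 2 + ‖deriv u.φ s‖ ^ 2 + ‖deriv u.source s‖ ^ 2
      + G s ^ (2 / P.β)) (by norm_num) ht fun s hs => by
    have hGpow := hG.rpow_nonneg hs.1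
    have : 0 ≤ 1 + ‖toL2 (u.ρ₀ - u.φ 0)‖ ^ 2 + ‖deriv u.φ s‖ ^ 2 := by positivity
    linarith
  have hexp : ENNReal.ofReal (Real.exp (1 / 4 * t₀)) ≤ (Real.exp (1 / 4)).toNNReal := by
    refine ENNReal.ofReal_le_ofReal (Real.exp_le_exp.2 ?_)
    linarith
  rw [boundB, ENNReal.ofReal_mul (inv_nonneg.2 ht₀.le)]
  set e := ENNReal.ofReal (Real.exp (-(1 / 4) * (t - t₀)))
  set A := ENNReal.ofReal (1 + ‖u.ρ₀‖ ^ 2 + ‖toL2 (u.φ 0)‖ ^ 2)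
    + ∫⁻ s in Ioo 0 t₀, ENNReal.ofReal (‖deriv u.φ s‖ ^ 2 + G s ^ (2 / P.β))
  set J := ∫⁻ s in Ioo 0 t₀, ENNReal.ofReal (‖deriv u.source s‖ ^ 2)
  set I := ∫⁻ s in Ioo 0 t, ENNReal.ofReal (Real.exp (-(1 / 4) * (t - s)) *
    (1 + ‖toL2 (u.ρ₀ - u.φ 0)‖ ^ 2 + ‖deriv u.φ s‖ ^ 2 + ‖deriv u.source s‖ ^ 2
      + G s ^ (2 / P.β)))
  calc ‖toL2 (deriv u.ρt t)‖ₑ ^ 2 ≤ ENNReal.ofReal (u.rateSq t + 8 * u.energy t) := by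
        rw [enorm_sq]
        gcongr
        exact le_add_of_nonneg_right (mul_nonneg (by norm_num) (u.energy_nonneg t))
    _ ≤ e * (K * (ENNReal.ofReal t₀⁻¹ * A + J)) + M * I := by
        grw [hgronwall u G hG t₀ t ht₀ ht, hinitial u G hG t₀ ht₀ ht₁.le]
    _ = K * (ENNReal.ofReal t₀⁻¹ * e * A) + (K * (e * J) + M * I) := by ring
    _ ≤ K * (ENNReal.ofReal t₀⁻¹ * e * A)
        + (K * ((Real.exp (1 / 4)).toNNReal * I) + M * I) := by grw [hweight, hexp]
    _ = K * (ENNReal.ofReal t₀⁻¹ * e * A)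
        + ((K * (Real.exp (1 / 4)).toNNReal + M : ℝ≥0) : ℝ≥0∞) * I := by
        push_cast
        ring
    _ ≤ C * (ENNReal.ofReal t₀⁻¹ * e * A) + C * I := by
        gcongr
        exacts [le_self_add.trans hC, le_add_self.trans hC]
    _ = _ := by ring

theorem eventually_limsup_rateSq_le :
    ∀ᶠ C : ℝ≥0 in atTop, ∀ u : Solution P Ω,
      limsup (fun t => ‖toL2 (deriv u.ρt t)‖ₑ ^ 2) atTop
        ≤ C * (1 + limsup (fun t => ENNReal.ofReal (u.g t)) atTop ^ (2 / P.β)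
          + limsup (fun t => ‖deriv u.φ t‖ₑ ^ 2) atTop
          + limsup (fun t => ‖deriv u.source t‖ₑ ^ 2) atTop) := by
  obtain ⟨D, hforcing⟩ := exists_limsup_forcing_le hPS
  have hκ := P.energyConst_pos
  filter_upwards [eventually_ge_atTop (2 + (18 * P.energyConst).toNNReal * D)] with C hC u
  set N := limsup (fun t => ‖deriv u.φ t‖ₑ ^ 2) atTop
  set L := limsup (fun t => ENNReal.ofReal (u.g t)) atTop ^ (2 / P.β)
  set Q := limsup (fun t => ‖deriv u.source t‖ₑ ^ 2) atTop
  have hdecay := limsup_le_of_deriv_add_le (y := fun τ => u.rateSq τ + 8 * u.energy τ)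
    (h := fun t => 2 * ‖deriv u.source t‖ ^ 2 + 18 * P.energyConst * u.forcing t) one_half_pos
    ((eventually_gt_atTop 0).mono fun t ht => (u.differentiableAt_rateSq ht).hasDerivAt.add
      ((u.differentiableAt_energy ht).hasDerivAt.const_mul 8))
    ((eventually_gt_atTop 0).mono fun t ht => by linarith [u.deriv_rateSq_add_energy_le ht])
  calc limsup (fun t => ‖toL2 (deriv u.ρt t)‖ₑ ^ 2) atTop
      ≤ limsup (fun t => ENNReal.ofReal (u.rateSq t + 8 * u.energy t)) atTop := by
        refine limsup_le_limsup (.of_forall fun t => ?_)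
        simp only [enorm_sq]
        gcongr
        exact le_add_of_nonneg_right (mul_nonneg (by norm_num) (u.energy_nonneg t))
    _ ≤ limsup (fun t => 2 * ‖deriv u.source t‖ₑ ^ 2
          + ENNReal.ofReal (18 * P.energyConst) * ENNReal.ofReal (u.forcing t)) atTop := by
        refine hdecay.trans (limsup_le_limsup (.of_forall fun t => ?_))
        beta_reduce
        grw [ENNReal.ofReal_add_le, ENNReal.ofReal_mul (by positivity : 0 ≤ 18 * P.energyConst),
          ENNReal.ofReal_mul zero_le_two, enorm_sq, ENNReal.ofReal_ofNat]
    _ ≤ 2 * Q + ENNReal.ofReal (18 * P.energyConst) * (D * (1 + N + L)) := by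
        grw [limsup_add_le_ennreal, ENNReal.limsup_const_mul_of_ne_top ENNReal.ofNat_ne_top,
          ENNReal.limsup_const_mul_of_ne_top ENNReal.ofReal_ne_top, hforcing u]
    _ ≤ 2 * (1 + L + N + Q) + ENNReal.ofReal (18 * P.energyConst) * (D * (1 + L + N + Q)) := by
        have hQ : Q ≤ 1 + L + N + Q := le_add_self
        have hNL : 1 + N + L ≤ 1 + L + N + Q := (add_right_comm 1 N L).trans_le le_self_add
        gcongr
    _ = ((2 + (18 * P.energyConst).toNNReal * D : ℝ≥0) : ℝ≥0∞) * (1 + L + N + Q) := by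
        push_cast
        rw [ENNReal.ofReal]
        ring
    _ ≤ C * (1 + L + N + Q) := by gcongr

end Bounds

end Rate

theorem ofReal_le_mul_ofReal_add_lintegral {y y' h : ℝ → ℝ} {r s t c K M : ℝ} (hrs : r ≤ s)
    (hst : s ≤ t) (hst₁ : t - s ≤ 1) (hK : 0 ≤ K) (hM : 0 ≤ M) (hc : 0 ≤ c) (hys : 0 ≤ y s)
    (hysM : y s ≤ M * c) (hy : ContinuousOn y (Icc s t))
    (hderiv : ∀ τ ∈ Ioo s t, HasDerivAt y (y' τ) τ) (hh : ContinuousOn h (Ioo s t))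
    (hle : ∀ τ ∈ Ioo s t, y' τ ≤ K * (c + h τ)) :
    ENNReal.ofReal (y t)
      ≤ (M + K).toNNReal * (ENNReal.ofReal c + ∫⁻ τ in Ioo r t, ENNReal.ofReal (h τ)) := by
  grw [ofReal_le_add_lintegral_const_add hst hst₁ hK hc hys hy hderiv hh hle, ← hrs]
  exact ofReal_add_mul_le (add_nonneg hM hK) (by linarith) (le_add_of_nonneg_left hM) _

section UnitTime

variable {d : ℕ} {Ω : Set (EuclideanSpace ℝ (Fin d))} {P : GenPoly}
  [IsFiniteMeasure (volume.restrict Ω)] (hPS : PoincareSobolev P.β Ω)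
include hPS

theorem exists_massSq_le_add :
    ∃ D, 0 < D ∧ ∀ (u : Solution P Ω) (G : ℝ → ℝ), IsEnvelope (Ioi 0) u.g G →
      ∀ s t, 0 < s → s ≤ t →
        u.massSq s ≤ D * (1 + ‖toL2 (u.ρ₀ - u.φ 0)‖ ^ 2 + G t ^ (2 / P.β)) := by
  obtain ⟨D, hD, hmass⟩ := exists_massSq_le hPS
  refine ⟨D + 1, by positivity, fun u G hG s t hs hst => ?_⟩
  have hGpow := hG.rpow_nonneg (hs.trans_le hst)
  have hinit := mul_nonneg hD.le (sq_nonneg ‖toL2 (u.ρ₀ - u.φ 0)‖)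
  linarith [hmass u G hG s hs, mul_le_mul_of_nonneg_left (hG.rpow_le_rpow hs hst) hD.le]

theorem exists_energy_le_of_one_le :
    ∃ C : ℝ≥0, ∀ (u : Solution P Ω) (G : ℝ → ℝ), IsEnvelope (Ioi 0) u.g G → ∀ t, 1 ≤ t →
      ENNReal.ofReal (u.energy t)
        ≤ C * (ENNReal.ofReal (1 + ‖toL2 (u.ρ₀ - u.φ 0)‖ ^ 2 + G t ^ (2 / P.β))
          + ∫⁻ s in Ioo (t - 1) t, ‖deriv u.φ s‖ₑ ^ 2) := by
  obtain ⟨K, hK, hforcing⟩ := exists_mul_norm_sq_add_mul_forcing_le hPS (k := 4) (by norm_num)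
  obtain ⟨M, hM, hmass⟩ := exists_massSq_le_add hPS
  refine ⟨(2 * M + K).toNNReal, fun u G hG t ht => ?_⟩
  set s := t - 1 / 2 with hs
  have hs₀ : 0 < s := by linarith
  have hst : s ≤ t := by linarith
  have hpos : Icc s t ⊆ Ioi 0 := fun τ hτ => hs₀.trans_le hτ.1
  have hGpow := hG.rpow_nonneg (hs₀.trans_le hst)
  set y : ℝ → ℝ := fun τ => 2 * ((τ - s) * u.energy τ + u.massSq τ)
  have hys : y s = 2 * u.massSq s := by simp only [y, sub_self, zero_mul, zero_add]
  have hyt : u.energy t ≤ y t := by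
    simp only [y, hs, sub_sub_cancel]
    linarith [u.massSq_nonneg t]
  grw [hyt]
  simp only [enorm_sq]
  refine ofReal_le_mul_ofReal_add_lintegral (by linarith) hst (by linarith) hK.le
    (by positivity) (by positivity) ?_ ?_ ?_
    (fun τ hτ => (u.hasDerivAt_sub_mul_energy_add_massSq s (hs₀.trans hτ.1)).const_mul 2)
    (u.continuousOn_norm_deriv_φ_sq.mono (Ioo_subset_Icc_self.trans hpos)) fun τ hτ => ?_
  · linarith [hys, u.massSq_nonneg s]
  · linarith [hys, hmass u G hG s t hs₀ hst]
  · exact continuousOn_const.mul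
      ((u.continuousOn_sub_mul_energy_add_massSq s).mono (hpos.trans Ioi_subset_Ici_self))
  · have hτ₀ := hs₀.trans hτ.1
    have hσ : 0 ≤ τ - s := sub_nonneg.2 hτ.1.le
    linarith [u.deriv_mul_energy_add_massSq_le hτ₀ hσ (by linarith [hτ.2]),
      mul_nonneg hσ (u.rateSq_nonneg τ), hforcing u G hG τ 0 hτ₀ le_rfl,
      mul_le_mul_of_nonneg_left (hG.rpow_le_rpow hτ₀ hτ.2.le) hK.le]

theorem eventually_gradNorm_le_of_one_le :
    ∀ᶠ C : ℝ≥0 in atTop, ∀ (u : Solution P Ω) (G : ℝ → ℝ), IsEnvelope (Ioi 0) u.g G →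
      ∀ t, 1 ≤ t →
        gradNorm P.β (u.ρt t + u.φ t) ^ P.β
          ≤ C * (ENNReal.ofReal (1 + ‖toL2 (u.ρ₀ - u.φ 0)‖ ^ 2 + G t ^ (2 / P.β))
            + ∫⁻ s in Ioo (t - 1) t, ‖deriv u.φ s‖ₑ ^ 2) := by
  obtain ⟨R, hgrad⟩ := exists_gradNorm_rpow_le (Ω := Ω) P one_pos
  obtain ⟨D, henergy⟩ := exists_energy_le_of_one_le hPS
  filter_upwards [eventually_one_add_mul_le R D] with C hC u G hG t ht
  have hGpow := hG.rpow_nonneg (zero_lt_one.trans_le ht)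
  have hone : (1 : ℝ) ≤ 1 + ‖toL2 (u.ρ₀ - u.φ 0)‖ ^ 2 + G t ^ (2 / P.β) := by
    rw [add_assoc]
    exact le_add_of_nonneg_right (by positivity)
  grw [hgrad, ENNReal.ofReal_one,
    hC _ _ (le_add_right (ENNReal.one_le_ofReal.2 hone)) (henergy u G hG t ht)]

theorem eventually_rateSq_le_of_one_le :
    ∀ᶠ C : ℝ≥0 in atTop, ∀ (u : Solution P Ω) (G : ℝ → ℝ), IsEnvelope (Ioi 0) u.g G →
      ∀ t, 1 ≤ t →
        ‖toL2 (deriv u.ρt t)‖ₑ ^ 2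
          ≤ C * (ENNReal.ofReal (1 + ‖toL2 (u.ρ₀ - u.φ 0)‖ ^ 2 + G t ^ (2 / P.β))
            + ∫⁻ s in Ioo (t - 1) t, (‖deriv u.φ s‖ₑ ^ 2 + ‖deriv u.source s‖ₑ ^ 2)) := by
  obtain ⟨K, hK, hforcing⟩ := exists_mul_norm_sq_add_mul_forcing_le hPS (k := 25) (by norm_num)
  obtain ⟨M, hM, hmass⟩ := exists_massSq_le_add hPS
  filter_upwards [eventually_ge_atTop (48 * M + 4 * K).toNNReal] with C hC u G hG t ht
  set s := t - 1 / 2 with hs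
  have hs₀ : 0 < s := by linarith
  have hst : s ≤ t := by linarith
  have hpos : Icc s t ⊆ Ioi 0 := fun τ hτ => hs₀.trans_le hτ.1
  have hGpow := hG.rpow_nonneg (hs₀.trans_le hst)
  set y : ℝ → ℝ :=
    fun τ => 4 * ((τ - s) ^ 2 * u.rateSq τ + 12 * ((τ - s) * u.energy τ + u.massSq τ)) with hy
  have hys : y s = 48 * u.massSq s := by
    rw [hy]
    ring
  have hyt : ‖toL2 (deriv u.ρt t)‖ ^ 2 ≤ y t := by
    simp only [y, hs, sub_sub_cancel]
    change u.rateSq t ≤ _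
    linarith [u.massSq_nonneg t, u.energy_nonneg t]
  simp only [enorm_sq]
  simp only [← ENNReal.ofReal_add (sq_nonneg _) (sq_nonneg _)]
  grw [hyt, ← hC]
  refine ofReal_le_mul_ofReal_add_lintegral (by linarith) hst (by linarith) (by positivity)
    (by positivity) (by positivity) ?_ ?_ ?_
    (fun τ hτ => ((u.hasDerivAt_sub_sq_mul_rateSq s (hs₀.trans hτ.1)).add
      ((u.hasDerivAt_sub_mul_energy_add_massSq s (hs₀.trans hτ.1)).const_mul 12)).const_mul 4)
    ((u.continuousOn_norm_deriv_φ_sq.add u.continuousOn_norm_deriv_source_sq).mono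
      (Ioo_subset_Icc_self.trans hpos)) fun τ hτ => ?_
  · linarith [hys, u.massSq_nonneg s]
  · linarith [hys, hmass u G hG s t hs₀ hst]
  · exact continuousOn_const.mul ((((continuousOn_id.sub continuousOn_const).pow 2).mul
      (u.continuousOn_rateSq.mono hpos)).add
        (continuousOn_const.mul
          ((u.continuousOn_sub_mul_energy_add_massSq s).mono (hpos.trans Ioi_subset_Ici_self))))
  · have hτ₀ := hs₀.trans hτ.1
    linarith [u.deriv_sq_mul_rateSq_add_le hτ₀ (sub_nonneg.2 hτ.1.le) (by linarith [hτ.2]),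
      hforcing u G hG τ 1 hτ₀ zero_le_one,
      mul_le_mul_of_nonneg_left (hG.rpow_le_rpow hτ₀ hτ.2.le) hK.le]

end UnitTime

end Forchheimer

end

theorem theorem4p6_general (d : ℕ) (hd : 2 ≤ d) (Ω : Set (EuclideanSpace ℝ (Fin d)))
    (hΩ_open : IsOpen Ω) (hΩ_fin : volume Ω ≠ ∞)
    (P : Forchheimer.GenPoly) (hdeg : P.a ≤ 4 / ((d : ℝ) + 2)) :
    ∃ C : ℝ≥0, 0 < C ∧
      ∀ (φ : ℝ → Forchheimer.H1 Ω) (f : ℝ → Forchheimer.L2 Ω) (ρ₀ : Forchheimer.H1 Ω)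
        (ρt : ℝ → Forchheimer.H1 Ω),
        Forchheimer.IsRegularData φ f → Forchheimer.IsWeakSolution P φ f ρ₀ ρt →
        (∀ G : ℝ → ℝ, Forchheimer.IsEnvelope (Ioi 0) (Forchheimer.gFun P φ f) G →
          ∀ t : ℝ, 0 < t →
            ‖Forchheimer.toL2 (ρt t)‖
              ≤ C * (1 + ‖Forchheimer.toL2 ρ₀‖ + G t ^ (1 / P.β))) ∧
        limsup (fun t => ‖Forchheimer.toL2 (ρt t)‖ₑ ^ 2) atTop
          ≤ C * (1 + limsup (fun t => ENNReal.ofReal (Forchheimer.gFun P φ f t)) atTop)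
              ^ (2 / P.β) ∧
        (limsup (fun t => ‖Forchheimer.fTilde φ f t‖ₑ) atTop = 0 →
          limsup (fun t => ‖φ t‖ₑ) atTop = 0 →
          limsup (fun t => ‖Forchheimer.toL2 (ρt t)‖ₑ ^ 2) atTop = 0) ∧
        (∀ G : ℝ → ℝ, Forchheimer.IsEnvelope (Ioi 0) (Forchheimer.gFun P φ f) G →
          ∀ t : ℝ, 0 < t →
            Forchheimer.gradNorm P.β (ρt t + φ t) ^ P.β
              ≤ C * Forchheimer.boundA P φ ρ₀ G t) ∧
        limsup (fun t => Forchheimer.gradNorm P.β (ρt t + φ t) ^ P.β) atTop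
          ≤ C * (1 + limsup (fun t => ‖deriv φ t‖ₑ ^ 2) atTop
              + (limsup (fun t => ENNReal.ofReal (Forchheimer.gFun P φ f t)) atTop)
                  ^ (2 / P.β)) ∧
        (limsup (fun t => ‖Forchheimer.fTilde φ f t‖ₑ) atTop = 0 →
          limsup (fun t => ‖φ t‖ₑ) atTop = 0 →
          limsup (fun t => ‖deriv φ t‖ₑ) atTop = 0 →
          limsup (fun t => Forchheimer.gradNorm P.β (ρt t + φ t)) atTop = 0) ∧
        (∀ t₀ : ℝ, 0 < t₀ → t₀ < 1 →
          ∀ G : ℝ → ℝ, Forchheimer.IsEnvelope (Ioi 0) (Forchheimer.gFun P φ f) G →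
          ∀ t : ℝ, t₀ ≤ t →
            ‖Forchheimer.toL2 (deriv ρt t)‖ₑ ^ 2
              ≤ C * Forchheimer.boundB P φ f ρ₀ G t₀ t) ∧
        limsup (fun t => ‖Forchheimer.toL2 (deriv ρt t)‖ₑ ^ 2) atTop
          ≤ C * (1 + (limsup (fun t => ENNReal.ofReal (Forchheimer.gFun P φ f t)) atTop)
                  ^ (2 / P.β)
              + limsup (fun t => ‖deriv φ t‖ₑ ^ 2) atTop
              + limsup (fun t => ‖deriv (Forchheimer.fTilde φ f) t‖ₑ ^ 2) atTop) ∧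
        (∀ G : ℝ → ℝ, Forchheimer.IsEnvelope (Ioi 0) (Forchheimer.gFun P φ f) G →
          ∀ t : ℝ, 1 ≤ t →
            Forchheimer.gradNorm P.β (ρt t + φ t) ^ P.β
              ≤ C * (ENNReal.ofReal
                    (1 + ‖Forchheimer.toL2 (ρ₀ - φ 0)‖ ^ 2 + G t ^ (2 / P.β))
                  + ∫⁻ s in Ioo (t - 1) t, ‖deriv φ s‖ₑ ^ 2) ∧
            ‖Forchheimer.toL2 (deriv ρt t)‖ₑ ^ 2
              ≤ C * (ENNReal.ofReal
                    (1 + ‖Forchheimer.toL2 (ρ₀ - φ 0)‖ ^ 2 + G t ^ (2 / P.β))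
                  + ∫⁻ s in Ioo (t - 1) t,
                      (‖deriv φ s‖ₑ ^ 2 + ‖deriv (Forchheimer.fTilde φ f) s‖ₑ ^ 2))) := by
  have : IsFiniteMeasure (volume.restrict Ω) := isFiniteMeasure_restrict.2 hΩ_fin
  have hPS := Forchheimer.poincareSobolev hd hΩ_open (P.two_mul_div_le_β hdeg) P.β_lt_two.le
  obtain ⟨C, hnorm, hlimnorm, hgrad, hlimgrad, hrate, hlimrate, hgrad_one, hrate_one, hC⟩ :=
    ((Forchheimer.eventually_norm_le hPS).and <|
      (Forchheimer.eventually_limsup_norm_sq_le hPS).and <|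
      (Forchheimer.eventually_gradNorm_le_boundA hPS).and <|
      (Forchheimer.eventually_limsup_gradNorm_le hPS).and <|
      (Forchheimer.eventually_rateSq_le_boundB hPS).and <|
      (Forchheimer.eventually_limsup_rateSq_le hPS).and <|
      (Forchheimer.eventually_gradNorm_le_of_one_le hPS).and <|
      (Forchheimer.eventually_rateSq_le_of_one_le hPS).and <| eventually_gt_atTop 0).exists
  refine ⟨C, hC, fun φ f ρ₀ ρt hreg hsol => ?_⟩
  let u : Forchheimer.Solution P Ω := ⟨φ, f, ρ₀, ρt, hreg, hsol⟩
  exact ⟨hnorm u, hlimnorm u,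
    fun hf hφ => Forchheimer.limsup_norm_sq_eq_zero hPS u (u.limsup_g_eq_zero hf hφ),
    hgrad u, hlimgrad u, Forchheimer.limsup_gradNorm_eq_zero hPS u,
    hrate u, hlimrate u, fun G hG t ht => ⟨hgrad_one u G hG t ht, hrate_one u G hG t ht⟩⟩

theorem theorem4p6 (d : ℕ) (hd : 2 ≤ d) (Ω : Set (EuclideanSpace ℝ (Fin d)))
    (hΩ_open : IsOpen Ω) (hΩ_bdd : Bornology.IsBounded Ω)
    (P : Forchheimer.GenPoly) (hdeg : P.a ≤ 4 / ((d : ℝ) + 2)) :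
    ∃ C : ℝ≥0, 0 < C ∧
      ∀ (φ : ℝ → Forchheimer.H1 Ω) (f : ℝ → Forchheimer.L2 Ω) (ρ₀ : Forchheimer.H1 Ω)
        (ρt : ℝ → Forchheimer.H1 Ω),
        Forchheimer.IsRegularData φ f → Forchheimer.IsWeakSolution P φ f ρ₀ ρt →
        -- bounds of the solution
        (∀ G : ℝ → ℝ, Forchheimer.IsEnvelope (Ioi 0) (Forchheimer.gFun P φ f) G →
          ∀ t : ℝ, 0 < t →
            ‖Forchheimer.toL2 (ρt t)‖
              ≤ C * (1 + ‖Forchheimer.toL2 ρ₀‖ + G t ^ (1 / P.β))) ∧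
        limsup (fun t => ‖Forchheimer.toL2 (ρt t)‖ₑ ^ 2) atTop
          ≤ C * (1 + limsup (fun t => ENNReal.ofReal (Forchheimer.gFun P φ f t)) atTop)
              ^ (2 / P.β) ∧
        (limsup (fun t => ‖Forchheimer.fTilde φ f t‖ₑ) atTop = 0 →
          limsup (fun t => ‖φ t‖ₑ) atTop = 0 →
          limsup (fun t => ‖Forchheimer.toL2 (ρt t)‖ₑ ^ 2) atTop = 0) ∧
        -- bounds of the gradient
        (∀ G : ℝ → ℝ, Forchheimer.IsEnvelope (Ioi 0) (Forchheimer.gFun P φ f) G →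
          ∀ t : ℝ, 0 < t →
            Forchheimer.gradNorm P.β (ρt t + φ t) ^ P.β
              ≤ C * Forchheimer.boundA P φ ρ₀ G t) ∧
        limsup (fun t => Forchheimer.gradNorm P.β (ρt t + φ t) ^ P.β) atTop
          ≤ C * (1 + limsup (fun t => ‖deriv φ t‖ₑ ^ 2) atTop
              + (limsup (fun t => ENNReal.ofReal (Forchheimer.gFun P φ f t)) atTop)
                  ^ (2 / P.β)) ∧
        (limsup (fun t => ‖Forchheimer.fTilde φ f t‖ₑ) atTop = 0 →
          limsup (fun t => ‖φ t‖ₑ) atTop = 0 →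
          limsup (fun t => ‖deriv φ t‖ₑ) atTop = 0 →
          limsup (fun t => Forchheimer.gradNorm P.β (ρt t + φ t)) atTop = 0) ∧
        -- bounds of the time derivative
        (∀ t₀ : ℝ, 0 < t₀ → t₀ < 1 →
          ∀ G : ℝ → ℝ, Forchheimer.IsEnvelope (Ioi 0) (Forchheimer.gFun P φ f) G →
          ∀ t : ℝ, t₀ ≤ t →
            ‖Forchheimer.toL2 (deriv ρt t)‖ₑ ^ 2
              ≤ C * Forchheimer.boundB P φ f ρ₀ G t₀ t) ∧
        limsup (fun t => ‖Forchheimer.toL2 (deriv ρt t)‖ₑ ^ 2) atTop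
          ≤ C * (1 + (limsup (fun t => ENNReal.ofReal (Forchheimer.gFun P φ f t)) atTop)
                  ^ (2 / P.β)
              + limsup (fun t => ‖deriv φ t‖ₑ ^ 2) atTop
              + limsup (fun t => ‖deriv (Forchheimer.fTilde φ f) t‖ₑ ^ 2) atTop) ∧
        -- uniform bounds for `t ≥ 1`
        (∀ G : ℝ → ℝ, Forchheimer.IsEnvelope (Ioi 0) (Forchheimer.gFun P φ f) G →
          ∀ t : ℝ, 1 ≤ t →
            Forchheimer.gradNorm P.β (ρt t + φ t) ^ P.β
              ≤ C * (ENNReal.ofReal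
                    (1 + ‖Forchheimer.toL2 (ρ₀ - φ 0)‖ ^ 2 + G t ^ (2 / P.β))
                  + ∫⁻ s in Ioo (t - 1) t, ‖deriv φ s‖ₑ ^ 2) ∧
            ‖Forchheimer.toL2 (deriv ρt t)‖ₑ ^ 2
              ≤ C * (ENNReal.ofReal
                    (1 + ‖Forchheimer.toL2 (ρ₀ - φ 0)‖ ^ 2 + G t ^ (2 / P.β))
                  + ∫⁻ s in Ioo (t - 1) t,
                      (‖deriv φ s‖ₑ ^ 2 + ‖deriv (Forchheimer.fTilde φ f) s‖ₑ ^ 2))) := by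
  exact theorem4p6_general d hd Ω hΩ_open hΩ_bdd.measure_lt_top.ne P hdeg
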